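/- For a finite (possibly empty) dynamical system $(A,f)$, $f\colon A\to A$, let the height of $x\in A$ be the least $h$ such that $f^h(x)$ is periodic, and let the profile of $(A,f)$ be the sequence $(|A|_i)_{i\in\mathbb N}$, where $|A|_i$ is the number of states of height $i$. Let $\mathbf P$ be the set of all profiles of finite dynamical systems; it is a commutative semiring with the operations $$\mathbf p+\mathbf q=(p_i+q_i)_{i\in\mathbb N},\qquad \mathbf p\times\mathbf q=\Big(p_i\sum_{j=0}^i q_j+q_i\sum_{j=0}^i p_j-p_iq_i\Big)_{i\in\mathbb N}.$$ Encode a profile as the finite sequence $(p_0,\dots,p_h)$ of its terms in binary, where $h$ is the last index of a non-null term (the null profile being written $(0)$). Encode a polynomial $p\in\mathbf P[\vec X]$, in finitely many of the variables $X_0,X_1,\dots$, as a list of terms $\mathbf a\times X_{v_1}^{e_1}\times\cdots\times X_{v_k}^{e_k}$ whose sum is $p$, each given by its coefficient $\mathbf a\in\mathbf P$ and the list of pairs $(v_i,e_i)$ in binary. Then the following two decision problems (as languages of encodings over a finite alphabet) are in $\mathsf{NP}$: 1. given $p\in\mathbf P[\vec X]$ and $\mathbf q\in\mathbf P$, decide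 whether the equation $p(\vec X)=\mathbf q$ has a solution in $\mathbf P$; 2. given a finite system $p_1(\vec X)=\mathbf q_1,\ \dots,\ p_n(\vec X)=\mathbf q_n$ with $p_i\in\mathbf P[\vec X]$ and $\mathbf q_i\in\mathbf P$, decide whether the equations have a common solution in $\mathbf P$. Here a language $L$ is in $\mathsf{NP}$ if there are a deterministic Turing machine $V$, working in polynomial time on pairs of words, and a polynomial $b$, such that $w\in L$ if and only if $V$ accepts $(w,y)$ for some word $y$ with $|y|\le b(|w|)$. -/

import Mathlib

/-! ### Finite dynamical systems and their profiles -/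

/-- The height of the state `x` of the dynamical system `(A, f)`: the least `h` such that
`f^h(x)` is a periodic state. -/
noncomputable def stateHeight {A : Type} (f : A → A) (x : A) : ℕ :=
  sInf {h : ℕ | f^[h] x ∈ Function.periodicPts f}

/-- The profile of the dynamical system `(A, f)`: the sequence counting the states of height
`0, 1, 2, …`. -/
noncomputable def systemProfile {A : Type} (f : A → A) (i : ℕ) : ℕ :=
  Nat.card {x : A // stateHeight f x = i}

/-- A sequence is a profile if it is the profile of some finite (possibly empty) dynamical
system. -/
def IsProfile (p : ℕ → ℕ) : Prop :=
  ∃ (A : Type) (_ : Finite A) (f : A → A), systemProfile f = p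

lemma exists_iterate_mem_periodicPts {A : Type} [Finite A] (f : A → A) (x : A) :
    ∃ h : ℕ, f^[h] x ∈ Function.periodicPts f := by
  obtain ⟨a, b, hab, h⟩ := Finite.exists_ne_map_eq_of_infinite (fun n : ℕ => f^[n] x)
  wlog hlt : a < b generalizing a b
  · exact this b a hab.symm h.symm (lt_of_le_of_ne (not_lt.1 hlt) hab.symm)
  refine ⟨a, Function.mk_mem_periodicPts (n := b - a) (by omega) ?_⟩
  show f^[b - a] (f^[a] x) = f^[a] x
  rw [← Function.iterate_add_apply, Nat.sub_add_cancel hlt.le]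
  exact h.symm

lemma stateHeight_apply {A : Type} [Finite A] (f : A → A) (x : A) (i : ℕ)
    (h : stateHeight f x = i + 1) : stateHeight f (f x) = i := by
  have hmem : f^[i + 1] x ∈ Function.periodicPts f := by
    rw [← h]
    exact Nat.sInf_mem (exists_iterate_mem_periodicPts f x)
  have hle : stateHeight f (f x) ≤ i := Nat.sInf_le (by simpa using hmem)
  refine le_antisymm hle ?_
  have hm : f^[stateHeight f (f x)] (f x) ∈ Function.periodicPts f :=
    Nat.sInf_mem (exists_iterate_mem_periodicPts f (f x))
  have : stateHeight f x ≤ stateHeight f (f x) + 1 := Nat.sInf_le (by simpa using hm)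
  omega

lemma systemProfile_ne_zero {A : Type} [Finite A] (f : A → A) (i : ℕ) :
    systemProfile f i ≠ 0 ↔ ∃ x, stateHeight f x = i := by
  unfold systemProfile
  rw [Nat.card_ne_zero]
  constructor
  · rintro ⟨⟨x⟩, _⟩
    exact ⟨x.1, x.2⟩
  · rintro ⟨x, hx⟩
    exact ⟨⟨x, hx⟩, inferInstance⟩

/-- The canonical system with a given profile: every state of height `0` is a fixed point, and
every state of height `i + 1` is mapped to the first state of height `i`. -/
def canonicalMap (p : ℕ → ℕ) (n : ℕ) (hp : ∀ i, p i ≠ 0 ↔ i < n) :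
    (Σ i : Fin n, Fin (p i)) → (Σ i : Fin n, Fin (p i))
  | ⟨⟨0, h⟩, y⟩ => ⟨⟨0, h⟩, y⟩
  | ⟨⟨i + 1, h⟩, _⟩ =>
      ⟨⟨i, Nat.lt_of_succ_lt h⟩, ⟨0, Nat.pos_of_ne_zero ((hp i).2 (Nat.lt_of_succ_lt h))⟩⟩

lemma canonicalMap_fst (p : ℕ → ℕ) (n : ℕ) (hp : ∀ i, p i ≠ 0 ↔ i < n)
    (x : Σ i : Fin n, Fin (p i)) : ((canonicalMap p n hp x).1 : ℕ) = (x.1 : ℕ) - 1 := by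
  obtain ⟨⟨i, h⟩, y⟩ := x
  cases i <;> simp [canonicalMap]

lemma canonicalMap_iterate_fst (p : ℕ → ℕ) (n : ℕ) (hp : ∀ i, p i ≠ 0 ↔ i < n) (k : ℕ)
    (x : Σ i : Fin n, Fin (p i)) : (((canonicalMap p n hp)^[k] x).1 : ℕ) = (x.1 : ℕ) - k := by
  induction k with
  | zero => simp
  | succ k ih => rw [Function.iterate_succ_apply', canonicalMap_fst, ih]; omega

lemma mem_periodicPts_canonicalMap (p : ℕ → ℕ) (n : ℕ) (hp : ∀ i, p i ≠ 0 ↔ i < n)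
    (x : Σ i : Fin n, Fin (p i)) :
    x ∈ Function.periodicPts (canonicalMap p n hp) ↔ (x.1 : ℕ) = 0 := by
  constructor
  · rintro ⟨k, hk, h⟩
    have h1 := canonicalMap_iterate_fst p n hp k x
    rw [show (canonicalMap p n hp)^[k] x = x from h] at h1
    omega
  · intro h
    obtain ⟨⟨i, hi⟩, y⟩ := x
    obtain rfl : i = 0 := h
    exact Function.mk_mem_periodicPts (n := 1) one_pos rfl

lemma stateHeight_canonicalMap (p : ℕ → ℕ) (n : ℕ) (hp : ∀ i, p i ≠ 0 ↔ i < n)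
    (x : Σ i : Fin n, Fin (p i)) : stateHeight (canonicalMap p n hp) x = x.1 := by
  have h : {k : ℕ | (canonicalMap p n hp)^[k] x ∈ Function.periodicPts (canonicalMap p n hp)}
      = Set.Ici (x.1 : ℕ) := by
    ext k
    simp only [Set.mem_ofPred_eq, mem_periodicPts_canonicalMap, canonicalMap_iterate_fst,
      Set.mem_Ici]
    omega
  unfold stateHeight
  rw [h]
  exact csInf_Ici

/-- A sequence is a profile exactly when its terms are positive up to some point and null from
there on. -/
theorem isProfile_iff (p : ℕ → ℕ) : IsProfile p ↔ ∃ n, ∀ i, p i ≠ 0 ↔ i < n := by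
  constructor
  · rintro ⟨A, _, f, rfl⟩
    have hdown : ∀ i, systemProfile f i = 0 → systemProfile f (i + 1) = 0 := by
      intro i h
      by_contra h'
      obtain ⟨x, hx⟩ := (systemProfile_ne_zero f (i + 1)).1 h'
      exact (systemProfile_ne_zero f i).2 ⟨f x, stateHeight_apply f x i hx⟩ h
    have hex : ∃ n, systemProfile f n = 0 := by
      obtain ⟨n, hn⟩ := (Set.finite_range (stateHeight f)).exists_notMem
      refine ⟨n, ?_⟩
      by_contra h
      obtain ⟨x, hx⟩ := (systemProfile_ne_zero f n).1 h
      exact hn ⟨x, hx⟩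
    refine ⟨Nat.find hex, fun i => ⟨fun h => ?_, fun h => Nat.find_min hex h⟩⟩
    by_contra hlt
    exact h (Nat.le_induction (Nat.find_spec hex) (fun k _ hk => hdown k hk) i (not_lt.1 hlt))
  · rintro ⟨n, hp⟩
    refine ⟨Σ i : Fin n, Fin (p i), inferInstance, canonicalMap p n hp, funext fun i => ?_⟩
    unfold systemProfile
    simp only [stateHeight_canonicalMap]
    by_cases hi : i < n
    · have e : {x : Σ i : Fin n, Fin (p i) // (x.1 : ℕ) = i} ≃ Fin (p i) :=
        { toFun := fun x => Fin.cast (by rw [x.2]) x.1.2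
          invFun := fun y => ⟨⟨⟨i, hi⟩, y⟩, rfl⟩
          left_inv := by
            rintro ⟨⟨⟨j, hj⟩, y⟩, h⟩
            obtain rfl : j = i := h
            rfl
          right_inv := fun y => rfl }
      rw [Nat.card_congr e, Nat.card_eq_fintype_card, Fintype.card_fin]
    · have : IsEmpty {x : Σ i : Fin n, Fin (p i) // (x.1 : ℕ) = i} :=
        ⟨fun x => hi (x.2 ▸ x.1.1.2)⟩
      rw [Nat.card_of_isEmpty]
      by_contra h
      exact hi ((hp i).1 (Ne.symm h))

/-! ### The semiring of profiles -/

/-- The set `𝐏` of profiles. -/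
@[ext]
structure Profile where
  /-- the underlying sequence `(p_i)` -/
  seq : ℕ → ℕ
  isProfile : IsProfile seq

namespace Profile

open Finset

instance : Zero Profile := ⟨⟨fun _ => 0, (isProfile_iff _).2 ⟨0, by simp⟩⟩⟩

instance : One Profile :=
  ⟨⟨fun i => if i = 0 then 1 else 0, (isProfile_iff _).2 ⟨1, by simp⟩⟩⟩

instance : Add Profile where
  add p q := ⟨fun i => p.seq i + q.seq i, by
    obtain ⟨n, hn⟩ := (isProfile_iff _).1 p.isProfile
    obtain ⟨m, hm⟩ := (isProfile_iff _).1 q.isProfile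
    refine (isProfile_iff _).2 ⟨max n m, fun i => ?_⟩
    rw [lt_max_iff, ← hn, ← hm]
    omega⟩

/-- The underlying sequence of the product of two profiles; the subtraction does not truncate. -/
def mulSeq (p q : ℕ → ℕ) (i : ℕ) : ℕ :=
  p i * ∑ j ∈ range (i + 1), q j + q i * ∑ j ∈ range (i + 1), p j - p i * q i

lemma mulSeq_eq (p q : ℕ → ℕ) (i : ℕ) :
    mulSeq p q i = p i * q i + p i * ∑ j ∈ range i, q j + q i * ∑ j ∈ range i, p j := by
  unfold mulSeq
  rw [sum_range_succ, sum_range_succ, mul_add, mul_add, mul_comm (q i) (p i)]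
  omega

lemma sum_mulSeq (p q : ℕ → ℕ) (k : ℕ) :
    ∑ i ∈ range k, mulSeq p q i = (∑ i ∈ range k, p i) * ∑ i ∈ range k, q i := by
  induction k with
  | zero => simp
  | succ k ih => rw [sum_range_succ, ih, mulSeq_eq, sum_range_succ, sum_range_succ]; ring

instance : Mul Profile where
  mul p q := ⟨mulSeq p.seq q.seq, by
    obtain ⟨n, hn⟩ := (isProfile_iff _).1 p.isProfile
    obtain ⟨m, hm⟩ := (isProfile_iff _).1 q.isProfile
    have pos : ∀ (r : ℕ → ℕ) (l : ℕ), (∀ i, r i ≠ 0 ↔ i < l) → ∀ i, 0 < l → 0 < i →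
        ∑ j ∈ range i, r j ≠ 0 := by
      intro r l hr i hl hi h
      exact (hr 0).2 hl (sum_eq_zero_iff.1 h 0 (mem_range.2 hi))
    refine (isProfile_iff _).2 ⟨if n = 0 ∨ m = 0 then 0 else max n m, fun i => ?_⟩
    rw [mulSeq_eq]
    split_ifs with h0
    · have hz : (∀ j, p.seq j = 0) ∨ ∀ j, q.seq j = 0 := by
        rcases h0 with rfl | rfl
        · left; intro j; by_contra h; exact absurd ((hn j).1 h) (by omega)
        · right; intro j; by_contra h; exact absurd ((hm j).1 h) (by omega)
      rcases hz with hz | hz <;> simp [hz]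
    · push Not at h0
      have hp := pos _ _ hn i (by omega)
      have hq := pos _ _ hm i (by omega)
      rw [lt_max_iff, ← hn, ← hm]
      rcases Nat.eq_zero_or_pos i with rfl | hi
      · have h1 := (hn 0).2 (by omega)
        have h2 := (hm 0).2 (by omega)
        simp [h1, h2]
      · have hp := hp hi
        have hq := hq hi
        by_cases h1 : p.seq i = 0 <;> by_cases h2 : q.seq i = 0 <;> simp [h1, h2, hp, hq]⟩

/-- The partial sum `p_0 + ⋯ + p_(k-1)`. -/
def psum (p : Profile) (k : ℕ) : ℕ := ∑ i ∈ range k, p.seq i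

lemma ext_psum {p q : Profile} (h : ∀ k, psum p k = psum q k) : p = q := by
  ext i
  have h1 := h (i + 1)
  have h2 := h i
  simp only [psum, sum_range_succ] at h1 h2
  omega

lemma psum_add (p q : Profile) (k : ℕ) : psum (p + q) k = psum p k + psum q k :=
  sum_add_distrib

lemma psum_mul (p q : Profile) (k : ℕ) : psum (p * q) k = psum p k * psum q k :=
  sum_mulSeq p.seq q.seq k

lemma psum_zero (k : ℕ) : psum 0 k = 0 := sum_eq_zero fun _ _ => rfl

lemma psum_one (k : ℕ) : psum 1 k = if k = 0 then 0 else 1 := by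
  show ∑ i ∈ range k, (if i = 0 then 1 else 0) = _
  cases k <;> simp

lemma psum_one_mul (p : Profile) (k : ℕ) : psum 1 k * psum p k = psum p k := by
  rw [psum_one]
  cases k <;> simp [psum]

instance : CommSemiring Profile where
  add_assoc _ _ _ := ext_psum fun _ => by simp only [psum_add]; ring
  add_comm _ _ := ext_psum fun _ => by simp only [psum_add]; ring
  zero_add _ := ext_psum fun _ => by simp only [psum_add, psum_zero]; ring
  add_zero _ := ext_psum fun _ => by simp only [psum_add, psum_zero]; ring
  nsmul := nsmulRec
  mul_assoc _ _ _ := ext_psum fun _ => by simp only [psum_mul]; ring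
  mul_comm _ _ := ext_psum fun _ => by simp only [psum_mul]; ring
  zero_mul _ := ext_psum fun _ => by simp only [psum_mul, psum_zero]; ring
  mul_zero _ := ext_psum fun _ => by simp only [psum_mul, psum_zero]; ring
  one_mul _ := ext_psum fun _ => by rw [psum_mul, psum_one_mul]
  mul_one _ := ext_psum fun _ => by rw [psum_mul, mul_comm, psum_one_mul]
  left_distrib _ _ _ := ext_psum fun _ => by simp only [psum_mul, psum_add]; ring
  right_distrib _ _ _ := ext_psum fun _ => by simp only [psum_mul, psum_add]; ring

/-- The height of a profile: the last index of a non-null term (and `0` for the null profile). -/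
noncomputable def height (p : Profile) : ℕ := sInf {h : ℕ | p.seq (h + 1) = 0}

/-- A profile written as a finite sequence `(p_0, …, p_h)`, where `h` is its height; the null
profile is written `(0)`. -/
noncomputable def entries (p : Profile) : List ℕ := (List.range (p.height + 1)).map p.seq

end Profile

/-! ### Polynomial equations with a constant right-hand side -/

/-- A term `a × X_(v₁)^(e₁) × ⋯ × X_(vₖ)^(eₖ)`, with coefficient `a ∈ 𝐏` and the list of the pairs
`(vᵢ, eᵢ)` of a variable index and an exponent. -/
structure ProfileTerm where
  coeff : Profile
  factors : List (ℕ × ℕ)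

/-- An equation `t₁ + ⋯ + tₙ = q`, given by the list of the terms `tᵢ` of its left-hand side
and its constant right-hand side `q ∈ 𝐏`. -/
structure ProfileEquation where
  lhs : List ProfileTerm
  rhs : Profile

/-- The polynomial denoted by a term. -/
noncomputable def ProfileTerm.toPoly (t : ProfileTerm) : MvPolynomial ℕ Profile :=
  MvPolynomial.C t.coeff * (t.factors.map fun f => MvPolynomial.X f.1 ^ f.2).prod

/-- The polynomial denoted by a list of terms: their sum. -/
noncomputable def termsToPoly (l : List ProfileTerm) : MvPolynomial ℕ Profile :=
  (l.map ProfileTerm.toPoly).sum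

/-- Every polynomial over `𝐏` is denoted by a list of terms. -/
theorem termsToPoly_surjective : Function.Surjective termsToPoly := by
  intro p
  induction p using MvPolynomial.induction_on' with
  | monomial u a =>
    refine ⟨[⟨a, u.support.toList.map fun i => (i, u i)⟩], ?_⟩
    rw [MvPolynomial.monomial_eq]
    simp only [termsToPoly, ProfileTerm.toPoly, List.map_cons, List.map_nil, List.sum_cons,
      List.sum_nil, add_zero, List.map_map, Function.comp_def, Finset.prod_map_toList]
    rfl
  | add p q hp hq =>
    obtain ⟨l, rfl⟩ := hp
    obtain ⟨m, rfl⟩ := hq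
    exact ⟨l ++ m, by simp [termsToPoly]⟩

/-- The assignment `r` of profiles to the variables is a solution of the equation. -/
def ProfileEquation.IsSolution (E : ProfileEquation) (r : ℕ → Profile) : Prop :=
  MvPolynomial.eval r (termsToPoly E.lhs) = E.rhs

/-! ### Encoding of equations as words -/

/-- The alphabet: binary digits, and end markers for numbers, profiles, terms and polynomials. -/
inductive EqSymbol
  | bit (b : Bool)
  | endNum
  | endProfile
  | endTerm
  | endPoly
  deriving DecidableEq, Fintype

/-- A natural number in binary notation (least significant digit first, without leading zeros). -/
def codeNat (n : ℕ) : List EqSymbol :=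
  (Computability.encodeNat n).map EqSymbol.bit ++ [EqSymbol.endNum]

/-- A profile as the finite sequence of its terms in binary notation. -/
noncomputable def codeProfile (p : Profile) : List EqSymbol :=
  p.entries.flatMap codeNat ++ [EqSymbol.endProfile]

/-- A term: its coefficient followed by its pairs of variable index and exponent. -/
noncomputable def codeTerm (t : ProfileTerm) : List EqSymbol :=
  codeProfile t.coeff ++ t.factors.flatMap (fun f => codeNat f.1 ++ codeNat f.2)
    ++ [EqSymbol.endTerm]

/-- An equation: the terms of its left-hand side, followed by its right-hand side. -/
noncomputable def codeEquation (E : ProfileEquation) : List EqSymbol :=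
  E.lhs.flatMap codeTerm ++ [EqSymbol.endPoly] ++ codeProfile E.rhs

/-- A system of equations: the concatenation of its equations. -/
noncomputable def codeSystem (S : List ProfileEquation) : List EqSymbol :=
  S.flatMap codeEquation

/-! The encodings are injective, so that a word encodes at most one equation or system. -/

lemma flatMap_append_cons_inj {α Γ : Type} {c : α → List Γ} {e : Γ}
    (hc : ∀ x y r s, c x ++ r = c y ++ s → x = y ∧ r = s)
    (he : ∀ x r s, c x ++ r ≠ e :: s) :
    ∀ (l l' : List α) (r s : List Γ),
      l.flatMap c ++ e :: r = l'.flatMap c ++ e :: s → l = l' ∧ r = s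
  | [], [], r, s, h => by simpa using h
  | [], y :: l', r, s, h => by
      simp only [List.flatMap_nil, List.nil_append, List.flatMap_cons, List.append_assoc] at h
      exact absurd h.symm (he _ _ _)
  | x :: l, [], r, s, h => by
      simp only [List.flatMap_nil, List.nil_append, List.flatMap_cons, List.append_assoc] at h
      exact absurd h (he _ _ _)
  | x :: l, y :: l', r, s, h => by
      simp only [List.flatMap_cons, List.append_assoc] at h
      obtain ⟨rfl, h2⟩ := hc _ _ _ _ h
      obtain ⟨rfl, rfl⟩ := flatMap_append_cons_inj hc he l l' r s h2
      exact ⟨rfl, rfl⟩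

lemma codeNat_append_inj (x y : ℕ) (r s : List EqSymbol)
    (h : codeNat x ++ r = codeNat y ++ s) : x = y ∧ r = s := by
  simp only [codeNat, List.append_assoc, List.singleton_append, List.map_eq_flatMap] at h
  obtain ⟨h1, h2⟩ := flatMap_append_cons_inj (by simp) (by simp) _ _ _ _ h
  exact ⟨Computability.encodingNatBool.encode_injective h1, h2⟩

lemma codeNat_append_ne (x : ℕ) (r s : List EqSymbol) (e : EqSymbol)
    (he : e ≠ .endNum) (he' : ∀ b, e ≠ .bit b) : codeNat x ++ r ≠ e :: s := by
  unfold codeNat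
  cases Computability.encodeNat x with
  | nil => simpa using fun h => absurd h.symm he
  | cons b l => simpa using fun h => absurd h.symm (he' b)

lemma Profile.entries_injective : Function.Injective Profile.entries := by
  have hz : ∀ (p : Profile) (i : ℕ), p.height < i → p.seq i = 0 := by
    intro p i hi
    obtain ⟨n, hn⟩ := (isProfile_iff _).1 p.isProfile
    have hne : p.seq (p.height + 1) = 0 :=
      Nat.sInf_mem (s := {h : ℕ | p.seq (h + 1) = 0})
        ⟨n, by_contra fun h => absurd ((hn _).1 h) (by omega)⟩
    by_contra h
    exact (hn _).2 (lt_of_le_of_lt hi ((hn i).1 h)) hne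
  intro p q h
  have hl : p.height = q.height := by simpa [Profile.entries] using congrArg List.length h
  ext i
  by_cases hi : i < p.height + 1
  · simp only [Profile.entries, ← hl, List.map_inj_left, List.mem_range] at h
    exact h i hi
  · rw [hz p i (by omega), hz q i (by omega)]

lemma codeProfile_append_inj (p q : Profile) (r s : List EqSymbol)
    (h : codeProfile p ++ r = codeProfile q ++ s) : p = q ∧ r = s := by
  simp only [codeProfile, List.append_assoc, List.singleton_append] at h
  obtain ⟨h1, h2⟩ := flatMap_append_cons_inj codeNat_append_inj
    (fun x r s => codeNat_append_ne x r s _ (by simp) (by simp)) _ _ _ _ h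
  exact ⟨Profile.entries_injective h1, h2⟩

lemma codeProfile_append_ne (p : Profile) (r s : List EqSymbol) :
    codeProfile p ++ r ≠ .endPoly :: s := by
  simp only [codeProfile]
  cases p.entries with
  | nil => simp
  | cons x l =>
    simp only [List.flatMap_cons, List.append_assoc]
    exact codeNat_append_ne x _ s _ (by simp) (by simp)

lemma codeTerm_append_inj (t u : ProfileTerm) (r s : List EqSymbol)
    (h : codeTerm t ++ r = codeTerm u ++ s) : t = u ∧ r = s := by
  simp only [codeTerm, List.append_assoc, List.singleton_append] at h
  obtain ⟨h1, h2⟩ := codeProfile_append_inj _ _ _ _ h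
  obtain ⟨h3, h4⟩ := flatMap_append_cons_inj
    (fun x y r s h => by
      simp only [List.append_assoc] at h
      obtain ⟨h1, h2⟩ := codeNat_append_inj _ _ _ _ h
      obtain ⟨h3, h4⟩ := codeNat_append_inj _ _ _ _ h2
      exact ⟨Prod.ext h1 h3, h4⟩)
    (fun x r s => by
      rw [List.append_assoc]
      exact codeNat_append_ne _ _ s _ (by simp) (by simp)) _ _ _ _ h2
  cases t
  cases u
  simp_all

lemma codeEquation_append_inj (E F : ProfileEquation) (r s : List EqSymbol)
    (h : codeEquation E ++ r = codeEquation F ++ s) : E = F ∧ r = s := by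
  simp only [codeEquation, List.append_assoc, List.singleton_append] at h
  obtain ⟨h1, h2⟩ := flatMap_append_cons_inj codeTerm_append_inj
    (fun x r s => by
      simp only [codeTerm, List.append_assoc]
      exact codeProfile_append_ne _ _ _) _ _ _ _ h
  obtain ⟨h3, h4⟩ := codeProfile_append_inj _ _ _ _ h2
  cases E
  cases F
  simp_all

theorem codeEquation_injective : Function.Injective codeEquation := fun E F h =>
  (codeEquation_append_inj E F [] [] (by simpa using h)).1

theorem codeSystem_injective : Function.Injective codeSystem := by
  intro S
  induction S with
  | nil =>
    rintro (_ | ⟨F, T⟩) h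
    · rfl
    · simp [codeSystem, codeEquation] at h
  | cons E S ih =>
    rintro (_ | ⟨F, T⟩) h
    · simp [codeSystem, codeEquation] at h
    · simp only [codeSystem, List.flatMap_cons] at h
      obtain ⟨rfl, h'⟩ := codeEquation_append_inj _ _ _ _ h
      rw [ih h']

/-- The decision problem of the solvability in `𝐏` of an equation `p(X) = q` with a constant
right-hand side. -/
def SolvableEquations : Language EqSymbol :=
  {w | ∃ E : ProfileEquation, codeEquation E = w ∧ ∃ r : ℕ → Profile, E.IsSolution r}

/-- The decision problem of the solvability in `𝐏` of a finite system of equations `pᵢ(X) = qᵢ`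
with constant right-hand sides. -/
def SolvableSystems : Language EqSymbol :=
  {w | ∃ S : List ProfileEquation, codeSystem S = w ∧
    ∃ r : ℕ → Profile, ∀ E ∈ S, E.IsSolution r}

/-! ### The complexity class NP -/

/-- A language `L` is in NP if there are a finite alphabet `Δ` for certificates, a verifier `V`
computable by a (multi-stack) Turing machine in polynomial time on every pair of words, and a
polynomial `b` such that a word `w` is in `L` if and only if `V` accepts `(w, y)` for some
certificate `y` of length at most `b(|w|)`. -/
def InNP {Γ : Type} (L : Language Γ) : Prop :=
  ∃ (Δ : Type) (_ : Fintype Δ) (V : List Γ × List Δ → Bool) (b : Polynomial ℕ),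
    Nonempty (Turing.TM2ComputableInPolyTime
      (Computability.encodingProd (Computability.encodingList Γ)
        (Computability.encodingList Δ)).encode
      Computability.encodeBool V) ∧
    ∀ w : List Γ, w ∈ L ↔ ∃ y : List Δ, y.length ≤ b.eval w.length ∧ V (w, y) = true

/-! ### Closure properties of regular languages -/

namespace Language

open Computability

variable {α : Type}

/-! Reduction to ℕ. For every `k`, sending a profile to the sum of its terms of index at most `k` is
a homomorphism of semirings to ℕ (`psumHom`), and together these maps separate profiles
(`ext_psum`). An equation over profiles is therefore a family of equations over ℕ, one for each `k`,
all with the same shape. Past the largest height of the profiles involved the equations repeat, so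
finitely many of them suffice (`isSolution_of_headSolution`).

Short solutions. Adding a profile, or multiplying by a non-null one, can only enlarge the support
and the partial sums (`dominated_add`, `dominated_mul`). Hence, in a solution, a variable with a
positive exponent in a term of non-null value is dominated by a right-hand side: its height and its
number of states are bounded by those of a constant of the input (`restrict_dominated`). All other
variables can be made null without changing the value of any term (`eval_restrict`). A solvable
system thus has a solution in which every profile has an encoding of polynomial length.

Fast verification. Exponents are in binary, so a power may be too long to write down. In a term of
non-zero value, however, all partial products are at most the right-hand side `q`, and the squares
that arise in fast exponentiation are essentially bounded by `q * q` (`size_pow_le`). A term of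
value zero is never multiplied out: its null coefficient, or the place of a null factor, is guessed
(`runs_evaluateTerm`).

Machines. The certificate is the complete list of stack actions of a nondeterministic computation,
and a program is a regular expression over these actions. Since regular expressions denote regular
languages, one fixed kind of Turing machine, which executes the actions while running a finite
automaton on them, verifies any program (`inNP_of_regular`). What remains for each program is
soundness (every executable word of actions has the intended effect, expressed by `Rel`) and
completeness (some word of polynomial length has it, expressed by `Runs`); `Det` combines both where
the outcome is forced. The program `verify` parses the input while replacing profiles by their
partial sums, substitutes guessed profiles for the variables, and checks the equations over ℕ round
by round, dropping one partial sum from each list after every round. -/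

theorem IsRegular.mul {L M : Language α} (hL : L.IsRegular) (hM : M.IsRegular) :
    (L * M).IsRegular := by
  rw [isRegular_iff_finite_range_leftQuotient] at *
  -- The quotient of `L * M` by `x` is the quotient of `L` by `x`, times `M`, together with the
  -- quotients of `M` by those `v` for which `x = u ++ v` with `u ∈ L`. It is determined by one
  -- quotient of `L` and a set of quotients of `M`.
  refine ((hL.prod hM.powerset).image fun p : Language α × Set (Language α) =>
    p.1 * M ⊔ sSup p.2).subset ?_
  rintro _ ⟨x, rfl⟩
  refine ⟨(L.leftQuotient x, {N | ∃ u ∈ L, ∃ v, u ++ v = x ∧ N = M.leftQuotient v}),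
    ⟨⟨x, rfl⟩, ?_⟩, ?_⟩
  · rintro _ ⟨u, -, v, -, rfl⟩
    exact ⟨v, rfl⟩
  · ext y
    show (y ∈ L.leftQuotient x * M ∨ y ∈ Set.sUnion _) ↔ x ++ y ∈ L * M
    simp only [Language.mem_mul]
    constructor
    · rintro (⟨a, ha, b, hb, rfl⟩ | ⟨_, ⟨u, hu, v, rfl, rfl⟩, hy⟩)
      · exact ⟨x ++ a, ha, b, hb, by simp⟩
      · exact ⟨u, hu, v ++ y, hy, by simp⟩
    · rintro ⟨a, ha, b, hb, h⟩
      rcases List.append_eq_append_iff.1 h with ⟨c, rfl, rfl⟩ | ⟨c, rfl, rfl⟩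
      · exact .inr ⟨_, ⟨a, ha, c, rfl, rfl⟩, hb⟩
      · exact .inl ⟨c, ha, b, hb, rfl⟩

/-- The boundary between `x` and `y` cuts one of the factors, and `v` is the part of this factor
that lies in `x`. If the boundary falls between two factors, `v` is the whole preceding one, which
is why `x` must not be empty. -/
lemma exists_split_of_flatten_eq {L : Language α} (S : List (List α)) (hS : ∀ a ∈ S, a ∈ L)
    (x y : List α) (hx : x ≠ []) (h : S.flatten = x ++ y) :
    ∃ u ∈ L∗, ∃ v, u ++ v = x ∧ y ∈ L.leftQuotient v * L∗ := by
  induction S generalizing x with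
  | nil => simp_all
  | cons a S ih =>
    have hS' : ∀ a ∈ S, a ∈ L := fun b hb => hS b (by simp [hb])
    have ha : a ∈ L := hS a (by simp)
    have hk : S.flatten ∈ L∗ := ⟨S, rfl, hS'⟩
    rw [List.flatten_cons] at h
    rcases List.append_eq_append_iff.1 h with ⟨c, rfl, h'⟩ | ⟨c, rfl, rfl⟩
    · rcases eq_or_ne c [] with rfl | hc
      · exact ⟨[], nil_mem_kstar L, a, by simp, [], (mem_leftQuotient _ _).2 (by simpa using ha), _, hk, by simpa using h'⟩
      · obtain ⟨u, hu, v, rfl, hy⟩ := ih hS' c hc h'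
        obtain ⟨T, rfl, hT⟩ := hu
        exact ⟨a ++ T.flatten, ⟨a :: T, by simp, by simpa using ⟨ha, hT⟩⟩, v, by simp, hy⟩
    · exact ⟨[], nil_mem_kstar L, x, rfl, c, ha, _, hk, rfl⟩

theorem IsRegular.kstar {L : Language α} (hL : L.IsRegular) : (L∗).IsRegular := by
  rw [isRegular_iff_finite_range_leftQuotient] at *
  -- For non-empty `x`, the quotient of `L∗` by `x` is the union of the languages `N * L∗`, where
  -- `N` is the quotient of `L` by some `v` with `x = u ++ v` and `u ∈ L∗`. Only finitely many sets
  -- of such `N` exist. The empty word contributes `L∗` itself.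
  refine ((hL.powerset.image fun B : Set (Language α) =>
    sSup ((fun N => N * L∗) '' B)).insert L∗).subset ?_
  rintro _ ⟨x, rfl⟩
  rcases eq_or_ne x [] with rfl | hx
  · exact .inl (leftQuotient_nil _)
  · refine .inr ⟨{N | ∃ u ∈ L∗, ∃ v, u ++ v = x ∧ N = L.leftQuotient v}, ?_, ?_⟩
    · rintro _ ⟨u, -, v, -, rfl⟩
      exact ⟨v, rfl⟩
    · ext y
      show (∃ t ∈ _, y ∈ t) ↔ x ++ y ∈ L∗
      constructor
      · rintro ⟨_, ⟨_, ⟨u, ⟨S, rfl, hS⟩, v, rfl, rfl⟩, rfl⟩, a, ha, _, ⟨T, rfl, hT⟩, rfl⟩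
        refine ⟨S ++ (v ++ a) :: T, by simp, fun b hb => ?_⟩
        rcases List.mem_append.1 hb with hb | hb
        · exact hS b hb
        · rcases List.mem_cons.1 hb with rfl | hb
          · exact ha
          · exact hT b hb
      · rintro ⟨S, h, hS⟩
        obtain ⟨u, hu, v, hv, hy⟩ := exists_split_of_flatten_eq S hS x y hx h.symm
        exact ⟨_, ⟨_, ⟨u, hu, v, hv, rfl⟩, rfl⟩, hy⟩

theorem isRegular_of_forall_length_le_one {L : Language α} [Finite α]
    (h : ∀ x ∈ L, x.length ≤ 1) : L.IsRegular := by
  rw [isRegular_iff_finite_range_leftQuotient]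
  refine ((Set.finite_range fun x : Option α => L.leftQuotient x.toList).insert ⊥).subset ?_
  rintro _ ⟨x, rfl⟩
  match x with
  | [] => exact .inr ⟨none, rfl⟩
  | [a] => exact .inr ⟨some a, rfl⟩
  | a :: b :: l =>
    refine .inl ?_
    ext y
    refine ⟨fun hy => ?_, fun hy => hy.elim⟩
    have := h _ ((mem_leftQuotient _ _).1 hy)
    simp at this

end Language

theorem RegularExpression.isRegular_matches' {α : Type} [Finite α] (P : RegularExpression α) :
    P.matches'.IsRegular := by
  induction P with
  | zero => exact Language.isRegular_of_forall_length_le_one fun x hx => hx.elim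
  | epsilon =>
    refine Language.isRegular_of_forall_length_le_one fun x hx => ?_
    rw [(Language.mem_one x).1 hx]
    simp
  | char a =>
    refine Language.isRegular_of_forall_length_le_one fun x hx => ?_
    rw [show x = [a] from hx]
    simp
  | plus P Q hP hQ => exact hP.add hQ
  | comp P Q hP hQ => exact hP.mul hQ
  | star P hP => exact hP.kstar

/-! ### Nondeterministic stack programs and the class NP -/

/-- The elementary actions of a machine with conts indexed by `K` over the alphabet `S`. -/
inductive StackAction (K S : Type)
  | push (k : K) (s : S)
  | pop (k : K) (s : S)
  | isEmpty (k : K)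
  deriving Fintype

namespace StackAction

variable {K S : Type} [DecidableEq K] [DecidableEq S]

/-- The effect of an action on the stacks; popping fails if the top of the stack is not the
expected symbol, and `isEmpty` fails if the stack is not empty. -/
def exec : StackAction K S → (K → List S) → Option (K → List S)
  | push k s, T => some (Function.update T k (s :: T k))
  | pop k s, T => if (T k).head? = some s then some (Function.update T k (T k).tail) else none
  | isEmpty k, T => if (T k).head? = none then some T else none

/-- The effect of a sequence of actions. -/
def execAll : List (StackAction K S) → (K → List S) → Option (K → List S)
  | [], T => some T
  | a :: l, T => (a.exec T).bind (execAll l)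

/-- One move of the verifier: the stacks are modified, and the state `none` records a failure. -/
def move {Q : Type} (δ : Q → StackAction K S → Q) (a : StackAction K S) :
    Option Q × (K → List S) → Option Q × (K → List S)
  | (q, T) =>
    match a with
    | push k s => (q.map fun q => δ q (push k s), Function.update T k (s :: T k))
    | pop k s => (if (T k).head? = some s then q.map fun q => δ q (pop k s) else none,
        Function.update T k (T k).tail)
    | isEmpty k => (if (T k).head? = none then q.map fun q => δ q (isEmpty k) else none, T)

@[simp] lemma move_push {Q : Type} (δ : Q → StackAction K S → Q) (c : Option Q × (K → List S))
    (k : K) (s : S) : move δ (push k s) c =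
      (c.1.map fun q => δ q (push k s), Function.update c.2 k (s :: c.2 k)) := rfl

@[simp] lemma move_pop {Q : Type} (δ : Q → StackAction K S → Q) (c : Option Q × (K → List S))
    (k : K) (s : S) : move δ (pop k s) c =
      (if (c.2 k).head? = some s then c.1.map fun q => δ q (pop k s) else none,
        Function.update c.2 k (c.2 k).tail) := rfl

@[simp] lemma move_isEmpty {Q : Type} (δ : Q → StackAction K S → Q)
    (c : Option Q × (K → List S)) (k : K) : move δ (isEmpty k) c =
      (if (c.2 k).head? = none then c.1.map fun q => δ q (isEmpty k) else none, c.2) := rfl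

lemma foldl_move_none {Q : Type} (δ : Q → StackAction K S → Q) (y : List (StackAction K S))
    (T : K → List S) : (y.foldl (fun c a => move δ a c) (none, T)).1 = none := by
  induction y generalizing T with
  | nil => rfl
  | cons a y ih => cases a <;> simp [ih]

/-- `move` is total: after a failure the rest of the certificate is still consumed, with `none` as
an absorbing state. The final state thus combines two tests, whether all actions could be executed
and where the automaton ends. -/
lemma foldl_move {Q : Type} (δ : Q → StackAction K S → Q) (y : List (StackAction K S)) (q : Q)
    (T : K → List S) : (y.foldl (fun c a => move δ a c) (some q, T)).1 =
      (execAll y T).map fun _ => y.foldl δ q := by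
  induction y generalizing T q with
  | nil => rfl
  | cons a y ih =>
    cases a with
    | push k s => simp [execAll, exec, ih]
    | pop k s =>
      by_cases h : (T k).head? = some s <;> simp [execAll, exec, ih, h, foldl_move_none]
    | isEmpty k =>
      by_cases h : T k = [] <;> simp [execAll, exec, ih, h, foldl_move_none]

lemma length_move {Q : Type} (δ : Q → StackAction K S → Q) (a : StackAction K S) (q : Option Q)
    (T : K → List S) (k : K) : ((move δ a (q, T)).2 k).length ≤ (T k).length + 1 := by
  cases a with
  | push j s => rcases eq_or_ne k j with rfl | h <;> simp [*]
  | pop j s =>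
    rcases eq_or_ne k j with rfl | h
    · simp only [move_pop, Function.update_self, List.length_tail]
      omega
    · simp [h]
  | isEmpty j => simp

end StackAction

/-! ### The Turing machine which executes a certificate -/

namespace StackVerifier

open Turing StackAction

variable (Γ K S Q : Type) [DecidableEq K]

/-- The stacks of the verifier: the input, the output and the stacks of the program. -/
inductive Stk
  | inp
  | out
  | work (k : K)
  deriving DecidableEq, Fintype

/-- The stack alphabets of the verifier. -/
@[reducible] def Sym : Stk K → Type
  | .inp => Γ ⊕ StackAction K S
  | .out => Bool
  | .work _ => S

/-- The labels of the verifier. -/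
inductive Lab
  | main
  | feed (s : S)
  | act (a : StackAction K S)
  | clear
  deriving Fintype

/-- The internal state of the verifier: the last symbol read from the input, the state of the
control automaton (`none` after a failure), and a flag used when the stacks are cleared. -/
structure Var where
  reg : Option (Γ ⊕ StackAction K S)
  state : Option Q
  flag : Bool

variable {Γ K S Q}

/-- The stacks of the verifier with given contents. -/
def conts (i : List (Γ ⊕ StackAction K S)) (o : List Bool) (T : K → List S) :
    ∀ k, List (Sym Γ K S k)
  | .inp => i
  | .out => o
  | .work k => T k

lemma update_conts_inp (i i' : List (Γ ⊕ StackAction K S)) (o : List Bool) (T : K → List S) :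
    Function.update (conts i o T) .inp i' = conts i' o T := by
  funext k; cases k <;> simp [conts]

lemma update_conts_out (i : List (Γ ⊕ StackAction K S)) (o o' : List Bool) (T : K → List S) :
    Function.update (conts i o T) .out o' = conts i o' T := by
  funext k; cases k <;> simp [conts]

lemma update_conts_work (i : List (Γ ⊕ StackAction K S)) (o : List Bool) (T : K → List S) (k : K)
    (l : List S) :
    Function.update (conts i o T) (.work k) l = conts i o (Function.update T k l) := by
  funext j
  cases j with
  | inp => simp [conts]
  | out => simp [conts]
  | work j => rcases eq_or_ne j k with rfl | h <;> simp [conts, *]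

variable [DecidableEq S]

/-- The statement which executes an action. -/
def actStmt (δ : Q → StackAction K S → Q) :
    StackAction K S → TM2.Stmt (Sym Γ K S) (Lab K S) (Var Γ K S Q)
  | push k s => .push (.work k) (fun _ => s) <|
      .load (fun v => ⟨none, v.state.map fun q => δ q (push k s), false⟩) <| .goto fun _ => .main
  | pop k s => .pop (.work k) (fun v x => ⟨none,
      if x = some s then v.state.map fun q => δ q (pop k s) else none, false⟩) <|
      .goto fun _ => .main
  | isEmpty k => .peek (.work k) (fun v x => ⟨none,
      if x = none then v.state.map fun q => δ q (isEmpty k) else none, false⟩) <|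
      .goto fun _ => .main

/-- The statement which removes the top symbols of all the conts in a list, and continues with
`r` if no symbol was found, and with the label `clear` otherwise. -/
def clearStmt (r : TM2.Stmt (Sym Γ K S) (Lab K S) (Var Γ K S Q)) :
    List K → TM2.Stmt (Sym Γ K S) (Lab K S) (Var Γ K S Q)
  | [] => .branch (fun v => v.flag)
      (.load (fun v => ⟨none, v.state, false⟩) <| .goto fun _ => .clear) r
  | k :: l => .pop (.work k) (fun v x => ⟨none, v.state, v.flag || x.isSome⟩) (clearStmt r l)

/-- The final statement. -/
def finalStmt (q₀ : Q) (acc : Q → Bool) : TM2.Stmt (Sym Γ K S) (Lab K S) (Var Γ K S Q) :=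
  .push .out (fun v => v.state.elim false acc) <| .load (fun _ => ⟨none, some q₀, false⟩) .halt

/-- The program of the verifier: the word is moved to the stack `k₀`, the actions of the
certificate are executed, and finally the stacks are cleared. -/
def program (emb : Γ → S) (k₀ : K) (δ : Q → StackAction K S → Q) (q₀ : Q) (acc : Q → Bool)
    (l : List K) : Lab K S → TM2.Stmt (Sym Γ K S) (Lab K S) (Var Γ K S Q)
  | .main => .pop .inp (fun v x => ⟨x, v.state, false⟩) <| .goto fun v => match v.reg with
      | some (.inl g) => .feed (emb g)
      | some (.inr a) => .act a
      | none => .clear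
  | .feed s => .push (.work k₀) (fun _ => s) <| .load (fun v => ⟨none, v.state, false⟩) <|
      .goto fun _ => .main
  | .act a => actStmt δ a
  | .clear => clearStmt (finalStmt q₀ acc) l


section

variable [Fintype K] [Fintype S] [Fintype Γ] [Fintype Q]

noncomputable instance : Fintype (Var Γ K S Q) :=
  haveI : Finite (Var Γ K S Q) := Finite.of_injective
    (fun v => (v.reg, v.state, v.flag)) fun v w h => by
      cases v; cases w; simpa using h
  Fintype.ofFinite _

/-- The verifier as a Turing machine. -/
noncomputable def machine (emb : Γ → S) (k₀ : K) (δ : Q → StackAction K S → Q) (q₀ : Q)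
    (acc : Q → Bool) : FinTM2 where
  K := Stk K
  k₀ := .inp
  k₁ := .out
  Γ := Sym Γ K S
  Λ := Lab K S
  main := .main
  σ := Var Γ K S Q
  initialState := ⟨none, some q₀, false⟩
  Γk₀Fin := inferInstanceAs (Fintype (Γ ⊕ StackAction K S))
  m := program emb k₀ δ q₀ acc Finset.univ.toList

end

/-- `f` leads from `a` to `b` in at most `n` steps. -/
def Leads {σ : Type} (f : σ → Option σ) (a b : σ) (n : ℕ) : Prop :=
  ∃ m ≤ n, (flip bind f)^[m] (some a) = some b

lemma Leads.refl {σ : Type} {f : σ → Option σ} (a : σ) : Leads f a a 0 := ⟨0, le_rfl, rfl⟩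

lemma Leads.trans {σ : Type} {f : σ → Option σ} {a b c : σ} {m n : ℕ} (h : Leads f a b m)
    (h' : Leads f b c n) : Leads f a c (m + n) := by
  obtain ⟨i, hi, h⟩ := h
  obtain ⟨j, hj, h'⟩ := h'
  exact ⟨j + i, by omega, by rw [Function.iterate_add_apply, h, h']⟩

lemma Leads.head {σ : Type} {f : σ → Option σ} {a b c : σ} {n : ℕ} (h : f a = some b)
    (h' : Leads f b c n) : Leads f a c (n + 1) := by
  obtain ⟨j, hj, h'⟩ := h'
  exact ⟨j + 1, by omega, by rw [Function.iterate_succ_apply]; simpa [flip, h] using h'⟩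

lemma Leads.mono {σ : Type} {f : σ → Option σ} {a b : σ} {m n : ℕ} (h : Leads f a b m)
    (hmn : m ≤ n) : Leads f a b n := by
  obtain ⟨i, hi, h⟩ := h
  exact ⟨i, by omega, h⟩

section

variable (emb : Γ → S) (k₀ : K) (δ : Q → StackAction K S → Q) (q₀ : Q) (acc : Q → Bool)
  (l : List K)

/-- Each letter takes two steps, one for reading and one for pushing. Pushing reverses the word, so
its last letter ends up on top of the stack `k₀`. -/
lemma leads_feed (w : List Γ) (i : List (Γ ⊕ StackAction K S)) (q : Option Q)
    (T : K → List S) :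
    Leads (TM2.step (program emb k₀ δ q₀ acc l))
      ⟨some .main, ⟨none, q, false⟩, conts (w.map .inl ++ i) [] T⟩
      ⟨some .main, ⟨none, q, false⟩,
        conts i [] (Function.update T k₀ (w.reverse.map emb ++ T k₀))⟩ (2 * w.length) := by
  induction w generalizing T with
  | nil => simpa using Leads.refl _
  | cons g w ih =>
    have h := ih (Function.update T k₀ (emb g :: T k₀))
    simp only [Function.update_self, Function.update_idem] at h
    rw [show w.reverse.map emb ++ emb g :: T k₀ = (g :: w).reverse.map emb ++ T k₀ by simp] at h
    refine (Leads.head (b := ⟨some (.feed (emb g)), ⟨some (.inl g), q, false⟩,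
      conts (w.map .inl ++ i) [] T⟩) ?_ (Leads.head ?_ h)).mono (by simp; omega)
    · simp [TM2.step, TM2.stepAux, program, conts, update_conts_inp]
    · simp [TM2.step, TM2.stepAux, program, conts, update_conts_work]

lemma leads_act (y : List (StackAction K S)) (q : Option Q) (T : K → List S) :
    Leads (TM2.step (program emb k₀ δ q₀ acc l))
      ⟨some .main, ⟨none, q, false⟩, conts (y.map .inr) [] T⟩
      ⟨some .main, ⟨none, (y.foldl (fun c a => move δ a c) (q, T)).1, false⟩,
        conts [] [] (y.foldl (fun c a => move δ a c) (q, T)).2⟩ (2 * y.length) := by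
  induction y generalizing q T with
  | nil => exact Leads.refl _
  | cons a y ih =>
    have h := ih (move δ a (q, T)).1 (move δ a (q, T)).2
    refine (Leads.head (b := ⟨some (.act a), ⟨some (.inr a), q, false⟩,
      conts (y.map .inr) [] T⟩) ?_ (Leads.head ?_ h)).mono (by simp; omega)
    · simp [TM2.step, TM2.stepAux, program, conts, update_conts_inp]
    · cases a with
      | pop k s => simp [TM2.step, TM2.stepAux, program, actStmt, conts, update_conts_work]; congr
      | _ => simp [TM2.step, TM2.stepAux, program, actStmt, conts, update_conts_work]

omit [DecidableEq S] in
-- A pass over the list pops one symbol from every stack within a single machine step, and the flag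
-- records whether anything was found. Without repetitions in the list, each stack is popped exactly
-- once.
lemma stepAux_clearStmt (r : TM2.Stmt (Sym Γ K S) (Lab K S) (Var Γ K S Q)) (hl : l.Nodup)
    (q : Option Q) (b : Bool) (i : List (Γ ⊕ StackAction K S)) (o : List Bool)
    (T : K → List S) :
    TM2.stepAux (clearStmt r l) ⟨none, q, b⟩ (conts i o T) =
      bif b || l.any fun k => !(T k).isEmpty then
        ⟨some .clear, ⟨none, q, false⟩, conts i o fun k => if k ∈ l then (T k).tail else T k⟩
      else TM2.stepAux r ⟨none, q, false⟩
        (conts i o fun k => if k ∈ l then (T k).tail else T k) := by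
  induction l generalizing b T with
  | nil => cases b <;> simp [clearStmt]
  | cons k l ih =>
    obtain ⟨hk, hl⟩ := List.nodup_cons.1 hl
    have h1 : (fun j => if j ∈ l then (Function.update T k (T k).tail j).tail
        else Function.update T k (T k).tail j) =
        fun j => if j ∈ k :: l then (T j).tail else T j := by
      funext j
      rcases eq_or_ne j k with rfl | h <;> simp [*]
    have h2 : (l.any fun j => !(Function.update T k (T k).tail j).isEmpty) =
        l.any fun j => !(T j).isEmpty := by
      rw [Bool.eq_iff_iff]
      simp only [List.any_eq_true]
      refine exists_congr fun j => and_congr_right fun hj => ?_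
      have hjk : j ≠ k := fun e => hk (e ▸ hj)
      rw [Function.update_of_ne hjk]
    have h3 : (T k).head?.isSome = !(T k).isEmpty := by cases T k <;> rfl
    rw [clearStmt, TM2.stepAux, update_conts_work]
    simp only [conts]
    rw [ih hl, h1, h2, h3, List.any_cons, Bool.or_assoc]

/-- The prescribed halting configuration has every stack empty except the output, hence the
cleaning. Every pass lowers all non-empty stacks by one; the first pass that finds nothing writes
the verdict. -/
lemma leads_clear (hl : l.Nodup) (hl' : ∀ k, k ∈ l) (n : ℕ) (q : Option Q) (T : K → List S)
    (hT : ∀ k, (T k).length ≤ n) :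
    Leads (TM2.step (program (Γ := Γ) emb k₀ δ q₀ acc l))
      ⟨some .clear, ⟨none, q, false⟩, conts [] [] T⟩
      ⟨none, ⟨none, some q₀, false⟩, conts [] [q.elim false acc] fun _ => []⟩ (n + 1) := by
  induction n generalizing T with
  | zero =>
    refine Leads.head ?_ (Leads.refl _)
    have h : T = fun _ => [] := funext fun k => List.length_eq_zero_iff.1 (by simpa using hT k)
    have h0 : (l.any fun _ => false) = false := List.any_eq_false.2 (by simp)
    simp [TM2.step, program, stepAux_clearStmt _ _ hl, h, h0, finalStmt, update_conts_out, conts]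
  | succ n ih =>
    by_cases h : ∀ k, T k = []
    · exact (ih T (by simp [h])).mono (by omega)
    · have h' : (l.any fun k => !(T k).isEmpty) = true := by
        push Not at h
        obtain ⟨k, hk⟩ := h
        exact List.any_eq_true.2 ⟨k, hl' k, by simpa using hk⟩
      refine Leads.head ?_ (ih (fun k => (T k).tail) fun k => ?_)
      · simp [TM2.step, program, stepAux_clearStmt _ _ hl, h', hl']
      · have := hT k
        simp only [List.length_tail]
        omega

end

/-- An action adds at most one symbol, so the time needed to clear the stacks is linear in the
length of the certificate. -/
lemma length_foldl_move (δ : Q → StackAction K S → Q) (y : List (StackAction K S))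
    (c : Option Q × (K → List S)) (k : K) :
    ((y.foldl (fun c a => move δ a c) c).2 k).length ≤ (c.2 k).length + y.length := by
  induction y generalizing c with
  | nil => rfl
  | cons a y ih =>
    have h1 := ih (move δ a c)
    have h2 := length_move δ a c.1 c.2 k
    simp only [List.foldl_cons, List.length_cons, Prod.mk.eta] at *
    omega

end StackVerifier

open StackVerifier in
/-- A language is in NP if its words are those from which some word of actions in a regular
language, of polynomial length, can be executed. -/
theorem inNP_of_regular {Γ K S : Type} [Fintype Γ] [Fintype K] [DecidableEq K] [Fintype S]
    [DecidableEq S] (emb : Γ → S) (k₀ : K) (P : Language (StackAction K S)) (hP : P.IsRegular)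
    (b : Polynomial ℕ) (L : Language Γ)
    (h : ∀ w : List Γ, w ∈ L ↔ ∃ y ∈ P, y.length ≤ b.eval w.length ∧
      (StackAction.execAll y (Function.update (fun _ => []) k₀ (w.reverse.map emb))).isSome) :
    InNP L := by
  classical
  obtain ⟨Q, _, M, rfl⟩ := hP
  let acc : Q → Bool := fun q => decide (q ∈ M.accept)
  -- Acceptance means that no action failed and that the automaton, run on the actions of the
  -- certificate, ends in an accepting state.
  let V : List Γ × List (StackAction K S) → Bool := fun p =>
    (p.2.foldl (fun c a => StackAction.move M.step a c) (some M.start,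
      Function.update (fun _ => []) k₀ (p.1.reverse.map emb))).1.elim false acc
  refine ⟨StackAction K S, inferInstance, V, b, ⟨?_⟩, fun w => ?_⟩
  · refine
      { tm := machine emb k₀ M.step M.start acc
        inputAlphabet := Equiv.refl _
        outputAlphabet := Equiv.refl _
        -- Two steps for each symbol of the word and of the certificate, one step to notice the end
        -- of the input, and at most one pass per symbol, plus a final one, to clear the stacks.
        time := 4 * Polynomial.X + 3
        outputsFun := ?_ }
    rintro ⟨w, y⟩
    have key : Leads (machine (Γ := Γ) emb k₀ M.step M.start acc).step
        (Turing.initList (machine emb k₀ M.step M.start acc)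
          (w.map Sum.inl ++ y.map Sum.inr))
        (Turing.haltList (machine emb k₀ M.step M.start acc) [V (w, y)])
        (4 * (w.length + y.length) + 3) := by
      have e1 : Turing.initList (machine (Γ := Γ) emb k₀ M.step M.start acc)
          (w.map Sum.inl ++ y.map Sum.inr) = ⟨some .main, ⟨none, some M.start, false⟩,
            conts (w.map Sum.inl ++ y.map Sum.inr) [] fun _ => []⟩ := by
        refine congrArg (Turing.TM2.Cfg.mk _ _) (funext fun k => ?_)
        cases k <;> rfl
      have e2 : Turing.haltList (machine (Γ := Γ) emb k₀ M.step M.start acc) [V (w, y)] =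
          ⟨none, ⟨none, some M.start, false⟩, conts [] [V (w, y)] fun _ => []⟩ := by
        refine congrArg (Turing.TM2.Cfg.mk _ _) (funext fun k => ?_)
        cases k <;> rfl
      rw [e1, e2]
      have h1 := leads_feed emb k₀ M.step M.start acc Finset.univ.toList w (y.map Sum.inr)
        (some M.start) fun _ => []
      have h2 := leads_act (Γ := Γ) emb k₀ M.step M.start acc Finset.univ.toList y (some M.start)
        (Function.update (fun _ => []) k₀ (w.reverse.map emb))
      have h3 := leads_clear (Γ := Γ) emb k₀ M.step M.start acc Finset.univ.toList
        (Finset.nodup_toList _) (by simp) (w.length + y.length)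
        (y.foldl (fun c a => StackAction.move M.step a c) (some M.start,
          Function.update (fun _ => []) k₀ (w.reverse.map emb))).1 _ fun k =>
          (length_foldl_move M.step y (some M.start,
            Function.update (fun _ => []) k₀ (w.reverse.map emb)) k).trans (by
              rcases eq_or_ne k k₀ with rfl | h <;> simp [*])
      simp only [List.append_nil] at h1
      refine ((h1.trans h2).trans (Leads.head ?_ h3)).mono (by omega)
      simp [Turing.TM2.step, Turing.TM2.stepAux, program, conts, update_conts_inp]
    have hlen : ((Computability.encodingProd (Computability.encodingList Γ)
        (Computability.encodingList (StackAction K S))).encode (w, y)).length =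
        w.length + y.length := by
      simp [Computability.encodingProd, Computability.encodingList]
    rw [hlen]
    have key2 := key.choose_spec
    refine ⟨⟨key.choose, ?_⟩, ?_⟩
    · erw [List.map_id, List.map_id]
      exact key2.2
    · simpa using key2.1
  · rw [h]
    refine exists_congr fun y => ?_
    have : V (w, y) = true ↔ y ∈ M.accepts ∧ (StackAction.execAll y
        (Function.update (fun _ => []) k₀ (w.reverse.map emb))).isSome := by
      simp only [V, StackAction.foldl_move]
      cases StackAction.execAll y (Function.update (fun _ => []) k₀ (w.reverse.map emb)) with
      | none => simp
      | some T => simp [acc, DFA.mem_accepts, DFA.eval, DFA.evalFrom]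
    rw [this]
    tauto

/-! ### A calculus of nondeterministic stack programs -/

/-- The stack alphabet: the input symbols, and markers for the coefficients, factors, variables,
ends of exponents, right-hand sides, and for the claim that a term is null. -/
inductive Cell
  | bit (b : Bool)
  | endNum
  | endProfile
  | endTerm
  | endPoly
  | coef
  | fac
  | var
  | endExp
  | rhs
  | claim
  deriving DecidableEq, Fintype

/-- The stacks: `w` and `x` for the text which is read and written, `y` for guessed text, `n` and
`r` for the name and the value of a variable, and the others for numbers. -/
inductive Reg
  | w | x | y | n | r | a | b | m | u | v | c | s | g | d
  deriving DecidableEq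

instance : Fintype Reg where
  elems := {.w, .x, .y, .n, .r, .a, .b, .m, .u, .v, .c, .s, .g, .d}
  complete k := by cases k <;> decide

/-- The contents of the stacks. -/
structure Store where
  (w x y n r a b m u v c s g d : List Cell)

/-- The programs: regular expressions over the elementary actions. -/
abbrev Prog := RegularExpression (StackAction Reg Cell)

namespace Store

/-- The content of a stack. -/
def get (σ : Store) : Reg → List Cell
  | .w => σ.w | .x => σ.x | .y => σ.y | .n => σ.n | .r => σ.r | .a => σ.a | .b => σ.b
  | .m => σ.m | .u => σ.u | .v => σ.v | .c => σ.c | .s => σ.s | .g => σ.g | .d => σ.d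

/-- The store after the content of a stack has been replaced. -/
def set (σ : Store) (k : Reg) (l : List Cell) : Store :=
  match k with
  | .w => {σ with w := l} | .x => {σ with x := l} | .y => {σ with y := l}
  | .n => {σ with n := l} | .r => {σ with r := l} | .a => {σ with a := l}
  | .b => {σ with b := l} | .m => {σ with m := l} | .u => {σ with u := l}
  | .v => {σ with v := l} | .c => {σ with c := l} | .s => {σ with s := l}
  | .g => {σ with g := l} | .d => {σ with d := l}

@[simp] lemma get_set_self (σ : Store) (k : Reg) (l : List Cell) : (σ.set k l).get k = l := by
  cases k <;> rfl

lemma get_set_of_ne (σ : Store) {j k : Reg} (h : j ≠ k) (l : List Cell) :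
    (σ.set k l).get j = σ.get j := by
  cases k <;> cases j <;> first | rfl | exact absurd rfl h

@[simp] lemma set_set_self (σ : Store) (k : Reg) (l l' : List Cell) :
    (σ.set k l).set k l' = σ.set k l' := by
  cases k <;> rfl

@[simp] lemma set_get_self (σ : Store) (k : Reg) : σ.set k (σ.get k) = σ := by
  cases k <;> rfl

lemma set_comm (σ : Store) {j k : Reg} (h : j ≠ k) (l l' : List Cell) :
    (σ.set k l).set j l' = (σ.set j l').set k l := by
  cases k <;> cases j <;> first | rfl | exact absurd rfl h

lemma get_set (σ : Store) (k : Reg) (l : List Cell) :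
    (σ.set k l).get = Function.update σ.get k l := by
  funext j
  rcases eq_or_ne j k with rfl | h
  · simp
  · simp [get_set_of_ne _ h, h]

/-- The effect of an action. -/
def exec : StackAction Reg Cell → Store → Option Store
  | .push k s, σ => some (σ.set k (s :: σ.get k))
  | .pop k s, σ => if (σ.get k).head? = some s then some (σ.set k (σ.get k).tail) else none
  | .isEmpty k, σ => if (σ.get k).head? = none then some σ else none

/-- The effect of a sequence of actions. -/
def execAll : List (StackAction Reg Cell) → Store → Option Store
  | [], σ => some σ
  | a :: l, σ => (exec a σ).bind (execAll l)

lemma execAll_append (y z : List (StackAction Reg Cell)) (σ : Store) :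
    execAll (y ++ z) σ = (execAll y σ).bind (execAll z) := by
  induction y generalizing σ with
  | nil => rfl
  | cons a y ih => simp [execAll, Option.bind_assoc, ih]

lemma execAll_get (y : List (StackAction Reg Cell)) (σ : Store) :
    StackAction.execAll y σ.get = (execAll y σ).map get := by
  induction y generalizing σ with
  | nil => rfl
  | cons a y ih =>
    cases a with
    | push k s => simp [execAll, StackAction.execAll, exec, StackAction.exec, ← ih, get_set]
    | pop k s =>
      by_cases h : (σ.get k).head? = some s <;>
        simp [execAll, StackAction.execAll, exec, StackAction.exec, ← ih, get_set, h]
    | isEmpty k =>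
      by_cases h : σ.get k = [] <;>
        simp [execAll, StackAction.execAll, exec, StackAction.exec, ← ih, h]

end Store

namespace Prog

open Store

/-- Push a symbol on a stack. -/
def push (k : Reg) (s : Cell) : Prog := .char (.push k s)

/-- Pop an expected symbol from a stack. -/
def pop (k : Reg) (s : Cell) : Prog := .char (.pop k s)

/-- Check that a stack is empty. -/
def isEmpty (k : Reg) : Prog := .char (.isEmpty k)

/-- A choice between finitely many programs. -/
def alt {ι : Type} (l : List ι) (f : ι → Prog) : Prog := l.foldr (fun i P => f i + P) 0

/-- The program `P` can lead from `σ` to `τ`. -/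
def Rel (P : Prog) (σ τ : Store) : Prop := ∃ y ∈ P.matches', execAll y σ = some τ

/-- The program `P` can lead from `σ` to `τ` in at most `n` actions. -/
def Runs (P : Prog) (σ τ : Store) (n : ℕ) : Prop :=
  ∃ y ∈ P.matches', execAll y σ = some τ ∧ y.length ≤ n

/-- The program `P` can lead from `σ` to `τ` in at most `n` actions, and to no other store. -/
def Det (P : Prog) (σ τ : Store) (n : ℕ) : Prop := Runs P σ τ n ∧ ∀ ρ, Rel P σ ρ → ρ = τ

variable {P Q : Prog} {σ τ ρ : Store} {m n : ℕ}

lemma Runs.rel (h : Runs P σ τ n) : Rel P σ τ := by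
  obtain ⟨y, hy, h, -⟩ := h
  exact ⟨y, hy, h⟩

@[simp] lemma rel_zero : ¬ Rel 0 σ τ := fun ⟨_, hy, _⟩ => hy

@[simp] lemma rel_one : Rel 1 σ τ ↔ τ = σ := by
  simp only [Rel, RegularExpression.matches'_epsilon, Language.mem_one]
  constructor
  · rintro ⟨_, rfl, h⟩
    exact (Option.some_injective _ h).symm
  · rintro rfl
    exact ⟨[], rfl, rfl⟩

lemma rel_char (a : StackAction Reg Cell) : Rel (.char a) σ τ ↔ exec a σ = some τ := by
  simp only [Rel, RegularExpression.matches'_char]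
  constructor
  · rintro ⟨_, rfl, h⟩
    simpa [execAll] using h
  · intro h
    exact ⟨[a], rfl, by simpa [execAll] using h⟩

@[simp] lemma rel_push (k : Reg) (s : Cell) :
    Rel (push k s) σ τ ↔ τ = σ.set k (s :: σ.get k) := by
  rw [push, rel_char]
  simp [exec, eq_comm]

@[simp] lemma rel_pop (k : Reg) (s : Cell) :
    Rel (pop k s) σ τ ↔ ∃ l, σ.get k = s :: l ∧ τ = σ.set k l := by
  rw [pop, rel_char]
  cases h : σ.get k <;> simp [exec, eq_comm, h]

@[simp] lemma rel_isEmpty (k : Reg) : Rel (isEmpty k) σ τ ↔ σ.get k = [] ∧ τ = σ := by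
  rw [isEmpty, rel_char]
  by_cases h : σ.get k = [] <;> simp [exec, h]
  exact eq_comm

@[simp] lemma rel_mul : Rel (P * Q) σ τ ↔ ∃ ρ, Rel P σ ρ ∧ Rel Q ρ τ := by
  simp only [Rel, RegularExpression.matches'_mul, Language.mem_mul]
  constructor
  · rintro ⟨_, ⟨y, hy, z, hz, rfl⟩, h⟩
    rw [execAll_append, Option.bind_eq_some_iff] at h
    obtain ⟨ρ, h1, h2⟩ := h
    exact ⟨ρ, ⟨y, hy, h1⟩, z, hz, h2⟩
  · rintro ⟨ρ, ⟨y, hy, h1⟩, z, hz, h2⟩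
    exact ⟨y ++ z, ⟨y, hy, z, hz, rfl⟩, by simp [execAll_append, h1, h2]⟩

@[simp] lemma rel_add : Rel (P + Q) σ τ ↔ Rel P σ τ ∨ Rel Q σ τ := by
  simp only [Rel, RegularExpression.matches'_add, Language.mem_add, or_and_right, exists_or]

@[simp] lemma rel_alt {ι : Type} (l : List ι) (f : ι → Prog) :
    Rel (alt l f) σ τ ↔ ∃ i ∈ l, Rel (f i) σ τ := by
  induction l with
  | nil => simp [alt]
  | cons i l ih =>
    rw [show alt (i :: l) f = f i + alt l f from rfl, rel_add, ih]
    simp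

lemma rel_star : Rel P.star σ τ ↔ τ = σ ∨ ∃ ρ, Rel P σ ρ ∧ Rel P.star ρ τ := by
  have h : P.star.matches' = (1 + P * P.star).matches' := by
    rw [RegularExpression.matches'_add, RegularExpression.matches'_mul,
      RegularExpression.matches'_star, RegularExpression.matches'_epsilon]
    exact (Language.one_add_self_mul_kstar_eq_kstar _).symm
  rw [← rel_one, ← rel_mul, ← rel_add, Rel, Rel, h]

/-- Induction on the number of iterations, going backwards from the final store. Soundness of loops
is proved in this form, with a motive that quantifies over the data held in the store. -/
lemma Rel.star_induction (motive : Store → Prop) (h : Rel P.star σ τ) (base : motive τ)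
    (step : ∀ ρ ρ', Rel P ρ ρ' → Rel P.star ρ' τ → motive ρ' → motive ρ) : motive σ := by
  obtain ⟨_, ⟨S, rfl, hS⟩, h⟩ := h
  induction S generalizing σ with
  | nil =>
    obtain rfl : σ = τ := by simpa [execAll] using h
    exact base
  | cons y S ih =>
    rw [List.flatten_cons, execAll_append, Option.bind_eq_some_iff] at h
    obtain ⟨ρ, h1, h2⟩ := h
    have hS' : ∀ z ∈ S, z ∈ P.matches' := fun z hz => hS z (by simp [hz])
    exact step σ ρ ⟨y, hS y (by simp), h1⟩ ⟨_, ⟨S, rfl, hS'⟩, h2⟩ (ih hS' h2)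

lemma Runs.mono (h : Runs P σ τ m) (hmn : m ≤ n) : Runs P σ τ n := by
  obtain ⟨y, hy, h, hl⟩ := h
  exact ⟨y, hy, h, hl.trans hmn⟩

lemma Runs.mul (h : Runs P σ ρ m) (h' : Runs Q ρ τ n) : Runs (P * Q) σ τ (m + n) := by
  obtain ⟨y, hy, h, hl⟩ := h
  obtain ⟨z, hz, h', hl'⟩ := h'
  exact ⟨y ++ z, ⟨y, hy, z, hz, rfl⟩, by simp [execAll_append, h, h'], by simp; omega⟩

lemma Runs.left (h : Runs P σ τ n) : Runs (P + Q) σ τ n := by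
  obtain ⟨y, hy, h⟩ := h
  exact ⟨y, .inl hy, h⟩

lemma Runs.right (h : Runs Q σ τ n) : Runs (P + Q) σ τ n := by
  obtain ⟨y, hy, h⟩ := h
  exact ⟨y, .inr hy, h⟩

lemma Runs.alt {ι : Type} {l : List ι} {f : ι → Prog} {i : ι} (hi : i ∈ l)
    (h : Runs (f i) σ τ n) : Runs (alt l f) σ τ n := by
  induction l with
  | nil => simp at hi
  | cons j l ih =>
    rcases List.mem_cons.1 hi with rfl | hi
    · exact h.left
    · exact (ih hi).right

lemma Runs.one : Runs 1 σ σ 0 := ⟨[], rfl, rfl, le_rfl⟩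

lemma Runs.star_nil : Runs P.star σ σ 0 := ⟨[], ⟨[], rfl, by simp⟩, rfl, le_rfl⟩

lemma Runs.star_cons (h : Runs P σ ρ m) (h' : Runs P.star ρ τ n) :
    Runs P.star σ τ (m + n) := by
  obtain ⟨y, hy, h, hl⟩ := h
  obtain ⟨_, ⟨S, rfl, hS⟩, h', hl'⟩ := h'
  refine ⟨y ++ S.flatten, ⟨y :: S, by simp, ?_⟩, by simp [execAll_append, h, h'], by simp_all; omega⟩
  rintro z hz
  rcases List.mem_cons.1 hz with rfl | hz
  exacts [hy, hS z hz]

/-- The program does not contain any loop. -/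
def StarFree : Prog → Bool
  | .zero => true
  | .epsilon => true
  | .char _ => true
  | .plus P Q => StarFree P && StarFree Q
  | .comp P Q => StarFree P && StarFree Q
  | .star _ => false

/-- The maximal number of actions of a loop-free program. -/
def maxLength : Prog → ℕ
  | .zero => 0
  | .epsilon => 0
  | .char _ => 1
  | .plus P Q => max (maxLength P) (maxLength Q)
  | .comp P Q => maxLength P + maxLength Q
  | .star _ => 0

lemma length_le_maxLength (hP : StarFree P) {y : List (StackAction Reg Cell)}
    (hy : y ∈ P.matches') : y.length ≤ maxLength P := by
  induction P generalizing y with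
  | zero => exact hy.elim
  | epsilon => rw [(Language.mem_one y).1 hy]; simp
  | char a => rw [show y = [a] from hy]; simp [maxLength]
  | plus P Q ihP ihQ =>
    simp only [StarFree, Bool.and_eq_true] at hP
    rcases hy with hy | hy
    · exact le_max_of_le_left (ihP hP.1 hy)
    · exact le_max_of_le_right (ihQ hP.2 hy)
  | comp P Q ihP ihQ =>
    simp only [StarFree, Bool.and_eq_true] at hP
    obtain ⟨u, hu, v, hv, rfl⟩ := hy
    simpa [maxLength] using add_le_add (ihP hP.1 hu) (ihQ hP.2 hv)
  | star P => simp [StarFree] at hP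

/-- Every word of a loop-free expression has length at most `maxLength`, so a purely relational
statement already gives a time bound. The default arguments let it be found by evaluation. -/
lemma Rel.runs (h : Rel P σ τ) (hP : StarFree P := by rfl)
    (hn : maxLength P ≤ n := by exact Nat.le_of_ble_eq_true rfl) : Runs P σ τ n := by
  obtain ⟨y, hy, h⟩ := h
  exact ⟨y, hy, h, (length_le_maxLength hP hy).trans hn⟩

lemma Det.mono (h : Det P σ τ m) (hmn : m ≤ n) : Det P σ τ n := ⟨h.1.mono hmn, h.2⟩

lemma Det.rel_iff (h : Det P σ τ n) : Rel P σ ρ ↔ ρ = τ :=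
  ⟨h.2 ρ, fun h' => h' ▸ h.1.rel⟩

lemma Det.of_iff (h : ∀ ρ, Rel P σ ρ ↔ ρ = τ) (hP : StarFree P := by rfl)
    (hn : maxLength P ≤ n := by exact Nat.le_of_ble_eq_true rfl) : Det P σ τ n :=
  ⟨((h τ).2 rfl).runs hP hn, fun ρ => (h ρ).1⟩

lemma Det.mul (h : Det P σ ρ m) (h' : Det Q ρ τ n) : Det (P * Q) σ τ (m + n) := by
  refine ⟨h.1.mul h'.1, fun ρ' hρ' => ?_⟩
  obtain ⟨ρ'', h1, h2⟩ := rel_mul.1 hρ'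
  obtain rfl := h.2 _ h1
  exact h'.2 _ h2

lemma Det.left (h : Det P σ τ n) (h' : ∀ ρ, ¬ Rel Q σ ρ) : Det (P + Q) σ τ n :=
  ⟨h.1.left, fun ρ hρ => (rel_add.1 hρ).elim (h.2 ρ) fun hq => absurd hq (h' ρ)⟩

lemma Det.right (h : Det Q σ τ n) (h' : ∀ ρ, ¬ Rel P σ ρ) : Det (P + Q) σ τ n :=
  ⟨h.1.right, fun ρ hρ => (rel_add.1 hρ).elim (fun hq => absurd hq (h' ρ)) (h.2 ρ)⟩

lemma Det.alt {ι : Type} {l : List ι} {f : ι → Prog} {i : ι} (hi : i ∈ l) (h : Det (f i) σ τ n)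
    (h' : ∀ j ≠ i, ∀ ρ, ¬ Rel (f j) σ ρ) : Det (alt l f) σ τ n := by
  refine ⟨h.1.alt hi, fun ρ hρ => ?_⟩
  obtain ⟨j, -, hj⟩ := (rel_alt _ _).1 hρ
  rcases eq_or_ne j i with rfl | hji
  · exact h.2 _ hj
  · exact absurd hj (h' j hji ρ)

/-- Repeat `P`, and then do `Q`. -/
def loop (P Q : Prog) : Prog := P.star * Q

lemma rel_loop : Rel (loop P Q) σ τ ↔ Rel Q σ τ ∨ ∃ ρ, Rel P σ ρ ∧ Rel (loop P Q) ρ τ := by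
  simp only [loop, rel_mul]
  constructor
  · rintro ⟨ρ, h, h'⟩
    rcases rel_star.1 h with rfl | ⟨ρ', h1, h2⟩
    · exact .inl h'
    · exact .inr ⟨ρ', h1, ρ, h2, h'⟩
  · rintro (h | ⟨ρ', h1, ρ, h2, h'⟩)
    · exact ⟨σ, rel_star.2 (.inl rfl), h⟩
    · exact ⟨ρ, rel_star.2 (.inr ⟨ρ', h1, h2⟩), h'⟩

lemma Runs.loop_done (h : Runs Q σ τ n) : Runs (loop P Q) σ τ n :=
  (Runs.star_nil.mul h).mono (by omega)

lemma Runs.loop_step (h : Runs P σ ρ m) (h' : Runs (loop P Q) ρ τ n) :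
    Runs (loop P Q) σ τ (m + n) := by
  obtain ⟨y, hy, h, hl⟩ := h
  obtain ⟨_, ⟨_, ⟨S, rfl, hS⟩, z, hz, rfl⟩, h', hl'⟩ := h'
  refine ⟨y ++ (S.flatten ++ z), ⟨y ++ S.flatten, ⟨y :: S, by simp, ?_⟩, z, hz, by simp⟩,
    by rw [execAll_append, h]; exact h', by simp only [List.length_append] at *; omega⟩
  rintro z hz
  rcases List.mem_cons.1 hz with rfl | hz
  exacts [hy, hS z hz]

/-- A loop has a unique outcome if its body and its exit can never both be executed. The choice left
open by the regular expression is settled by pops and emptiness tests that fail. -/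
lemma Det.loop_done (h : Det Q σ τ n) (h' : ∀ ρ, ¬ Rel P σ ρ) : Det (loop P Q) σ τ n := by
  refine ⟨h.1.loop_done, fun ρ hρ => ?_⟩
  rcases rel_loop.1 hρ with hρ | ⟨ρ', h1, -⟩
  exacts [h.2 _ hρ, absurd h1 (h' _)]

lemma Det.loop_step (h : Det P σ ρ m) (h' : Det (loop P Q) ρ τ n) (hQ : ∀ ρ, ¬ Rel Q σ ρ) :
    Det (loop P Q) σ τ (m + n) := by
  refine ⟨h.1.loop_step h'.1, fun ρ' hρ' => ?_⟩
  rcases rel_loop.1 hρ' with hρ' | ⟨ρ'', h1, h2⟩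
  · exact absurd hρ' (hQ _)
  · obtain rfl := h.2 _ h1
    exact h'.2 _ h2

lemma det_push (k : Reg) (s : Cell) : Det (push k s) σ (σ.set k (s :: σ.get k)) 1 :=
  .of_iff fun _ => rel_push k s

lemma det_pop {k : Reg} {s : Cell} {l : List Cell} (h : σ.get k = s :: l) :
    Det (pop k s) σ (σ.set k l) 1 :=
  .of_iff fun _ => by simp [h]

lemma det_isEmpty {k : Reg} (h : σ.get k = []) : Det (isEmpty k) σ σ 1 :=
  .of_iff fun _ => by simp [h]

end Prog

/-! ### Binary numbers -/

/-- The number with given binary digits, the least significant digit first. -/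
def bval (l : List Bool) : ℕ := l.foldr Nat.bit 0

@[simp] lemma bval_nil : bval [] = 0 := rfl

@[simp] lemma bval_cons (b : Bool) (l : List Bool) : bval (b :: l) = Nat.bit b (bval l) := rfl

@[simp] lemma bval_bits (n : ℕ) : bval n.bits = n := by
  induction n using Nat.binaryRec' with
  | zero => simp
  | bit b n h ih => rw [Nat.bits_append_bit n b h, bval_cons, ih]

lemma bits_bval {l : List Bool} (h : l.getLast? ≠ some false) : (bval l).bits = l := by
  induction l with
  | nil => simp
  | cons b l ih =>
    cases l with
    | nil => cases b <;> simp_all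
    | cons b' l =>
      have ih := ih (by simpa using h)
      rw [bval_cons, Nat.bits_append_bit _ _ fun h0 => by simp [h0] at ih, ih]

lemma getLast?_bits (n : ℕ) : n.bits.getLast? ≠ some false := by
  induction n using Nat.binaryRec' with
  | zero => simp
  | bit b n h ih =>
    rw [Nat.bits_append_bit n b h]
    cases hn : n.bits with
    | nil =>
      have : n = 0 := by rw [← bval_bits n, hn]; rfl
      simp [h this]
    | cons b' l => rw [hn] at ih; simpa using ih

/-- Links the encoding of the input to `Nat.bits`, in terms of which the arithmetic on stacks is
formulated. -/
lemma encodeNat_eq_bits (n : ℕ) : Computability.encodeNat n = n.bits := by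
  have h : ∀ p : PosNum, Computability.encodePosNum p = (p : ℕ).bits := by
    intro p
    induction p with
    | one => simp [Computability.encodePosNum]
    | bit0 p ih =>
      rw [Computability.encodePosNum, ih, PosNum.cast_bit0, ← two_mul, Nat.bit0_bits]
      exact (PosNum.cast_pos p).ne'
    | bit1 p ih =>
      rw [Computability.encodePosNum, ih, PosNum.cast_bit1, ← two_mul, Nat.bit1_bits]
  rw [Computability.encodeNat]
  conv_rhs => rw [← Num.to_of_nat n]
  cases (n : Num) with
  | zero => simp [Computability.encodeNum]
  | pos p => exact h p

/-- Addition of binary numbers with a carry. -/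
def addBits : Bool → List Bool → List Bool → List Bool
  | c, [], [] => if c then [true] else []
  | c, p :: ps, [] => (p ^^ c) :: addBits (p && c) ps []
  | c, [], q :: qs => (q ^^ c) :: addBits (q && c) [] qs
  | c, p :: ps, q :: qs => (p ^^ q ^^ c) :: addBits (p && q || p && c || q && c) ps qs

lemma bval_addBits (c : Bool) (p q : List Bool) :
    bval (addBits c p q) = bval p + bval q + c.toNat := by
  induction c, p, q using addBits.induct with
  | case1 => simp [addBits, Nat.bit]
  | case2 c =>
    cases c <;> simp_all [addBits]
  | case3 c p ps ih =>
    rw [addBits, bval_cons, ih, bval_cons]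
    cases c <;> cases p <;> simp [Nat.bit]; ring
  | case4 c q qs ih =>
    rw [addBits, bval_cons, ih, bval_cons]
    cases c <;> cases q <;> simp [Nat.bit]; ring
  | case5 c p ps q qs ih =>
    cases c <;> cases p <;> cases q <;> simp_all [addBits, Nat.bit] <;> omega

lemma getLast?_cons_ne {b : Bool} {l : List Bool} (h : (b :: l).getLast? ≠ some false) :
    l.getLast? ≠ some false ∧ (l = [] → b = true) := by
  cases l <;> simp_all

/-- If the recursive call returns nothing, then there is no carry and no digit is left, so the
digits just added are leading ones, hence `1`. A single leading `1` without an outgoing carry yields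
the digit `1`, and two of them would produce a carry. -/
lemma getLast?_addBits (c : Bool) (p q : List Bool) (hp : p.getLast? ≠ some false)
    (hq : q.getLast? ≠ some false) : (addBits c p q).getLast? ≠ some false := by
  have nil : ∀ (c : Bool) (p q : List Bool), addBits c p q = [] → c = false ∧ p = [] ∧ q = [] := by
    intro c p q h
    cases p <;> cases q <;> simp_all [addBits]
  have cons : ∀ (b : Bool) (l : List Bool), l.getLast? ≠ some false → (l = [] → b = true) →
      (b :: l).getLast? ≠ some false := by
    intro b l h h'
    cases l with
    | nil => simp [h']
    | cons b' l => simpa using h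
  induction c, p, q using addBits.induct with
  | case1 => simp [addBits]
  | case2 c => simp_all [addBits]
  | case3 c p ps ih =>
    obtain ⟨h1, h2⟩ := getLast?_cons_ne hp
    rw [addBits]
    refine cons _ _ (ih h1 hq) fun h => ?_
    obtain ⟨h3, h4, -⟩ := nil _ _ _ h
    rw [h2 h4] at h3 ⊢
    simpa using h3
  | case4 c q qs ih =>
    obtain ⟨h1, h2⟩ := getLast?_cons_ne hq
    rw [addBits]
    refine cons _ _ (ih hp h1) fun h => ?_
    obtain ⟨h3, -, h4⟩ := nil _ _ _ h
    rw [h2 h4] at h3 ⊢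
    simpa using h3
  | case5 c p ps q qs ih =>
    obtain ⟨h1, h2⟩ := getLast?_cons_ne hp
    obtain ⟨h3, h4⟩ := getLast?_cons_ne hq
    rw [addBits]
    refine cons _ _ (ih h1 h3) fun h => ?_
    obtain ⟨h5, h6, h7⟩ := nil _ _ _ h
    simp [h2 h6, h4 h7] at h5

lemma addBits_bits (m n : ℕ) : addBits false m.bits n.bits = (m + n).bits := by
  rw [← bits_bval (getLast?_addBits _ _ _ (getLast?_bits m) (getLast?_bits n)), bval_addBits]
  simp

/-- Binary digits as symbols. -/
def cells (l : List Bool) : List Cell := l.map .bit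

@[simp] lemma cells_nil : cells [] = [] := rfl

@[simp] lemma cells_cons (b : Bool) (l : List Bool) : cells (b :: l) = .bit b :: cells l := rfl

@[simp] lemma cells_eq_nil {l : List Bool} : cells l = [] ↔ l = [] := by simp [cells]

@[simp] lemma length_cells (l : List Bool) : (cells l).length = l.length := by simp [cells]

lemma cells_reverse (l : List Bool) : (cells l).reverse = cells l.reverse := by simp [cells]

lemma cells_append (l l' : List Bool) : cells (l ++ l') = cells l ++ cells l' := by simp [cells]

/-- A number on a stack. -/
def enc (n : ℕ) : List Cell := cells n.bits

/-! ### Moving and copying the contents of stacks -/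

namespace Prog

open Store

/-- The symbols. -/
def allCells : List Cell :=
  [.bit false, .bit true, .endNum, .endProfile, .endTerm, .endPoly, .coef, .fac, .var, .endExp,
    .rhs, .claim]

@[simp] lemma mem_allCells (s : Cell) : s ∈ allCells := by
  rcases s with (_ | _) | _ | _ | _ | _ | _ | _ | _ | _ | _ | _ <;> decide

/-- The binary digits. -/
def bools : List Bool := [false, true]

@[simp] lemma mem_bools (b : Bool) : b ∈ bools := by cases b <;> decide

/-- Move a symbol among `l`. -/
def moveOne (l : List Cell) (i j : Reg) : Prog := alt l fun s => pop i s * push j s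

/-- Move a symbol among `l` to two stacks. -/
def moveTwo (l : List Cell) (i j k : Reg) : Prog := alt l fun s => pop i s * push j s * push k s

/-- Move the content of a stack to another one, which reverses it. -/
def move (i j : Reg) : Prog := loop (moveOne allCells i j) (isEmpty i)

/-- Empty a stack. -/
def clear (i : Reg) : Prog := loop (alt allCells fun s => pop i s) (isEmpty i)

variable {σ τ ρ : Store} {n : ℕ}

/-- The common pattern of all transfers: symbols of `l` are moved until one outside `l`, or the end
of the stack, is reached. The hypotheses on `rest` and `Q` make moving and leaving mutually
exclusive. The continuation `Q` is part of the loop because only it forces the transfer not to stop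
early. -/
lemma det_moveOne_loop {l : List Cell} {i j : Reg} (hij : i ≠ j) {Q : Prog} {t rest : List Cell}
    (ht : ∀ s ∈ t, s ∈ l) (hrest : ∀ s ∈ l, rest.head? ≠ some s)
    (hQ : ∀ σ ρ, Rel Q σ ρ → ∀ s ∈ l, (σ.get i).head? ≠ some s)
    (hσ : σ.get i = t ++ rest)
    (h : Det Q ((σ.set i rest).set j (t.reverse ++ σ.get j)) τ n) :
    Det (loop (moveOne l i j) Q) σ τ (2 * t.length + n) := by
  induction t generalizing σ with
  | nil =>
    have e : (σ.set i rest).set j (σ.get j) = σ := by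
      rw [set_comm _ hij.symm, set_get_self, ← (by simpa using hσ : σ.get i = rest), set_get_self]
    simp only [List.reverse_nil, List.nil_append, e] at h
    refine (h.loop_done fun ρ hρ => ?_).mono (by simp)
    simp only [moveOne, rel_alt, rel_mul, rel_pop] at hρ
    obtain ⟨s, hs, _, ⟨r, hr, -⟩, -⟩ := hρ
    exact hrest s hs (by rw [← (by simpa using hσ : σ.get i = rest), hr]; rfl)
  | cons s t ih =>
    have hs : s ∈ l := ht s (by simp)
    have h1 : Det (moveOne l i j) σ ((σ.set i (t ++ rest)).set j (s :: σ.get j)) 2 := by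
      refine Det.alt hs ?_ ?_
      · simpa [get_set_of_ne _ hij.symm] using (det_pop hσ).mul (det_push j s)
      · intro s' hs' ρ hρ
        simp only [rel_mul, rel_pop] at hρ
        obtain ⟨_, ⟨r, hr, -⟩, -⟩ := hρ
        rw [hσ] at hr
        exact hs' (List.cons.inj hr).1.symm
    refine (h1.loop_step (ih (fun s hs => ht s (by simp [hs])) ?_ ?_) ?_).mono
      (n := 2 * (s :: t).length + n) (by simp; omega)
    · simp [get_set_of_ne _ hij]
    · simpa [get_set_of_ne _ hij.symm, set_comm _ hij] using h
    · intro ρ hρ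
      exact hQ _ _ hρ s hs (by simp [hσ])

lemma det_move {i j : Reg} (hij : i ≠ j) (σ : Store) :
    Det (move i j) σ ((σ.set i []).set j ((σ.get i).reverse ++ σ.get j))
      (2 * (σ.get i).length + 1) :=
  det_moveOne_loop hij (t := σ.get i) (rest := []) (by simp) (by simp)
    (fun σ ρ h => by simp [((rel_isEmpty i).1 h).1]) (by simp)
    (det_isEmpty (by simp [get_set_of_ne _ hij]))

lemma det_moveTwo_loop {l : List Cell} {i j k : Reg} (hij : i ≠ j) (hik : i ≠ k) (hjk : j ≠ k)
    {Q : Prog} {t rest : List Cell}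
    (ht : ∀ s ∈ t, s ∈ l) (hrest : ∀ s ∈ l, rest.head? ≠ some s)
    (hQ : ∀ σ ρ, Rel Q σ ρ → ∀ s ∈ l, (σ.get i).head? ≠ some s)
    (hσ : σ.get i = t ++ rest)
    (h : Det Q (((σ.set i rest).set j (t.reverse ++ σ.get j)).set k (t.reverse ++ σ.get k)) τ n) :
    Det (loop (moveTwo l i j k) Q) σ τ (3 * t.length + n) := by
  induction t generalizing σ with
  | nil =>
    have e : ((σ.set i rest).set j (σ.get j)).set k (σ.get k) = σ := by
      rw [set_comm _ hjk.symm, set_comm _ hik.symm, set_get_self, set_comm _ hij.symm,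
        set_get_self, ← (by simpa using hσ : σ.get i = rest), set_get_self]
    simp only [List.reverse_nil, List.nil_append, e] at h
    refine (h.loop_done fun ρ hρ => ?_).mono (by simp)
    simp only [moveTwo, rel_alt, rel_mul, rel_pop] at hρ
    obtain ⟨s, hs, _, ⟨_, ⟨r, hr, -⟩, -⟩, -⟩ := hρ
    exact hrest s hs (by rw [← (by simpa using hσ : σ.get i = rest), hr]; rfl)
  | cons s t ih =>
    have hs : s ∈ l := ht s (by simp)
    have h1 : Det (moveTwo l i j k) σ
        (((σ.set i (t ++ rest)).set j (s :: σ.get j)).set k (s :: σ.get k)) 3 := by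
      refine Det.alt hs ?_ ?_
      · simpa [get_set_of_ne _ hij.symm, get_set_of_ne _ hik.symm, get_set_of_ne _ hjk.symm]
          using ((det_pop hσ).mul (det_push j s)).mul (det_push k s)
      · intro s' hs' ρ hρ
        simp only [rel_mul, rel_pop] at hρ
        obtain ⟨_, ⟨_, ⟨r, hr, -⟩, -⟩, -⟩ := hρ
        rw [hσ] at hr
        exact hs' (List.cons.inj hr).1.symm
    refine (h1.loop_step (ih (fun s hs => ht s (by simp [hs])) ?_ ?_) ?_).mono
      (n := 3 * (s :: t).length + n) (by simp; omega)
    · simp [get_set_of_ne _ hij, get_set_of_ne _ hik]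
    · simpa [get_set_of_ne _ hij.symm, get_set_of_ne _ hik.symm, get_set_of_ne _ hjk.symm,
        get_set_of_ne _ hjk, set_comm _ hij, set_comm _ hik, set_comm _ hjk] using h
    · intro ρ hρ
      exact hQ _ _ hρ s hs (by simp [hσ])

lemma det_clear (i : Reg) (σ : Store) : Det (clear i) σ (σ.set i []) ((σ.get i).length + 1) := by
  generalize hl : σ.get i = l
  induction l generalizing σ with
  | nil =>
    rw [← hl, set_get_self]
    exact ((det_isEmpty hl).loop_done (by simp [hl])).mono (by simp)
  | cons s l ih =>
    have h1 : Det (alt allCells fun s => pop i s) σ (σ.set i l) 1 :=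
      Det.alt (mem_allCells s) (det_pop hl) fun j hj ρ hρ => by
        simp [hl, hj.symm] at hρ
    have h2 := ih (σ.set i l) (by simp)
    rw [set_set_self] at h2
    exact (h1.loop_step h2 (by simp [hl])).mono (by simp; omega)

lemma not_rel_pop_mul {P : Prog} {k : Reg} {s : Cell} (h : (σ.get k).head? ≠ some s) :
    ¬ Rel (pop k s * P) σ ρ := by
  simp only [rel_mul, rel_pop]
  rintro ⟨_, ⟨l, hl, -⟩, -⟩
  simp [hl] at h

/-! #### Addition -/

/-- One step of the addition when both numbers have digits left. -/
def addBoth : Prog :=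
  alt bools fun p => alt bools fun q => alt bools fun c =>
    pop .a (.bit p) * pop .b (.bit q) * pop .c (.bit c) * push .u (.bit q) *
      push .v (.bit (p ^^ q ^^ c)) * push .c (.bit (p && q || p && c || q && c))

/-- One step of the addition when the second number is exhausted. -/
def addLeft : Prog :=
  isEmpty .b * alt bools fun p => alt bools fun c =>
    pop .a (.bit p) * pop .c (.bit c) * push .v (.bit (p ^^ c)) * push .c (.bit (p && c))

/-- One step of the addition when the first number is exhausted. -/
def addRight : Prog :=
  isEmpty .a * alt bools fun q => alt bools fun c =>
    pop .b (.bit q) * pop .c (.bit c) * push .u (.bit q) *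
      push .v (.bit (q ^^ c)) * push .c (.bit (q && c))

/-- The last step of the addition. -/
def addEnd : Prog :=
  isEmpty .a * isEmpty .b * (pop .c (.bit false) + pop .c (.bit true) * push .v (.bit true))

/-- Add the number in `b` to the number in `a`. -/
def add : Prog :=
  push .c (.bit false) * loop (addBoth + addLeft + addRight) addEnd * move .u .b * move .v .a

lemma rel_addBoth : Rel addBoth σ ρ ↔ ∃ p q c a b c', σ.a = .bit p :: a ∧ σ.b = .bit q :: b ∧
    σ.c = .bit c :: c' ∧ ρ =
      {σ with a := a, b := b, u := .bit q :: σ.u, v := .bit (p ^^ q ^^ c) :: σ.v,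
              c := .bit (p && q || p && c || q && c) :: c'} := by
  simp only [addBoth, rel_alt, mem_bools, true_and, rel_mul, rel_push, rel_pop]
  constructor
  · rintro ⟨p, q, c, _, ⟨_, ⟨_, ⟨_, ⟨_, ⟨a, ha, rfl⟩, b, hb, rfl⟩, c', hc, rfl⟩, rfl⟩, rfl⟩, rfl⟩
    exact ⟨p, q, c, a, b, c', ha, hb, hc, rfl⟩
  · rintro ⟨p, q, c, a, b, c', ha, hb, hc, rfl⟩
    exact ⟨p, q, c, _, ⟨_, ⟨_, ⟨_, ⟨_, ⟨a, ha, rfl⟩, b, hb, rfl⟩, c', hc, rfl⟩, rfl⟩, rfl⟩, rfl⟩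

lemma rel_addLeft : Rel addLeft σ ρ ↔ ∃ p c a c', σ.b = [] ∧ σ.a = .bit p :: a ∧
    σ.c = .bit c :: c' ∧ 
      ρ = {σ with a := a, v := .bit (p ^^ c) :: σ.v, c := .bit (p && c) :: c'} := by
  simp only [addLeft, rel_alt, mem_bools, true_and, rel_mul, rel_push, rel_pop, rel_isEmpty]
  constructor
  · rintro ⟨_, ⟨hb, rfl⟩, p, c, _, ⟨_, ⟨_, ⟨a, ha, rfl⟩, c', hc, rfl⟩, rfl⟩, rfl⟩
    exact ⟨p, c, a, c', hb, ha, hc, rfl⟩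
  · rintro ⟨p, c, a, c', hb, ha, hc, rfl⟩
    exact ⟨_, ⟨hb, rfl⟩, p, c, _, ⟨_, ⟨_, ⟨a, ha, rfl⟩, c', hc, rfl⟩, rfl⟩, rfl⟩

lemma rel_addRight : Rel addRight σ ρ ↔ ∃ q c b c', σ.a = [] ∧ σ.b = .bit q :: b ∧
    σ.c = .bit c :: c' ∧ ρ =
      {σ with b := b, u := .bit q :: σ.u, v := .bit (q ^^ c) :: σ.v, c := .bit (q && c) :: c'} := by
  simp only [addRight, rel_alt, mem_bools, true_and, rel_mul, rel_push, rel_pop, rel_isEmpty]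
  constructor
  · rintro ⟨_, ⟨hb, rfl⟩, p, c, _, ⟨_, ⟨_, ⟨_, ⟨a, ha, rfl⟩, c', hc, rfl⟩, rfl⟩, rfl⟩, rfl⟩
    exact ⟨p, c, a, c', hb, ha, hc, rfl⟩
  · rintro ⟨p, c, a, c', hb, ha, hc, rfl⟩
    exact ⟨_, ⟨hb, rfl⟩, p, c, _, ⟨_, ⟨_, ⟨_, ⟨a, ha, rfl⟩, c', hc, rfl⟩, rfl⟩, rfl⟩, rfl⟩

lemma rel_addEnd : Rel addEnd σ ρ ↔ ∃ c c', σ.a = [] ∧ σ.b = [] ∧ σ.c = .bit c :: c' ∧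
    ρ = {σ with v := cells (if c then [true] else []) ++ σ.v, c := c'} := by
  simp only [addEnd, rel_add, rel_mul, rel_push, rel_pop, rel_isEmpty]
  constructor
  · rintro ⟨_, ⟨_, ⟨ha, rfl⟩, hb, rfl⟩, ⟨c', hc, rfl⟩ | ⟨_, ⟨c', hc, rfl⟩, rfl⟩⟩
    · exact ⟨false, c', ha, hb, hc, rfl⟩
    · exact ⟨true, c', ha, hb, hc, rfl⟩
  · rintro ⟨c, c', ha, hb, hc, rfl⟩
    refine ⟨_, ⟨_, ⟨ha, rfl⟩, hb, rfl⟩, ?_⟩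
    cases c
    · exact .inl ⟨c', hc, rfl⟩
    · exact .inr ⟨_, ⟨c', hc, rfl⟩, rfl⟩

/-- The three bodies and the exit require different combinations of empty and non-empty `a` and `b`,
exactly the cases of the recursion of `addBits`. The sum accumulates reversed in `v`, and the second
number in `u`, from which it is restored. -/
lemma det_add_loop (c : Bool) (p q : List Bool) (σ : Store) (ha : σ.a = cells p)
    (hb : σ.b = cells q) (hc : σ.c = [.bit c]) :
    Det (loop (addBoth + addLeft + addRight) addEnd) σ
      {σ with a := [], b := [], c := [], u := (cells q).reverse ++ σ.u,
              v := (cells (addBits c p q)).reverse ++ σ.v} (7 * (p.length + q.length) + 4) := by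
  obtain ⟨w, x, y, n, r, a, b, m, u, v, c', s, g, d⟩ := σ
  subst ha hb hc
  induction c, p, q using addBits.induct generalizing u v with
  | case1 =>
    refine (Det.loop_done (n := 4) (Det.of_iff fun ρ => ?_) fun ρ => ?_).mono (by simp) <;>
      simp [-Bool.exists_bool, rel_addBoth, rel_addLeft, rel_addRight, rel_addEnd, addBits]
  | case2 c h =>
    obtain rfl : c = false := by simpa using h
    refine (Det.loop_done (n := 4) (Det.of_iff fun ρ => ?_) fun ρ => ?_).mono (by simp) <;>
      simp [-Bool.exists_bool, rel_addBoth, rel_addLeft, rel_addRight, rel_addEnd, addBits]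
  | case3 c p ps ih =>
    simp only [addBits, cells_cons, List.reverse_cons, List.append_assoc, List.singleton_append]
    refine (Det.loop_step (m := 7) (Det.of_iff fun ρ => ?_)
      (ih u (.bit (p ^^ c) :: v)) fun ρ => ?_).mono (by simp; omega)
    · simp [-Bool.exists_bool, rel_addBoth, rel_addLeft, rel_addRight]
    · simp [rel_addEnd]
  | case4 c q qs ih =>
    simp only [addBits, cells_cons, List.reverse_cons, List.append_assoc, List.singleton_append]
    refine (Det.loop_step (m := 7) (Det.of_iff fun ρ => ?_)
      (ih (.bit q :: u) (.bit (q ^^ c) :: v)) fun ρ => ?_).mono (by simp; omega)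
    · simp [-Bool.exists_bool, rel_addBoth, rel_addLeft, rel_addRight]
    · simp [rel_addEnd]
  | case5 c p ps q qs ih =>
    simp only [addBits, cells_cons, List.reverse_cons, List.append_assoc, List.singleton_append]
    refine (Det.loop_step (m := 7) (Det.of_iff fun ρ => ?_)
      (ih (.bit q :: u) (.bit (p ^^ q ^^ c) :: v)) fun ρ => ?_).mono (by simp; omega)
    · simp [-Bool.exists_bool, rel_addBoth, rel_addLeft, rel_addRight]
    · simp [rel_addEnd]

lemma Det.congr {P : Prog} {m : ℕ} (h : Det P σ τ m) (hτ : τ = ρ) (hmn : m ≤ n) :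
    Det P σ ρ n := hτ ▸ h.mono hmn

lemma Det.of_eq {P : Prog} {σ' : Store} (h : Det P σ τ n) (hσ : σ = σ') (hτ : τ = ρ) :
    Det P σ' ρ n := hσ ▸ hτ ▸ h

@[simp] lemma length_enc (n : ℕ) : (enc n).length = n.size := by
  simp [enc, Nat.size_eq_bits_len]

lemma det_add (σ : Store) {a b L : ℕ} (h : (a + b).size ≤ L) :
    Det add {σ with a := enc a, b := enc b, c := [], u := [], v := []}
      {σ with a := enc (a + b), b := enc b, c := [], u := [], v := []} (18 * L + 7) := by
  have ha : a.size ≤ L := (Nat.size_le_size (by omega)).trans h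
  have hb : b.size ≤ L := (Nat.size_le_size (by omega)).trans h
  have h1 := det_add_loop false a.bits b.bits
    {σ with a := enc a, b := enc b, c := [.bit false], u := [], v := []} rfl rfl rfl
  refine ((((det_push .c _).mul h1).mul (det_move (by decide) _)).mul
    (det_move (by decide) _)).congr ?_ ?_
  · simp [Store.get, Store.set, enc, addBits_bits]
  · simp only [Store.get, Store.set, List.length_append, List.length_reverse, length_cells,
      addBits_bits, List.length_nil, Nat.size_eq_bits_len]
    omega

/-! #### Multiplication -/

/-- Double the number in `a`. -/
def double : Prog :=
  isEmpty .a + alt bools fun p => pop .a (.bit p) * push .a (.bit p) * push .a (.bit false)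

lemma det_double (σ : Store) (a : ℕ) :
    Det double {σ with a := enc a} {σ with a := enc (2 * a)} 3 := by
  refine Det.of_iff fun ρ => ?_
  -- Zero is the empty list of digits, and prefixing a digit `0` to it would destroy the canonical
  -- form.
  rcases eq_or_ne a 0 with rfl | h
  · simp [double, Store.get, enc]
  · rw [enc, enc, Nat.bit0_bits a h]
    cases ha : a.bits with
    | nil => exact absurd (by simpa [ha] using (bval_bits a).symm) h
    | cons b l => cases b <;> simp [double, Store.get, Store.set, bools]

/-- Double the number in `a`, and add the number in `b` if a digit popped from `m` is `1`. -/
def hornerStep : Prog :=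
  alt bools fun p => pop .m (.bit p) * (double * if p then add else 1)

/-- Horner's scheme: the number whose binary digits are in `m`, the most significant digit first,
times the number in `b` is added to the number in `a`, which is shifted. -/
def horner : Prog := loop hornerStep (isEmpty .m)

/-- The result of Horner's scheme. -/
def hornerValue (b a : ℕ) (l : List Bool) : ℕ :=
  l.foldl (fun a p => 2 * a + if p then b else 0) a

/-- The values in Horner's scheme only grow, so a bound for the size of the result covers all the
intermediate additions. -/
lemma le_hornerValue (b a : ℕ) (l : List Bool) : a ≤ hornerValue b a l := by
  induction l generalizing a with
  | nil => exact le_rfl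
  | cons p l ih =>
    have h : a ≤ 2 * a + if p then b else 0 := by omega
    exact h.trans (ih _)

lemma hornerValue_reverse (b : ℕ) (l : List Bool) : hornerValue b 0 l.reverse = bval l * b := by
  induction l with
  | nil => simp [hornerValue]
  | cons p l ih =>
    simp only [hornerValue, List.reverse_cons, List.foldl_append] at ih ⊢
    rw [ih]
    cases p <;> simp [Nat.bit] <;> ring

lemma det_horner (σ : Store) {a b L : ℕ} {l : List Bool} (h : (hornerValue b a l).size ≤ L) :
    Det horner {σ with a := enc a, b := enc b, m := cells l, c := [], u := [], v := []}
      {σ with a := enc (hornerValue b a l), b := enc b, m := [], c := [], u := [], v := []}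
      (l.length * (18 * L + 11) + 1) := by
  induction l generalizing a with
  | nil => exact ((det_isEmpty rfl).loop_done (by simp [hornerStep, Store.get])).mono (by simp)
  | cons p l ih =>
    have h1 : Det hornerStep
        {σ with a := enc a, b := enc b, m := cells (p :: l), c := [], u := [], v := []}
        {σ with a := enc (2 * a + if p then b else 0), b := enc b, m := cells l, c := [],
                u := [], v := []} (18 * L + 11) := by
      refine Det.alt (mem_bools p) (((det_pop (l := cells l) rfl).mul
        ((det_double {σ with b := enc b, m := cells l, c := [], u := [], v := []} a).mul
          (n := 18 * L + 7) ?_)).mono (by omega)) fun q hq ρ => ?_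
      · cases p with
        | false => exact ⟨Runs.one.mono (by omega), by simp⟩
        | true =>
          have hle : 2 * a + b ≤ hornerValue b (2 * a + b) l := le_hornerValue _ _ _
          exact det_add {σ with m := cells l} ((Nat.size_le_size hle).trans h)
      · exact not_rel_pop_mul (by simp [Store.get, hq.symm])
    exact (h1.loop_step (ih h) (by simp [Store.get])).mono
      (by rw [List.length_cons, add_mul]; omega)

/-- Multiply the number in `a` by the number in `b`. -/
def mulAB : Prog := move .a .m * horner

lemma det_mulAB (σ : Store) {a b L : ℕ} (ha : a.size ≤ L) (h : (a * b).size ≤ L) :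
    Det mulAB {σ with a := enc a, b := enc b, m := [], c := [], u := [], v := []}
      {σ with a := enc (a * b), b := enc b, m := [], c := [], u := [], v := []}
      (L * (18 * L + 13) + 2) := by
  have e : hornerValue b 0 a.bits.reverse = a * b := by rw [hornerValue_reverse, bval_bits]
  refine ((det_move (by decide) _).mul
    ((det_horner σ (a := 0) (b := b) (L := L) (l := a.bits.reverse) (by rwa [e])).of_eq ?_
      rfl)).congr ?_ ?_
  · simp [Store.get, Store.set, enc, cells_reverse]
  · simp [e]
  · have : a.size * (18 * L + 11) ≤ L * (18 * L + 11) := Nat.mul_le_mul_right _ ha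
    simp only [Store.get, length_enc, List.length_reverse, ← Nat.size_eq_bits_len] at *
    nlinarith

/-- Square the number in `b`. -/
def squareB : Prog :=
  move .a .g * (loop (moveTwo allCells .b .u .m) (isEmpty .b) * (move .u .b * (horner *
    (clear .b * (move .a .u * (move .u .b * move .g .a))))))

/-- Horner's scheme accumulates in `a`, whose content is therefore put aside in `g`. Copying `b` to
both `u` and `m` leaves the digits in `m` with the most significant one on top, as the scheme needs,
and `b` is restored from `u`. -/
lemma det_squareB (σ : Store) {a b L : ℕ} (ha : a.size ≤ L) (h : (b * b).size ≤ L) :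
    Det squareB {σ with a := enc a, b := enc b, m := [], c := [], u := [], v := [], g := []}
      {σ with a := enc a, b := enc (b * b), m := [], c := [], u := [], v := [], g := []}
      (L * (18 * L + 25) + 8) := by
  have hb : b.size ≤ L := (Nat.size_le_size (Nat.le_mul_self b)).trans h
  have e : hornerValue b 0 b.bits.reverse = b * b := by rw [hornerValue_reverse, bval_bits]
  have h1 := det_horner {σ with g := (enc a).reverse} (a := 0) (b := b) (L := L)
    (l := b.bits.reverse) (by rwa [e])
  refine ((det_move (by decide) _).mul ((det_moveTwo_loop (t := enc b) (rest := []) (by decide)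
    (by decide) (by decide) (by simp) (by simp)
    (fun σ ρ h => by simp [((rel_isEmpty _).1 h).1]) (by simp [Store.get, Store.set])
    (det_isEmpty (by rfl))).mul
    ((det_move (by decide) _).mul ((h1.of_eq ?_ rfl).mul ((det_clear _ _).mul
      ((det_move (by decide) _).mul ((det_move (by decide) _).mul
        (det_move (by decide) _)))))))).congr ?_ ?_
  · simp [Store.get, Store.set, enc, cells_reverse]
  · simp [Store.get, Store.set, e]
  · have : b.size * (18 * L + 11) ≤ L * (18 * L + 11) := Nat.mul_le_mul_right _ hb
    simp only [Store.get, Store.set, e, length_enc, List.length_reverse, List.length_append,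
      List.length_nil, ← Nat.size_eq_bits_len] at *
    nlinarith

/-! #### Powers -/

/-- Use a digit of the exponent. -/
def powStep : Prog :=
  alt bools fun p => pop .w (.bit p) * (push .x (.bit p) * ((if p then mulAB else 1) * squareB))

/-- Multiply the number in `a` by a power of the number in `b`, whose exponent is read from `w`
and copied to `x`. -/
def pow : Prog := loop powStep (pop .w .endExp * (push .x .endExp * clear .b))

/-- Binary exponentiation starting from the least significant digit, with `a * b ^ bval l` as
invariant. The base is squared after every digit, including the last one, so `b ^ 2 ^ l.length` must
be bounded as well as the result. -/
lemma det_pow (σ : Store) {a b L : ℕ} {l : List Bool} {w x : List Cell} (ha : a.size ≤ L)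
    (h : (a * b ^ bval l).size ≤ L) (hb : (b ^ 2 ^ l.length).size ≤ L) :
    Det pow {σ with w := cells l ++ .endExp :: w, x := x, a := enc a, b := enc b, m := [],
                    c := [], u := [], v := [], g := []}
      {σ with w := w, x := .endExp :: ((cells l).reverse ++ x), a := enc (a * b ^ bval l), b := [],
              m := [], c := [], u := [], v := [], g := []}
      (l.length * (L * (36 * L + 38) + 12) + L + 3) := by
  induction l generalizing a b x with
  | nil =>
    refine (((det_pop (l := w) rfl).mul ((det_push _ _).mul (det_clear _ _))).loop_done
      (by simp [powStep, Store.get])).congr ?_ ?_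
    · simp [Store.get, Store.set]
    · simp [Store.get, Store.set] at hb ⊢
      omega
  | cons p l ih =>
    have e : (b * b) ^ 2 ^ l.length = b ^ 2 ^ (p :: l).length := by
      rw [← pow_two, ← pow_mul, List.length_cons, pow_succ']
    have hbb : (b * b).size ≤ L :=
      (Nat.size_le_size (Nat.le_self_pow (by positivity) _)).trans (e ▸ hb)
    have e2 : (a * if p then b else 1) * (b * b) ^ bval l = a * b ^ bval (p :: l) := by
      rw [← pow_two, ← pow_mul, bval_cons]
      cases p
      · simp
      · simp [pow_succ]; ring
    have ha' : (a * if p then b else 1).size ≤ L := by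
      -- For a positive base the new accumulator divides a product of bounded size. For the base
      -- zero it is `a` or `0`.
      rcases Nat.eq_zero_or_pos b with rfl | hb0
      · cases p <;> simp [ha]
      · exact (Nat.size_le_size (Nat.le_mul_of_pos_right _ (by positivity))).trans (e2 ▸ h)
    have h1 : Det powStep {σ with w := cells (p :: l) ++ .endExp :: w, x := x, a := enc a,
                                  b := enc b, m := [], c := [], u := [], v := [], g := []}
        {σ with w := cells l ++ .endExp :: w, x := .bit p :: x, a := enc (a * if p then b else 1),
                b := enc (b * b), m := [], c := [], u := [], v := [], g := []}
        (L * (36 * L + 38) + 12) := by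
      refine Det.alt (mem_bools p) (((det_pop (l := cells l ++ .endExp :: w) rfl).mul
        ((det_push _ _).mul (Det.mul (m := L * (18 * L + 13) + 2) ?_
          (det_squareB {σ with w := cells l ++ .endExp :: w, x := .bit p :: x} ha' hbb)))).mono
            (by nlinarith)) fun q hq ρ => ?_
      · cases p with
        | false =>
          have h0 : a * (if false then b else 1) = a := by simp
          exact h0.symm ▸ ⟨Runs.one.mono (by omega), fun ρ h => rel_one.1 h⟩
        | true =>
          exact det_mulAB {σ with w := cells l ++ .endExp :: w, x := .bit true :: x, g := []} ha
            (by simpa using ha')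
      · exact not_rel_pop_mul (by simp [Store.get, hq.symm])
    refine (h1.loop_step (ih ha' (e2 ▸ h) (e ▸ hb)) (by simp [Store.get])).congr ?_ ?_
    · rw [e2]
      simp
    · rw [List.length_cons, add_mul]
      omega

end Prog

/-! ### Partial sums of profiles -/

namespace Profile

lemma seq_eq_zero_of_height_lt (p : Profile) {i : ℕ} (hi : p.height < i) : p.seq i = 0 := by
  obtain ⟨n, hn⟩ := (isProfile_iff _).1 p.isProfile
  have hne : p.seq (p.height + 1) = 0 :=
    Nat.sInf_mem (s := {h : ℕ | p.seq (h + 1) = 0})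
      ⟨n, by_contra fun h => absurd ((hn _).1 h) (by omega)⟩
  by_contra h
  exact (hn _).2 (lt_of_le_of_lt hi ((hn i).1 h)) hne

lemma seq_ne_zero_of_le_height (p : Profile) (hp : p.seq 0 ≠ 0) {i : ℕ} (hi : i ≤ p.height) :
    p.seq i ≠ 0 := by
  cases i with
  | zero => exact hp
  | succ i =>
    have : i ∉ {h : ℕ | p.seq (h + 1) = 0} := Nat.notMem_of_lt_sInf (show i < p.height by omega)
    exact this

lemma eq_zero_of_seq_zero (p : Profile) (hp : p.seq 0 = 0) : p = 0 := by
  obtain ⟨n, hn⟩ := (isProfile_iff _).1 p.isProfile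
  ext i
  by_contra h
  exact (hn 0).2 (lt_of_le_of_lt (Nat.zero_le i) ((hn i).1 h)) hp

/-- The list of the partial sums of a list, starting from `s`. -/
def sums : ℕ → List ℕ → List ℕ
  | _, [] => []
  | s, n :: l => (s + n) :: sums (s + n) l

/-- The list of the partial sums `p_0`, `p_0 + p_1`, …, up to the height. -/
noncomputable def psums (p : Profile) : List ℕ :=
  (List.range (p.height + 1)).map fun i => p.psum (i + 1)

lemma sums_map_range (p : Profile) (k n : ℕ) :
    sums (p.psum k) ((List.range n).map fun i => p.seq (k + i)) =
      (List.range n).map fun i => p.psum (k + i + 1) := by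
  induction n generalizing k with
  | zero => rfl
  | succ n ih =>
    have h : p.psum k + p.seq k = p.psum (k + 1) := (Finset.sum_range_succ _ _).symm
    simp only [List.range_succ_eq_map, List.map_cons, List.map_map, sums, add_zero, h,
      List.cons.injEq, true_and]
    have := ih (k + 1)
    simpa [Function.comp_def, add_assoc, add_comm, add_left_comm] using this

lemma sums_entries (p : Profile) : sums 0 p.entries = p.psums := by
  have := sums_map_range p 0 (p.height + 1)
  simpa [psum, entries, psums] using this

lemma height_zero : (0 : Profile).height = 0 :=
  Nat.sInf_eq_zero.2 (.inl rfl)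

lemma entries_zero : (0 : Profile).entries = [0] := by
  simp only [entries, height_zero]
  rfl

lemma entries_cases (p : Profile) :
    p = 0 ∨ p.entries ≠ [] ∧ ∀ n ∈ p.entries, n ≠ 0 := by
  rcases eq_or_ne (p.seq 0) 0 with h | h
  · exact .inl (p.eq_zero_of_seq_zero h)
  · refine .inr ⟨by simp [entries], fun n hn => ?_⟩
    simp only [entries, List.mem_map, List.mem_range] at hn
    obtain ⟨i, hi, rfl⟩ := hn
    exact p.seq_ne_zero_of_le_height h (by omega)

/-- Needed for soundness: every non-empty list of positive numbers that can be guessed or read is a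
genuine profile. -/
lemma exists_entries_eq (l : List ℕ) (hl : l ≠ []) (h : ∀ n ∈ l, n ≠ 0) :
    ∃ p : Profile, p.entries = l := by
  have hp : ∀ i, l.getD i 0 ≠ 0 ↔ i < l.length := by
    intro i
    by_cases hi : i < l.length
    · simpa [hi] using h _ (List.getElem_mem hi)
    · simp [hi]
  have hlen : 0 < l.length := List.length_pos_iff.2 hl
  let p : Profile := ⟨fun i => l.getD i 0, (isProfile_iff _).2 ⟨l.length, hp⟩⟩
  have hh : p.height = l.length - 1 := by
    refine le_antisymm (Nat.sInf_le ?_) (le_csInf ⟨l.length, ?_⟩ fun k hk => ?_)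
    · show l.getD _ 0 = 0
      exact List.getD_eq_default _ _ (by omega)
    · show l.getD _ 0 = 0
      exact List.getD_eq_default _ _ (by omega)
    · have := mt (hp (k + 1)).2 (not_not.2 hk)
      omega
  refine ⟨p, List.ext_getElem (by simp [entries, hh]; omega) fun i h1 h2 => ?_⟩
  simp [entries, p, h2]

end Profile

/-- The encoding of a list of numbers on a stack. -/
def encNums (l : List ℕ) : List Cell := l.flatMap fun n => enc n ++ [.endNum]

@[simp] lemma encNums_nil : encNums [] = [] := rfl

@[simp] lemma encNums_cons (n : ℕ) (l : List ℕ) :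
    encNums (n :: l) = enc n ++ .endNum :: encNums l := by simp [encNums]

/-- The symbols of the input as symbols of the stack alphabet. -/
def EqSymbol.toCell : EqSymbol → Cell
  | .bit b => .bit b
  | .endNum => .endNum
  | .endProfile => .endProfile
  | .endTerm => .endTerm
  | .endPoly => .endPoly

lemma EqSymbol.toCell_injective : Function.Injective EqSymbol.toCell := by
  intro s t h
  cases s <;> cases t <;> simp_all [EqSymbol.toCell]

lemma map_codeNat (n : ℕ) : (codeNat n).map EqSymbol.toCell = enc n ++ [.endNum] := by
  simp [codeNat, encodeNat_eq_bits, enc, cells, EqSymbol.toCell, Function.comp_def]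

lemma map_codeProfile (p : Profile) :
    (codeProfile p).map EqSymbol.toCell = encNums p.entries ++ [.endProfile] := by
  simp [codeProfile, encNums, List.map_flatMap, map_codeNat, EqSymbol.toCell]

/-! ### Converting a profile to its partial sums -/

namespace Prog

open Store Profile

variable {σ τ ρ : Store} {n : ℕ}

/-- For soundness nothing has to be known about where the transfer stops: any prefix of symbols of
`l` may have been moved, and it is left to `Q` to reject wrong choices. -/
lemma Rel.moveOne_loop {l : List Cell} {i j : Reg} (hij : i ≠ j) {Q : Prog}
    (h : Rel (loop (moveOne l i j) Q) σ τ) : ∃ t rest, (∀ s ∈ t, s ∈ l) ∧ σ.get i = t ++ rest ∧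
      Rel Q ((σ.set i rest).set j (t.reverse ++ σ.get j)) τ := by
  obtain ⟨ρ, h1, h2⟩ := rel_mul.1 h
  refine h1.star_induction (fun σ => ∃ t rest, (∀ s ∈ t, s ∈ l) ∧ σ.get i = t ++ rest ∧
      Rel Q ((σ.set i rest).set j (t.reverse ++ σ.get j)) τ) ?_ ?_
  · refine ⟨[], ρ.get i, by simp, rfl, by simpa using h2⟩
  · rintro ρ₁ ρ₂ h - ⟨t, rest, ht, hi, hQ⟩
    simp only [moveOne, rel_alt, rel_mul, rel_pop, rel_push] at h
    obtain ⟨s, hs, _, ⟨r, hr, rfl⟩, rfl⟩ := h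
    refine ⟨s :: t, rest, ?_, ?_, ?_⟩
    · simpa [hs] using ht
    · simpa [get_set_of_ne _ hij, hr] using hi
    · simpa [get_set_of_ne _ hij.symm, set_comm _ hij] using hQ

/-- The store in which the stacks used for additions are empty. -/
def clean (σ : Store) : Store := {σ with a := [], b := [], c := [], u := [], v := []}

/-- The binary digits as symbols. -/
def bitCells : List Cell := [.bit false, .bit true]

lemma mem_bitCells (b : Bool) : .bit b ∈ bitCells := by cases b <;> decide

lemma mem_bitCells_of_mem_cells {l : List Bool} {s : Cell} (h : s ∈ cells l) : s ∈ bitCells := by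
  obtain ⟨b, -, rfl⟩ := List.mem_map.1 h
  exact mem_bitCells b

lemma exists_cells_eq {t : List Cell} (h : ∀ s ∈ t, s ∈ bitCells) : ∃ l, t = cells l := by
  induction t with
  | nil => exact ⟨[], rfl⟩
  | cons s t ih =>
    obtain ⟨l, rfl⟩ := ih fun s hs => h s (by simp [hs])
    have hs : s = .bit false ∨ s = .bit true := by simpa [bitCells] using h s (by simp)
    rcases hs with rfl | rfl
    exacts [⟨false :: l, rfl⟩, ⟨true :: l, rfl⟩]

/-- Copy the number in `a` to `x`. -/
def emit : Prog :=
  loop (moveTwo allCells .a .u .x) (isEmpty .a) * (push .x .endNum * move .u .a)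

lemma det_emit (σ : Store) (a : ℕ) :
    Det emit {σ with a := enc a, u := []}
      {σ with a := enc a, u := [], x := (enc a ++ [Cell.endNum]).reverse ++ σ.x}
      (5 * a.size + 3) := by
  refine ((det_moveTwo_loop (t := enc a) (rest := []) (by decide) (by decide) (by decide)
    (by simp) (by simp) (fun σ ρ h => by simp [((rel_isEmpty _).1 h).1]) (by simp [Store.get])
    (det_isEmpty (by rfl))).mul ((det_push _ _).mul (det_move (by decide) _))).congr ?_ ?_
  · simp [Store.get, Store.set]
  · simp [Store.get, Store.set]
    omega

/-- Read a positive number from `y` into `b`. -/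
def readPos : Prog :=
  loop (moveOne bitCells .y .u)
    (pop .y .endNum * (pop .u (.bit true) * (push .u (.bit true) * move .u .b)))

/-- After the transfer to `u` the most significant digit is on top. Popping `1` there checks at once
that the number is positive and written without leading zeros. -/
lemma rel_readPos (σ : Store) (h : Rel readPos {σ with u := [], b := []} τ) :
    ∃ n rest, n ≠ 0 ∧ σ.y = enc n ++ .endNum :: rest ∧
      τ = {σ with y := rest, u := [], b := enc n} := by
  obtain ⟨t, rest, ht, hy, h⟩ := h.moveOne_loop (by decide)
  obtain ⟨l, rfl⟩ := exists_cells_eq ht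
  simp only [rel_mul, rel_pop, rel_push, (det_move (show Reg.u ≠ Reg.b by decide) _).rel_iff] at h
  obtain ⟨_, ⟨r, hr, rfl⟩, _, ⟨l', hl', rfl⟩, _, rfl, rfl⟩ := h
  simp only [Store.get, Store.set, List.append_nil] at hr hl' hy
  have hl : l.getLast? = some true := by
    rw [cells_reverse] at hl'
    cases hrev : l.reverse with
    | nil => simp [hrev] at hl'
    | cons b l'' =>
      rw [hrev] at hl'
      obtain rfl : b = true := by simpa using (List.cons.inj hl').1
      rw [← List.reverse_reverse l, hrev]
      simp
  have hb : (bval l).bits = l := bits_bval (by simp [hl])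
  refine ⟨bval l, r, fun h0 => ?_, by rw [enc, hb, hy, hr], ?_⟩
  · rw [h0] at hb
    simp [← hb] at hl
  · simp [Store.get, Store.set, ← hl', enc, hb]

lemma runs_readPos (σ : Store) {n : ℕ} (hn : n ≠ 0) {rest : List Cell} :
    Runs readPos {σ with y := enc n ++ .endNum :: rest, u := [], b := []}
      {σ with y := rest, u := [], b := enc n} (4 * n.size + 4) := by
  have hl : ∃ l, (enc n).reverse = .bit true :: l := by
    rw [enc, cells_reverse]
    cases hrev : n.bits.reverse with
    | nil =>
      have h0 := bval_bits n
      rw [List.reverse_eq_nil_iff.1 hrev] at h0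
      exact absurd h0.symm hn
    | cons b l =>
      have := getLast?_bits n
      rw [← List.reverse_reverse n.bits, hrev] at this
      cases b with
      | true => exact ⟨_, rfl⟩
      | false => simp at this
  obtain ⟨l, hl⟩ := hl
  have hlen : (enc n).length = l.length + 1 := by rw [← List.length_reverse, hl]; rfl
  rw [length_enc] at hlen
  refine ((det_moveOne_loop (t := enc n) (rest := .endNum :: rest) (by decide)
    (fun s hs => mem_bitCells_of_mem_cells hs) (by simp [bitCells])
    (fun σ ρ h => ?_) rfl ((det_pop rfl).mul ((det_pop (l := l) ?_).mul ((det_push _ _).mul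
      (det_move (by decide) _))))).congr ?_ ?_).1
  · simp only [rel_mul, rel_pop] at h
    obtain ⟨_, ⟨r, hr, -⟩, -⟩ := h
    simp [hr, bitCells]
  · simp [Store.get, Store.set, hl]
  · simp [Store.get, Store.set, ← hl]
  · simp [Store.get, Store.set, hlen]
    omega

/-- Read a positive entry of a profile, add it to the number in `a`, and copy the sum to `x`. -/
def convertEntry : Prog := readPos * (add * (clear .b * emit))

lemma det_convertEntry_tail (σ : Store) {s n L : ℕ} (h : (s + n).size ≤ L) :
    Det (add * (clear .b * emit)) {clean σ with a := enc s, b := enc n}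
      {clean σ with a := enc (s + n), x := (enc (s + n) ++ [Cell.endNum]).reverse ++ σ.x}
      (24 * L + 11) := by
  refine ((det_add (clean σ) h).mul ((det_clear _ _).mul (det_emit (clean σ) (s + n)))).congr
    rfl ?_
  have : n.size ≤ L := (Nat.size_le_size (by omega)).trans h
  simp [Store.get]
  omega

/-- Read the positive entries of a profile up to its end. -/
def convertEntries : Prog := loop convertEntry (pop .y .endProfile)

lemma rel_convertEntry (σ : Store) {s : ℕ} (h : Rel convertEntry {clean σ with a := enc s} τ) :
    ∃ n rest, n ≠ 0 ∧ σ.y = enc n ++ .endNum :: rest ∧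
      τ = {clean σ with y := rest, a := enc (s + n),
                        x := (enc (s + n) ++ [Cell.endNum]).reverse ++ σ.x} := by
  obtain ⟨ρ, h1, h2⟩ := rel_mul.1 h
  obtain ⟨n, rest, hn, hy, rfl⟩ := rel_readPos {clean σ with a := enc s} h1
  exact ⟨n, rest, hn, hy, (det_convertEntry_tail {σ with y := rest} le_rfl).2 _ h2⟩

lemma runs_convertEntry (σ : Store) {s n L : ℕ} (hn : n ≠ 0) (h : (s + n).size ≤ L)
    {rest : List Cell} :
    Runs convertEntry {clean σ with y := enc n ++ .endNum :: rest, a := enc s}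
      {clean σ with y := rest, a := enc (s + n),
                    x := (enc (s + n) ++ [Cell.endNum]).reverse ++ σ.x} (28 * L + 15) := by
  have : n.size ≤ L := (Nat.size_le_size (by omega)).trans h
  exact ((runs_readPos {clean σ with a := enc s} hn).mul
    (det_convertEntry_tail {σ with y := rest} h).1).mono (by omega)

lemma rel_convertEntries (σ : Store) {s : ℕ}
    (h : Rel convertEntries {clean σ with a := enc s} τ) :
    ∃ l rest, (∀ n ∈ l, n ≠ 0) ∧ σ.y = encNums l ++ .endProfile :: rest ∧
      τ = {clean σ with y := rest, a := enc (s + l.sum),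
                        x := (encNums (sums s l)).reverse ++ σ.x} := by
  obtain ⟨ρ, h1, h2⟩ := rel_mul.1 h
  obtain ⟨r, hr, rfl⟩ := (rel_pop _ _).1 h2
  refine h1.star_induction (fun σ' => ∀ σ s, σ' = {clean σ with a := enc s} →
    ∃ l rest, (∀ n ∈ l, n ≠ 0) ∧ σ.y = encNums l ++ .endProfile :: rest ∧
      ρ.set .y r = {clean σ with
        y := rest, a := enc (s + l.sum), x := (encNums (sums s l)).reverse ++ σ.x}) ?_ ?_ σ s rfl
  · rintro σ s rfl
    exact ⟨[], r, by simp, hr, by simp [Store.set, sums, clean]⟩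
  · rintro ρ₁ ρ₂ h - ih σ s rfl
    obtain ⟨n, rest, hn, hy, rfl⟩ := rel_convertEntry σ h
    obtain ⟨l, rest', hl, hy', he⟩ := ih {clean σ with
      y := rest, x := (enc (s + n) ++ [Cell.endNum]).reverse ++ σ.x} (s + n) rfl
    simp only at hy'
    refine ⟨n :: l, rest', by simpa using ⟨hn, hl⟩, by rw [hy, hy']; simp, he.trans ?_⟩
    simp [sums, clean, add_assoc]

lemma runs_convertEntries (σ : Store) {s L : ℕ} {l : List ℕ} (hl : ∀ n ∈ l, n ≠ 0)
    (h : (s + l.sum).size ≤ L) {rest : List Cell} :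
    Runs convertEntries {clean σ with y := encNums l ++ .endProfile :: rest, a := enc s}
      {clean σ with y := rest, a := enc (s + l.sum), x := (encNums (sums s l)).reverse ++ σ.x}
      (l.length * (28 * L + 15) + 1) := by
  induction l generalizing s σ with
  | nil => simpa [sums, Store.set, clean, convertEntries] using (det_pop rfl).1.loop_done
  | cons n l ih =>
    have h1 : (s + n).size ≤ L :=
      (Nat.size_le_size (by simp only [List.sum_cons]; omega)).trans h
    have h2 := runs_convertEntry σ (hl n (by simp)) h1
      (rest := encNums l ++ .endProfile :: rest)
    have h3 := ih {σ with x := (enc (s + n) ++ [Cell.endNum]).reverse ++ σ.x} (s := s + n)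
      (fun n hn => hl n (by simp [hn])) (by simpa [add_assoc] using h)
    have h4 := (h2.loop_step h3).mono
      (show _ ≤ (n :: l).length * (28 * L + 15) + 1 by rw [List.length_cons, add_mul]; omega)
    simpa [sums, clean, add_assoc, convertEntries] using h4

/-- Read a profile from `y`, and write its partial sums to `x`. -/
def convert : Prog :=
  pop .y .endNum * (pop .y .endProfile * push .x .endNum) +
    convertEntry * (convertEntries * clear .a)

lemma psums_zero : (0 : Profile).psums = [0] := by
  rw [← sums_entries, entries_zero]
  rfl

/-- The two branches match the two shapes of the code of a profile, `(0)` and a non-empty sequence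
of positive numbers (`entries_cases`). A successful run thus also certifies that the text read is
the code of a profile. -/
lemma rel_convert (σ : Store) (h : Rel convert (clean σ) τ) :
    ∃ p : Profile, ∃ rest, σ.y = encNums p.entries ++ .endProfile :: rest ∧
      τ = clean {σ with y := rest, x := (encNums p.psums).reverse ++ σ.x} := by
  rcases rel_add.1 h with h | h
  · simp only [rel_mul, rel_pop, rel_push] at h
    obtain ⟨_, ⟨l, hl, rfl⟩, _, ⟨l', hl', rfl⟩, rfl⟩ := h
    refine ⟨0, l', ?_, ?_⟩
    · rw [entries_zero]
      simp only [Store.get, Store.set, clean] at hl hl'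
      simp [hl, hl', enc]
    · simp [psums_zero, enc, Store.get, Store.set, clean]
  · obtain ⟨_, h1, h2⟩ := rel_mul.1 h
    obtain ⟨n, rest, hn, hy, rfl⟩ := rel_convertEntry (s := 0) σ h1
    obtain ⟨_, h2, h3⟩ := rel_mul.1 h2
    obtain ⟨l, rest', hl, hy', rfl⟩ := rel_convertEntries (s := 0 + n) {σ with
      y := rest, x := (enc (0 + n) ++ [Cell.endNum]).reverse ++ σ.x} h2
    obtain ⟨p, hp⟩ := exists_entries_eq (n :: l) (by simp) (by simpa using ⟨hn, hl⟩)
    refine ⟨p, rest', ?_, ?_⟩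
    · simp only at hy'
      rw [hp, hy, hy']
      simp
    · rw [(det_clear _ _).2 _ h3, ← sums_entries, hp]
      simp [Store.set, clean, sums]

lemma runs_convert (σ : Store) (p : Profile) {L : ℕ} (h : p.entries.sum.size ≤ L)
    (rest : List Cell) :
    Runs convert (clean {σ with y := encNums p.entries ++ .endProfile :: rest})
      (clean {σ with y := rest, x := (encNums p.psums).reverse ++ σ.x})
      (p.entries.length * (28 * L + 15) + L + 3) := by
  rcases p.entries_cases with rfl | ⟨hne, hp⟩
  · rw [entries_zero, psums_zero]
    exact (((det_pop rfl).mul ((det_pop rfl).mul (det_push _ _))).1.left).mono (by omega)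
  · rw [← sums_entries]
    cases he : p.entries with
    | nil => exact absurd he hne
    | cons n l =>
      rw [he] at h hp
      simp only [List.sum_cons] at h
      have h1 := runs_convertEntry σ (s := 0) (n := n) (L := L) (hp n (by simp))
        ((Nat.size_le_size (by omega)).trans h)
        (rest := encNums l ++ .endProfile :: rest)
      have h2 := runs_convertEntries {σ with x := (enc (0 + n) ++ [Cell.endNum]).reverse ++ σ.x}
        (s := 0 + n) (L := L) (l := l) (fun n hn => hp n (by simp [hn])) (by simpa using h)
        (rest := rest)
      have h3 := (h1.mul (h2.mul (det_clear .a _).1)).right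
        (P := pop .y .endNum * (pop .y .endProfile * push .x .endNum))
      have h4 := h3.mono (n := (n :: l).length * (28 * L + 15) + L + 3) (by
        simp only [Store.get, length_enc, zero_add, List.length_cons, add_mul]
        omega)
      simpa [Store.set, clean, convert, enc, sums] using h4

end Prog

/-! ### Parsing of the input -/

lemma length_encNums (l : List ℕ) : (encNums l).length = (l.map fun n => n.size + 1).sum := by
  induction l with
  | nil => rfl
  | cons n l ih => simp [ih]; omega

lemma size_add_le (m n : ℕ) : (m + n).size ≤ m.size + (n.size + 1) := by
  rw [Nat.size_le]
  have h1 := Nat.lt_size_self m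
  have h2 := Nat.lt_size_self n
  have h3 : 1 ≤ 2 ^ m.size := Nat.one_le_two_pow
  have h4 : 1 ≤ 2 ^ n.size := Nat.one_le_two_pow
  rw [pow_add, pow_succ]
  nlinarith

lemma size_sum_le (l : List ℕ) : l.sum.size ≤ (encNums l).length := by
  induction l with
  | nil => simp
  | cons n l ih =>
    rw [List.sum_cons, add_comm]
    exact (size_add_le _ _).trans (by simp; omega)

lemma length_le_encNums (l : List ℕ) : l.length ≤ (encNums l).length := by
  induction l with
  | nil => simp
  | cons n l ih => simp; omega

namespace Prog

open Store Profile

variable {σ τ ρ : Store} {n : ℕ} {α β : Type} {P Q : Prog}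

/-- The program `P` reads the code of an object from `y`, and writes another code of it to `x`. -/
structure Parses (P : Prog) (code out : α → List Cell) : Prop where
  sound : ∀ σ τ : Store, Rel P (clean σ) τ → ∃ a rest, σ.y = code a ++ rest ∧
    τ = clean {σ with y := rest, x := (out a).reverse ++ σ.x}
  runs : ∃ K, ∀ (σ : Store) (a : α) (rest : List Cell), Runs P (clean {σ with y := code a ++ rest})
    (clean {σ with y := rest, x := (out a).reverse ++ σ.x}) (K * ((code a).length + 1) ^ 2)

lemma Parses.push (s : Cell) : Parses (push .x s) (fun _ : Unit => []) fun _ => [s] where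
  sound σ _ h := ⟨(), σ.y, rfl, (rel_push _ _).1 h⟩
  runs := ⟨1, fun _ _ _ => (det_push .x s).1⟩

lemma Parses.pop (s : Cell) : Parses (pop .y s) (fun _ : Unit => [s]) fun _ => [] where
  sound σ τ h := by
    obtain ⟨l, hl, rfl⟩ := (rel_pop _ _).1 h
    exact ⟨(), l, hl, rfl⟩
  runs := ⟨1, fun σ _ rest => (det_pop rfl).1.mono (by simp)⟩

lemma Parses.mul {code out : α → List Cell} {code' out' : β → List Cell}
    (hP : Parses P code out) (hQ : Parses Q code' out') :
    Parses (P * Q) (fun p : α × β => code p.1 ++ code' p.2) fun p => out p.1 ++ out' p.2 where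
  sound σ τ h := by
    obtain ⟨ρ, h1, h2⟩ := rel_mul.1 h
    obtain ⟨a, rest, ha, rfl⟩ := hP.sound _ _ h1
    obtain ⟨b, rest', hb, rfl⟩ := hQ.sound _ _ h2
    exact ⟨(a, b), rest', by simp only at hb; rw [ha, hb, List.append_assoc], by simp⟩
  runs := by
    obtain ⟨K, hK⟩ := hP.runs
    obtain ⟨K', hK'⟩ := hQ.runs
    refine ⟨K + K', fun σ ⟨a, b⟩ rest => ?_⟩
    have h1 := hK σ a (code' b ++ rest)
    have h2 := hK' {σ with x := (out a).reverse ++ σ.x} b rest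
    have h3 := h1.mul h2
    simp only [List.append_assoc, List.reverse_append, List.length_append]
    refine h3.mono ?_
    have e1 : ((code a).length + 1) ^ 2 ≤ ((code a).length + (code' b).length + 1) ^ 2 :=
      Nat.pow_le_pow_left (by omega) 2
    have e2 : ((code' b).length + 1) ^ 2 ≤ ((code a).length + (code' b).length + 1) ^ 2 :=
      Nat.pow_le_pow_left (by omega) 2
    rw [add_mul]
    exact add_le_add (Nat.mul_le_mul_left _ e1) (Nat.mul_le_mul_left _ e2)

/-- Replaces the nested products arising from sequential composition by the intended structures.
Surjectivity ensures that every object is still covered by the completeness part. -/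
lemma Parses.of_surjective {code out : α → List Cell} {code' out' : β → List Cell}
    (h : Parses P code out) (f : α → β) (hf : Function.Surjective f)
    (hc : ∀ a, code' (f a) = code a) (ho : ∀ a, out' (f a) = out a) : Parses P code' out' where
  sound σ τ hr := by
    obtain ⟨a, rest, h1, h2⟩ := h.sound σ τ hr
    exact ⟨f a, rest, by rw [hc, h1], by rw [ho, h2]⟩
  runs := by
    obtain ⟨K, hK⟩ := h.runs
    refine ⟨K, fun σ b rest => ?_⟩
    obtain ⟨a, rfl⟩ := hf b
    rw [hc, ho]
    exact hK σ a rest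

lemma Parses.rel_star {code out : α → List Cell} (hP : Parses P code out)
    (h : Rel P.star (clean σ) τ) : ∃ (l : List α) (rest : _), σ.y = l.flatMap code ++ rest ∧
      τ = clean {σ with y := rest, x := (l.flatMap out).reverse ++ σ.x} := by
  refine h.star_induction (fun σ' => ∀ σ : Store, σ' = clean σ → ∃ (l : List α) (rest : _),
    σ.y = l.flatMap code ++ rest ∧
      τ = clean {σ with y := rest, x := (l.flatMap out).reverse ++ σ.x}) ?_ ?_ σ rfl
  · rintro σ rfl
    exact ⟨[], σ.y, rfl, rfl⟩
  · rintro ρ ρ' h - ih σ rfl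
    obtain ⟨a, rest, ha, rfl⟩ := hP.sound _ _ h
    obtain ⟨l, rest', hl, rfl⟩ := ih _ rfl
    simp only at hl
    exact ⟨a :: l, rest', by simp [ha, hl], by simp⟩

lemma Parses.runs_star {code out : α → List Cell} (hP : Parses P code out)
    (hne : ∀ a, code a ≠ []) : ∃ K, ∀ (σ : Store) (l : List α) (rest : List Cell),
      Runs P.star (clean {σ with y := l.flatMap code ++ rest})
        (clean {σ with y := rest, x := (l.flatMap out).reverse ++ σ.x})
        (K * (l.flatMap code).length ^ 2) := by
  obtain ⟨K, hK⟩ := hP.runs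
  -- Codes are non-empty, so `(m + 1) ^ 2 ≤ (2 * m) ^ 2` for the length `m` of each of them. The
  -- factor 4 then makes the sum of the costs quadratic in the total length.
  refine ⟨4 * K, fun σ l rest => ?_⟩
  induction l generalizing σ with
  | nil => exact Runs.star_nil.mono (by simp)
  | cons a l ih =>
    have h1 := hK σ a (l.flatMap code ++ rest)
    have h2 := (h1.star_cons (ih {σ with x := (out a).reverse ++ σ.x})).mono
      (n := 4 * K * ((a :: l).flatMap code).length ^ 2) (by
        have := List.length_pos_iff.2 (hne a)
        simp only [List.flatMap_cons, List.length_append]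
        generalize (code a).length = m at *
        generalize (l.flatMap code).length = k
        have e1 : (m + 1) ^ 2 + 4 * k ^ 2 ≤ 4 * (m + k) ^ 2 := by
          have := Nat.pow_le_pow_left (show m + 1 ≤ 2 * m by omega) 2
          nlinarith [Nat.zero_le (m * k)]
        calc _ = K * ((m + 1) ^ 2 + 4 * k ^ 2) := by ring
          _ ≤ K * (4 * (m + k) ^ 2) := Nat.mul_le_mul_left _ e1
          _ = _ := by ring)
    simpa using h2

lemma Parses.loop {code out : α → List Cell} {code' out' : β → List Cell}
    (hP : Parses P code out) (hne : ∀ a, code a ≠ []) (hQ : Parses Q code' out') :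
    Parses (loop P Q) (fun p : List α × β => p.1.flatMap code ++ code' p.2)
      fun p => p.1.flatMap out ++ out' p.2 :=
  Parses.mul ⟨fun _ _ h => hP.rel_star h, by
    obtain ⟨K, hK⟩ := hP.runs_star hne
    exact ⟨K, fun σ l rest => (hK σ l rest).mono
      (Nat.mul_le_mul_left _ (Nat.pow_le_pow_left (by omega) 2))⟩⟩ hQ

lemma Parses.convert :
    Parses convert (fun p : Profile => encNums p.entries ++ [.endProfile])
      fun p => encNums p.psums where
  sound σ τ h := by
    obtain ⟨p, rest, h1, h2⟩ := rel_convert σ h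
    exact ⟨p, rest, by simpa using h1, h2⟩
  runs := ⟨47, fun σ p rest => by
    have := runs_convert σ p (size_sum_le p.entries) rest
    rw [List.append_assoc, List.singleton_append]
    refine this.mono ?_
    have h1 := length_le_encNums p.entries
    rw [List.length_append, List.length_singleton]
    generalize (encNums p.entries).length = k at *
    have : p.entries.length * (28 * k + 15) ≤ k * (28 * k + 15) := Nat.mul_le_mul_right _ h1
    nlinarith⟩

lemma runs_moveOne_loop {l : List Cell} {i j : Reg} (hij : i ≠ j) {t rest : List Cell}
    (ht : ∀ s ∈ t, s ∈ l) (hσ : σ.get i = t ++ rest)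
    (h : Runs Q ((σ.set i rest).set j (t.reverse ++ σ.get j)) τ n) :
    Runs (loop (moveOne l i j) Q) σ τ (2 * t.length + n) := by
  induction t generalizing σ with
  | nil =>
    have e : (σ.set i rest).set j (σ.get j) = σ := by
      rw [set_comm _ hij.symm, set_get_self, ← (by simpa using hσ : σ.get i = rest), set_get_self]
    simp only [List.reverse_nil, List.nil_append, e] at h
    exact h.loop_done.mono (by simp)
  | cons s t ih =>
    have h1 : Runs (moveOne l i j) σ ((σ.set i (t ++ rest)).set j (s :: σ.get j)) 2 :=
      Runs.alt (ht s (by simp))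
        (by simpa [get_set_of_ne _ hij.symm] using ((det_pop hσ).mul (det_push j s)).1)
    refine (h1.loop_step (ih (fun s hs => ht s (by simp [hs])) ?_ ?_)).mono
      (n := 2 * (s :: t).length + n) (by simp; omega)
    · simp [get_set_of_ne _ hij]
    · simpa [get_set_of_ne _ hij.symm, set_comm _ hij] using h

/-- Copy a number from `y` to `x`, between the given symbols. -/
def copyNum (s t : Cell) : Prog :=
  push .x s * (loop (moveOne bitCells .y .x)
    (pop .y .endNum * (alt [.bit true, s] (fun s => pop .x s * push .x s) * push .x t)))

/-- Once the digits have been moved, the top of `x` is the most significant digit, or the marker `s`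
if there are no digits. Popping and pushing back either `1` or `s` excludes leading zeros, provided
that `s` is not itself a digit. -/
lemma Parses.copyNum (s t : Cell) (hs : ∀ b, s ≠ .bit b) :
    Parses (copyNum s t) (fun n : ℕ => enc n ++ [.endNum]) fun n => s :: enc n ++ [t] where
  sound σ τ h := by
    obtain ⟨_, h1, h2⟩ := rel_mul.1 h
    obtain rfl := (rel_push _ _).1 h1
    obtain ⟨t', rest, ht, hy, h⟩ := h2.moveOne_loop (by decide)
    obtain ⟨l, rfl⟩ := exists_cells_eq ht
    simp only [rel_mul, rel_pop, rel_push, rel_alt] at h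
    obtain ⟨_, ⟨r, hr, rfl⟩, _, ⟨s', hs', _, ⟨l', hl', rfl⟩, rfl⟩, rfl⟩ := h
    simp only [Store.get, Store.set] at hr hl' hy
    have hl : l.getLast? ≠ some false := by
      rw [cells_reverse] at hl'
      cases hrev : l.reverse with
      | nil => simp [List.reverse_eq_nil_iff.1 hrev]
      | cons b l'' =>
        rw [hrev] at hl'
        obtain rfl : .bit b = s' := (List.cons.inj hl').1
        obtain rfl : b = true := by simpa [(hs b).symm] using hs'
        rw [← List.reverse_reverse l, hrev]
        simp
    have hb : (bval l).bits = l := bits_bval hl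
    refine ⟨bval l, r, ?_, ?_⟩
    · rw [enc, hb]
      simpa [clean, hr] using hy
    · simp [Store.get, Store.set, clean, ← hl', enc, hb]
  runs := ⟨7, fun σ n rest => by
    have hl : ∃ s' ∈ [.bit true, s], ∃ l, (enc n).reverse ++ s :: σ.x = s' :: l := by
      rw [enc, cells_reverse]
      cases hrev : n.bits.reverse with
      | nil => exact ⟨s, by simp, σ.x, rfl⟩
      | cons b l =>
        have := getLast?_bits n
        rw [← List.reverse_reverse n.bits, hrev] at this
        cases b with
        | true => exact ⟨_, by simp, _, rfl⟩
        | false => simp at this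
    obtain ⟨s', hs', l, hl⟩ := hl
    have h1 := (det_push .x s).1.mul (runs_moveOne_loop (l := bitCells) (i := .y) (j := .x)
      (σ := (clean {σ with y := enc n ++ [.endNum] ++ rest}).set .x (s :: σ.x))
      (t := enc n) (rest := .endNum :: rest) (by decide)
      (fun s hs => mem_bitCells_of_mem_cells hs) (by simp [Store.get, Store.set, clean])
      ((det_pop (k := .y) (s := .endNum) (l := rest) rfl).1.mul ((Runs.alt (f := fun s => Prog.pop .x s * Prog.push .x s) hs' ((det_pop (l := l) ?_).mul (det_push _ _)).1).mul
        (det_push .x t).1)))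
    · have h2 := h1.mono (n := 7 * ((enc n ++ [Cell.endNum]).length + 1) ^ 2) (by
        simp
        nlinarith)
      simpa [Store.get, Store.set, clean, ← hl, Prog.copyNum] using h2
    · simpa [Store.get, Store.set, clean] using hl⟩

end Prog

/-! ### Texts with variables -/

/-- A text which may contain variables. -/
abbrev Template := List (Cell ⊕ ℕ)

namespace Template

/-- A text without variables. -/
def ofCells (l : List Cell) : Template := l.map .inl

/-- The text obtained by replacing the variables. -/
def subst (T : Template) (f : ℕ → List Cell) : List Cell :=
  T.flatMap (Sum.elim (fun c => [c]) f)

@[simp] lemma subst_nil (f : ℕ → List Cell) : subst [] f = [] := rfl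

@[simp] lemma subst_inl (c : Cell) (T : Template) (f : ℕ → List Cell) :
    subst (.inl c :: T) f = c :: T.subst f := rfl

@[simp] lemma subst_inr (v : ℕ) (T : Template) (f : ℕ → List Cell) :
    subst (.inr v :: T) f = f v ++ T.subst f := rfl

@[simp] lemma subst_append (T U : Template) (f : ℕ → List Cell) :
    (T ++ U).subst f = T.subst f ++ U.subst f := by simp [subst]

lemma subst_flatMap {α : Type} (l : List α) (T : α → Template) (f : ℕ → List Cell) :
    subst (l.flatMap T) f = l.flatMap fun a => (T a).subst f := by
  simp [subst, List.flatMap_assoc]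

@[simp] lemma subst_ofCells (l : List Cell) (f : ℕ → List Cell) : (ofCells l).subst f = l := by
  simp [subst, ofCells, List.flatMap_map]

/-- The text in which the variables are represented by their names. -/
def render (T : Template) : List Cell := T.subst fun v => .var :: enc v ++ [.endNum]

end Template

open Template

/-- The text of a factor. -/
def factorText (f : ℕ × ℕ) : Template :=
  [.inl .fac, .inr f.1, .inl .endProfile] ++ ofCells (enc f.2 ++ [.endExp])

/-- The text of a term. -/
noncomputable def termText (t : ProfileTerm) : Template :=
  ofCells (.coef :: encNums t.coeff.psums ++ [.endProfile]) ++ t.factors.flatMap factorText ++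
    [.inl .endTerm]

/-- The text of an equation. -/
noncomputable def equationText (E : ProfileEquation) : Template :=
  E.lhs.flatMap termText ++ ofCells (.rhs :: encNums E.rhs.psums ++ [.endProfile])

/-- The text of a system of equations. -/
noncomputable def systemText (S : List ProfileEquation) : Template := S.flatMap equationText

namespace Prog

open Store Profile

/-- Parse a factor. -/
def parseFactor : Prog :=
  push .x .fac * (copyNum .var .endNum * copyNum .endProfile .endExp)

/-- Parse a term. -/
def parseTerm : Prog :=
  push .x .coef * (convert * (push .x .endProfile * loop parseFactor
    (pop .y .endTerm * push .x .endTerm)))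

/-- Parse an equation. -/
def parseEquation : Prog :=
  loop parseTerm (pop .y .endPoly * (push .x .rhs * (convert * push .x .endProfile)))

lemma parses_factor : Parses parseFactor
    (fun f => (codeNat f.1 ++ codeNat f.2).map EqSymbol.toCell) fun f => (factorText f).render :=
  ((Parses.push _).mul ((Parses.copyNum _ _ (by simp)).mul
    (Parses.copyNum _ _ (by simp)))).of_surjective (fun p => p.2) (fun f => ⟨((), f), rfl⟩)
    (fun f => by simp [map_codeNat]) (fun f => by simp [factorText, render])

lemma parses_term : Parses parseTerm
    (fun t => (codeTerm t).map EqSymbol.toCell) fun t => (termText t).render :=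
  ((Parses.push _).mul (Parses.convert.mul ((Parses.push _).mul (parses_factor.loop
    (fun f => by simp [map_codeNat]) ((Parses.pop _).mul (Parses.push _)))))).of_surjective
    (fun p => ⟨p.2.1, p.2.2.2.1⟩)
    (fun t => ⟨((), t.coeff, (), t.factors, (), ()), rfl⟩)
    (fun p => by simp [codeTerm, map_codeProfile, List.map_flatMap, EqSymbol.toCell])
    (fun p => by simp [termText, render, subst_flatMap])

lemma parses_equation : Parses parseEquation
    (fun E => (codeEquation E).map EqSymbol.toCell) fun E => (equationText E).render :=
  (parses_term.loop (fun t => by simp [codeTerm]) ((Parses.pop _).mul ((Parses.push _).mul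
    (Parses.convert.mul (Parses.push _))))).of_surjective
    (fun p => ⟨p.1, p.2.2.2.1⟩)
    (fun E => ⟨(E.lhs, (), (), E.rhs, ()), rfl⟩)
    (fun p => by simp [codeEquation, map_codeProfile, List.map_flatMap, EqSymbol.toCell])
    (fun p => by simp [equationText, render, subst_flatMap])

lemma parses_system : Parses parseEquation.star
    (fun S => (codeSystem S).map EqSymbol.toCell)
    fun S => (systemText S).render := by
  have hne : ∀ E, (codeEquation E).map EqSymbol.toCell ≠ [] := fun E => by simp [codeEquation]
  obtain ⟨K, hK⟩ := parses_equation.runs_star hne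
  refine Parses.of_surjective ⟨fun _ _ h => parses_equation.rel_star h, K, fun σ l rest =>
    (hK σ l rest).mono (Nat.mul_le_mul_left _ (Nat.pow_le_pow_left (by omega) 2))⟩ id
    Function.surjective_id (fun S => ?_) (fun S => ?_)
  · simp [codeSystem, List.map_flatMap]
  · simp [render, systemText, subst_flatMap]

end Prog

/-! ### Substitution of guessed profiles for the variables -/

namespace Template

@[simp] lemma render_nil : render [] = [] := rfl

@[simp] lemma render_inl (c : Cell) (T : Template) : render (.inl c :: T) = c :: T.render := rfl

@[simp] lemma render_inr (v : ℕ) (T : Template) :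
    render (.inr v :: T) = .var :: (enc v ++ .endNum :: T.render) := by simp [render]

@[simp] lemma render_append (T U : Template) : (T ++ U).render = T.render ++ U.render :=
  subst_append _ _ _

@[simp] lemma render_ofCells (l : List Cell) : (ofCells l).render = l := subst_ofCells _ _

/-- Replace the variable whose name is given by its binary digits. -/
def substOne (T : Template) (l : List Bool) (r : List Cell) : Template :=
  T.flatMap (Sum.elim (fun c => [.inl c]) fun u => if u.bits = l then ofCells r else [.inr u])

@[simp] lemma substOne_nil (l : List Bool) (r : List Cell) : substOne [] l r = [] := rfl

@[simp] lemma substOne_inl (c : Cell) (T : Template) (l : List Bool) (r : List Cell) :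
    substOne (.inl c :: T) l r = .inl c :: T.substOne l r := rfl

@[simp] lemma substOne_inr (u : ℕ) (T : Template) (l : List Bool) (r : List Cell) :
    substOne (.inr u :: T) l r = (if u.bits = l then ofCells r else [.inr u]) ++ T.substOne l r :=
  rfl

lemma subst_substOne (T : Template) (l : List Bool) (r : List Cell) (f : ℕ → List Cell) :
    (T.substOne l r).subst f = T.subst fun u => if u.bits = l then r else f u := by
  induction T with
  | nil => rfl
  | cons s T ih =>
    rcases s with c | u
    · simp [ih]
    · by_cases h : u.bits = l <;> simp [ih, h]

lemma mem_inl_substOne {T : Template} {l : List Bool} {r : List Cell} {c : Cell}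
    (h : .inl c ∈ T.substOne l r) : .inl c ∈ T ∨ c ∈ r := by
  simp only [substOne, List.mem_flatMap] at h
  obtain ⟨s | u, hs, h⟩ := h
  · simp only [Sum.elim_inl, List.mem_singleton] at h
    exact .inl (h ▸ hs)
  · simp only [Sum.elim_inr] at h
    split_ifs at h with hu
    · exact .inr (by simpa [ofCells] using h)
    · simp at h

lemma mem_inr_substOne {T : Template} {l : List Bool} {r : List Cell} {u : ℕ}
    (h : .inr u ∈ T.substOne l r) : .inr u ∈ T ∧ u.bits ≠ l := by
  simp only [substOne, List.mem_flatMap] at h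
  obtain ⟨s | u', hs, h⟩ := h
  · simp at h
  · simp only [Sum.elim_inr] at h
    split_ifs at h with hu
    · simp [ofCells] at h
    · simp only [List.mem_singleton, Sum.inr.injEq] at h
      exact h ▸ ⟨hs, hu⟩

lemma length_le_length_render (T : Template) : T.length ≤ T.render.length := by
  induction T with
  | nil => simp
  | cons s T ih => rcases s with c | u <;> simp <;> omega

lemma subst_congr {T : Template} {f g : ℕ → List Cell} (h : ∀ u, .inr u ∈ T → f u = g u) :
    T.subst f = T.subst g := by
  induction T with
  | nil => rfl
  | cons s T ih =>
    have ih := ih fun u hu => h u (by simp [hu])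
    rcases s with c | u
    · simp [ih]
    · simp [ih, h u (by simp)]

lemma var_mem_render {T : Template} {u : ℕ} (h : .inr u ∈ T) : Cell.var ∈ T.render := by
  simp only [render, subst, List.mem_flatMap]
  exact ⟨_, h, by simp⟩

end Template

open Template

/-- The store which contains only a text. -/
def Store.ofText (w : List Cell) : Store := ⟨w, [], [], [], [], [], [], [], [], [], [], [], [], []⟩

namespace Prog

open Store Profile

variable {σ τ ρ : Store} {n : ℕ}

/-- Compare a digit of the name of a variable with a digit of the given name. -/
def sameBit : Prog := alt bools fun b => pop .w (.bit b) * (pop .n (.bit b) * push .u (.bit b))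

/-- Check that the rests of two names begin differently. -/
def differ : Prog :=
  (alt bools fun b => pop .w (.bit b) * (pop .n (.bit !b) *
    (push .n (.bit !b) * push .w (.bit b)))) +
  (pop .w .endNum * ((alt bools fun b => pop .n (.bit b) * push .n (.bit b)) *
    push .w .endNum) +
  isEmpty .n * alt bools fun b => pop .w (.bit b) * push .w (.bit b))

/-- At the end of the given name, copy the value of the variable. -/
def replaceVar : Prog :=
  pop .w .endNum * (isEmpty .n * (move .u .n *
    (loop (moveTwo allCells .r .u .x) (isEmpty .r) * move .u .r)))

/-- Keep a variable whose name is different from the given name. -/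
def keepVar : Prog :=
  differ * (loop (moveTwo allCells .u .n .v) (isEmpty .u) * (push .x .var * (move .v .x *
    loop (moveOne bitCells .w .x) (pop .w .endNum * push .x .endNum))))

/-- Read the name of a variable, and replace the variable if it has the given name. -/
def substVar : Prog := loop sameBit (replaceVar + keepVar)

lemma det_replaceVar (σ : Store) (p : List Bool) (rest r x : List Cell) :
    Det replaceVar {σ with w := .endNum :: rest, x := x, n := [], r := r, u := cells p.reverse}
      {σ with w := rest, x := r.reverse ++ x, n := cells p, r := r, u := []}
      (2 * p.length + 5 * r.length + 5) := by
  refine ((det_pop (l := rest) rfl).mul ((det_isEmpty rfl).mul ((det_move (by decide) _).mul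
    ((det_moveTwo_loop (t := r) (rest := []) (by decide) (by decide) (by decide) (by simp)
    (by simp) (fun σ ρ h => by simp [((rel_isEmpty _).1 h).1]) (by simp [Store.get, Store.set])
    (det_isEmpty (by rfl))).mul (det_move (by decide) _))))).congr ?_ ?_
  · simp [Store.get, Store.set, cells_reverse]
  · simp [Store.get, Store.set]
    omega

/-- The test `differ` pushes back all that it pops, which is what the hypothesis says for the case
at hand. The common prefix, held in `u`, is needed twice: to restore the guessed name in `n`, and to
write the kept name to `x`. -/
lemma det_keepVar (σ : Store) (l l' p : List Bool) (rest x : List Cell)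
    (h : Det differ {σ with w := cells l ++ .endNum :: rest, x := x, n := cells l',
                            u := cells p.reverse, v := []}
      {σ with w := cells l ++ .endNum :: rest, x := x, n := cells l', u := cells p.reverse,
              v := []} 4) :
    Det keepVar {σ with w := cells l ++ .endNum :: rest, x := x, n := cells l',
                        u := cells p.reverse, v := []}
      {σ with w := rest, x := (.var :: cells (p ++ l) ++ [Cell.endNum]).reverse ++ x,
              n := cells (p ++ l'), u := [], v := []} (5 * p.length + 2 * l.length + 9) := by
  refine (h.mul ((det_moveTwo_loop (t := cells p.reverse) (rest := []) (by decide) (by decide)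
    (by decide) (by simp) (by simp) (fun σ ρ h => by simp [((rel_isEmpty _).1 h).1])
    (by simp [Store.get]) (det_isEmpty (by rfl))).mul ((det_push _ _).mul
    ((det_move (by decide) _).mul (det_moveOne_loop (t := cells l) (rest := .endNum :: rest)
    (by decide) (fun s hs => mem_bitCells_of_mem_cells hs) (by simp [bitCells])
    (fun σ ρ h => ?_) rfl ((det_pop (l := rest) rfl).mul (det_push _ _))))))).congr ?_ ?_
  · simp only [rel_mul, rel_pop] at h
    obtain ⟨_, ⟨r, hr, -⟩, -⟩ := h
    simp [hr, bitCells]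
  · simp [Store.get, Store.set, cells_append, cells_reverse]
  · simp [Store.get, Store.set]
    omega

lemma not_rel_sameBit (h : σ.w.head? = some .endNum ∨ σ.n = [] ∨
    ∃ b, σ.w.head? = some (.bit b) ∧ σ.n.head? = some (.bit !b)) : ¬ Rel sameBit σ ρ := by
  simp only [sameBit, rel_alt, rel_mul, rel_pop, mem_bools, true_and]
  rintro ⟨b, _, ⟨l, hl, rfl⟩, _, ⟨l', hl', rfl⟩, -⟩
  simp only [Store.get, Store.set] at hl hl'
  simp [hl, hl'] at h

/-- Here `p` is the prefix already found equal, and `l`, `l'` are the unread parts of the two names.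
In each case exactly one of `sameBit`, `replaceVar` and `keepVar` can be executed: equal next
digits, both names exhausted, or a difference. -/
lemma det_substVar (σ : Store) (l l' p : List Bool) (rest r x : List Cell) :
    Det substVar {σ with w := cells l ++ .endNum :: rest, x := x, n := cells l', r := r,
                         u := cells p.reverse, v := []}
      {σ with w := rest,
              x := (if l = l' then r else .var :: cells (p ++ l) ++ [.endNum]).reverse ++ x,
              n := cells (p ++ l'), r := r, u := [], v := []}
      (13 * l.length + 10 * p.length + 5 * r.length + 9) := by
  induction l generalizing l' p with
  | nil =>
    cases l' with
    | nil =>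
      refine (Det.loop_done (.left (det_replaceVar {σ with v := []} p rest r x) fun ρ => ?_)
        fun ρ => not_rel_sameBit (.inl rfl)).congr ?_ ?_
      · simp [keepVar, differ, Store.get, Store.set]
      · simp
      · simp; omega
    | cons b' l' =>
      refine (Det.loop_done (.right (det_keepVar {σ with r := r} [] (b' :: l') p rest x
        (.of_iff fun ρ => ?_)) fun ρ => ?_) fun ρ => not_rel_sameBit (.inl rfl)).congr ?_ ?_
      · cases b' <;> simp [differ, Store.get, Store.set, bools]
      · simp [replaceVar, Store.get, Store.set]
      · simp
      · simp; omega
  | cons b l ih =>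
    cases l' with
    | nil =>
      refine (Det.loop_done (.right (det_keepVar {σ with r := r} (b :: l) [] p rest x
        (.of_iff fun ρ => ?_)) fun ρ => ?_) fun ρ => not_rel_sameBit (.inr (.inl rfl))).congr ?_ ?_
      · cases b <;> simp [differ, Store.get, Store.set, bools]
      · simp [replaceVar, Store.get, Store.set]
      · simp
      · simp; omega
    | cons b' l' =>
      rcases eq_or_ne b b' with rfl | hb
      · have h1 : Det sameBit {σ with w := cells (b :: l) ++ .endNum :: rest, x := x,
                                      n := cells (b :: l'), r := r, u := cells p.reverse, v := []}
            {σ with w := cells l ++ .endNum :: rest, x := x, n := cells l', r := r,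
                    u := cells (p ++ [b]).reverse, v := []} 3 := by
          refine .of_iff fun ρ => ?_
          cases b <;> simp [sameBit, Store.get, Store.set, bools]
        refine (h1.loop_step (ih l' (p ++ [b])) fun ρ => ?_).congr ?_ ?_
        · cases b <;> simp [keepVar, replaceVar, differ, Store.get, Store.set, bools]
        · simp
        · simp only [List.length_cons, List.length_append, List.length_nil]
          omega
      · obtain rfl : b' = !b := by cases b <;> cases b' <;> simp_all
        refine (Det.loop_done (.right (det_keepVar {σ with r := r} (b :: l) ((!b) :: l') p rest x
          (.of_iff fun ρ => ?_)) fun ρ => ?_)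
          fun ρ => not_rel_sameBit (.inr (.inr ⟨b, rfl, rfl⟩))).congr ?_ ?_
        · cases b <;> simp [differ, Store.get, Store.set, bools]
        · simp [replaceVar, Store.get, Store.set]
        · simp
        · simp; omega

/-- The symbols which do not represent a variable. -/
def otherCells : List Cell :=
  [.bit false, .bit true, .endNum, .endProfile, .endTerm, .endPoly, .coef, .fac, .endExp, .rhs,
    .claim]

@[simp] lemma mem_otherCells (s : Cell) : s ∈ otherCells ↔ s ≠ .var := by
  rcases s with (_ | _) | _ | _ | _ | _ | _ | _ | _ | _ | _ | _ <;> decide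

/-- Copy the text from `w` to `x`, and replace a variable. -/
def substPass : Prog := loop (moveOne otherCells .w .x + pop .w .var * substVar) (isEmpty .w)

lemma det_substPass (σ : Store) (T : Template) (hT : .inl .var ∉ T) (l : List Bool)
    (r x : List Cell) {D : ℕ} (hD : ∀ v, .inr v ∈ T → v.size ≤ D) (hr : r.length ≤ D) :
    Det substPass {σ with w := T.render, x := x, n := cells l, r := r, u := [], v := []}
      {σ with w := [], x := (T.substOne l r).render.reverse ++ x, n := cells l, r := r, u := [],
              v := []} (T.length * (18 * D + 10) + 1) := by
  induction T generalizing x with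
  | nil =>
    refine ((det_isEmpty rfl).loop_done fun ρ => ?_).congr ?_ ?_
    · simp [moveOne, render, Store.get]
    · simp [render]
    · simp
  | cons s T ih =>
    have ih := fun x => ih (fun h => hT (by simp [h])) x fun v hv => hD v (by simp [hv])
    rcases s with c | u
    · have hc : c ≠ .var := fun h => hT (by simp [h])
      refine (((Det.left (Det.alt ((mem_otherCells c).2 hc) ((det_pop (l := render T) rfl).mul
        (det_push _ _)) fun j hj ρ => not_rel_pop_mul ?_) fun ρ => not_rel_pop_mul ?_)).loop_step
        (ih (c :: x)) fun ρ => ?_).congr ?_ ?_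
      · simp [Store.get, hj.symm]
      · simp [Store.get, hc]
      · simp [Store.get]
      · simp
      · rw [List.length_cons, add_mul]
        omega
    · have hu := hD u (by simp)
      refine ((Det.right ((det_pop (l := enc u ++ .endNum :: render T) (by simp [Store.get])).mul
        (det_substVar {σ with y := σ.y} u.bits l [] (render T) r x))
        fun ρ => ?_).loop_step (ih _) fun ρ => ?_).congr ?_ ?_
      · simp only [moveOne, rel_alt, not_exists, not_and]
        intro s hs
        refine not_rel_pop_mul ?_
        simpa [Store.get, eq_comm] using hs
      · simp [Store.get]
      · by_cases h : u.bits = l <;> simp [h, enc]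
      · simp only [List.length_cons, add_mul, Nat.size_eq_bits_len, List.length_nil]
        omega

/-- Push guessed symbols on a stack. -/
def guess (l : List Cell) (k : Reg) : Prog := RegularExpression.star (alt l fun s => push k s)

lemma rel_guess {l : List Cell} {k : Reg} (h : Rel (guess l k) σ τ) :
    ∃ t, (∀ s ∈ t, s ∈ l) ∧ τ = σ.set k (t ++ σ.get k) := by
  refine h.star_induction (fun σ => ∃ t, (∀ s ∈ t, s ∈ l) ∧ τ = σ.set k (t ++ σ.get k)) ?_ ?_
  · exact ⟨[], by simp⟩
  · rintro ρ ρ' h' - ⟨t, ht, rfl⟩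
    simp only [rel_alt, rel_push] at h'
    obtain ⟨s, hs, rfl⟩ := h'
    refine ⟨t ++ [s], ?_, by simp⟩
    intro s' hs'
    rcases List.mem_append.1 hs' with h | h
    · exact ht s' h
    · simpa [List.mem_singleton.1 h] using hs

lemma runs_guess {l : List Cell} {k : Reg} (t : List Cell) (ht : ∀ s ∈ t, s ∈ l) :
    Runs (guess l k) σ (σ.set k (t.reverse ++ σ.get k)) t.length := by
  induction t generalizing σ with
  | nil => simpa [guess] using Runs.star_nil
  | cons s t ih =>
    have h1 : Runs (alt l fun s => push k s) σ (σ.set k (s :: σ.get k)) 1 :=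
      Runs.alt (ht s (by simp)) (det_push k s).1
    simpa [guess] using (h1.star_cons (ih fun s hs => ht s (by simp [hs]))).mono
      (n := (s :: t).length) (by simp; omega)

/-- Replace a guessed variable by a guessed profile. -/
def substitute : Prog :=
  guess bitCells .n * (guess allCells .y * (convert * (isEmpty .y * (move .x .r *
    (substPass * (move .x .w * (clear .n * clear .r)))))))

/-- Apart from the guesses and their conversion, `substitute` is deterministic, so this one
statement serves both for soundness and for completeness. -/
lemma det_substitute_tail (T : Template) (hT : .inl .var ∉ T) (l : List Bool) (r : List Cell)
    {M : ℕ} (hD : ∀ v, .inr v ∈ T → v.size ≤ M) (hr : r.length ≤ M) (hl : l.length ≤ M)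
    (h1 : T.length ≤ M) (h2 : (T.substOne l r).render.length ≤ M) :
    Det (isEmpty .y * (move .x .r * (substPass * (move .x .w * (clear .n * clear .r)))))
      {ofText T.render with n := cells l, x := r.reverse} (ofText (T.substOne l r).render)
      (M * (18 * M + 16) + 6) := by
  refine ((det_isEmpty rfl).mul ((det_move (by decide) _).mul
    (((det_substPass (ofText []) T hT l r [] hD hr).of_eq ?_ rfl).mul
    ((det_move (by decide) _).mul ((det_clear _ _).mul (det_clear _ _)))))).congr ?_ ?_
  · simp [Store.get, Store.set, ofText]
  · simp [Store.get, Store.set, ofText]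
  · have : T.length * (18 * M + 10) ≤ M * (18 * M + 10) := Nat.mul_le_mul_right _ h1
    simp only [Store.get, Store.set, ofText, List.length_reverse, List.append_nil, length_cells]
    nlinarith

lemma psums_ne_var (p : Profile) : Cell.var ∉ encNums p.psums := by
  simp [encNums, enc, cells]

/-- The guessed name need not be canonical, nor occur in the text. The pass then leaves the text as
it is, which does no harm to soundness. -/
lemma rel_substitute (T : Template) (hT : .inl .var ∉ T)
    (h : Rel substitute (ofText T.render) τ) :
    ∃ (l : List Bool) (p : Profile), τ = ofText (T.substOne l (encNums p.psums)).render := by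
  obtain ⟨_, h1, h⟩ := rel_mul.1 h
  obtain ⟨t, ht, rfl⟩ := rel_guess h1
  obtain ⟨l, rfl⟩ := exists_cells_eq ht
  obtain ⟨_, h2, h⟩ := rel_mul.1 h
  obtain ⟨t', -, rfl⟩ := rel_guess h2
  obtain ⟨_, h3, h⟩ := rel_mul.1 h
  obtain ⟨p, rest, -, rfl⟩ := rel_convert
    (((ofText T.render).set .n (cells l)).set .y t') (by
      simpa [Store.get, Store.set, ofText, clean] using h3)
  obtain rfl : rest = [] := by
    obtain ⟨_, h4, -⟩ := rel_mul.1 h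
    exact ((rel_isEmpty _).1 h4).1
  refine ⟨l, p, ?_⟩
  set r := encNums p.psums
  -- Only the uniqueness of the outcome is used below, so any sufficiently large bound will do.
  let M := (T.map (Sum.elim (fun _ => 0) Nat.size)).sum + r.length + l.length + T.length +
    (T.substOne l r).render.length
  have hD : ∀ v, .inr v ∈ T → v.size ≤ M := fun v hv => by
    have := List.single_le_sum (by simp) _ (List.mem_map_of_mem (f := Sum.elim (fun _ => 0) Nat.size) hv)
    simp only [Sum.elim_inr] at this
    omega
  refine (det_substitute_tail T hT l r (M := M) hD (by omega) (by omega) (by omega)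
    (by omega)).2 _ ?_
  simpa [Store.get, Store.set, ofText, clean] using h

lemma runs_substitute (T : Template) (hT : .inl .var ∉ T) (v : ℕ) (p : Profile)
    {M : ℕ} (hD : ∀ v, .inr v ∈ T → v.size ≤ M) (hr : (encNums p.psums).length ≤ M)
    (hp : (encNums p.entries).length ≤ M) (hl : v.size ≤ M)
    (h1 : T.length ≤ M) (h2 : (T.substOne v.bits (encNums p.psums)).render.length ≤ M) :
    Runs substitute (ofText T.render) (ofText (T.substOne v.bits (encNums p.psums)).render)
      (50 * (M + 1) ^ 2) := by
  have e := runs_convert ((ofText T.render).set .n (enc v)) p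
    ((size_sum_le _).trans hp) []
  have hlen := (length_le_encNums p.entries).trans hp
  have hmul : p.entries.length * (28 * M + 15) ≤ M * (28 * M + 15) := Nat.mul_le_mul_right _ hlen
  have h := (runs_guess (σ := ofText T.render) (k := .n) (enc v).reverse (l := bitCells)
    fun s hs => mem_bitCells_of_mem_cells (List.mem_reverse.1 hs)).mul
    ((runs_guess (k := .y) (encNums p.entries ++ [Cell.endProfile]).reverse (l := allCells)
      (by simp)).mul (Runs.mul (P := convert)
      (m := p.entries.length * (28 * M + 15) + M + 3) ?_
        (det_substitute_tail T hT v.bits (encNums p.psums) hD hr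
          (by rwa [Nat.size_eq_bits_len]) h1 h2).1))
  · refine h.mono ?_
    simp
    nlinarith
  · simpa [Store.get, Store.set, ofText, clean, enc] using e

/-- Replace variables by guessed profiles until none is left. -/
def substituteAll : Prog :=
  substitute.star * (loop (moveOne otherCells .w .x) (isEmpty .w) * move .x .w)

/-- The transfer after the substitutions does not move the symbol `var`, but ends only on an empty
stack; it succeeds only if no variable is left. The values are then read off from the successive
guesses. -/
lemma rel_substituteAll (T : Template) (hT : .inl .var ∉ T)
    (h : Rel substituteAll (ofText T.render) τ) :
    ∃ r : ℕ → Profile, τ = ofText (T.subst fun v => encNums (r v).psums) := by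
  obtain ⟨ρ, h1, h2⟩ := rel_mul.1 h
  refine h1.star_induction (fun σ' => ∀ T : Template, .inl .var ∉ T → σ' = ofText T.render →
    ∃ r : ℕ → Profile, τ = ofText (T.subst fun v => encNums (r v).psums)) ?_ ?_ _ hT rfl
  · rintro T hT rfl
    obtain ⟨_, h3, h4⟩ := rel_mul.1 h2
    obtain ⟨t, rest, ht, hw, h3⟩ := h3.moveOne_loop (by decide)
    obtain ⟨h5, rfl⟩ := (rel_isEmpty _).1 h3
    simp only [Store.get, Store.set] at h5
    subst h5
    simp only [Store.get, ofText, List.append_nil] at hw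
    have hvar : ∀ u, .inr u ∉ T := fun u hu => by
      have := ht _ (hw ▸ var_mem_render hu)
      simp at this
    -- No variable occurs any more, so the assignment is arbitrary.
    refine ⟨0, ((det_move (by decide) _).2 _ h4).trans ?_⟩
    rw [subst_congr (g := fun v => .var :: enc v ++ [.endNum]) fun u hu => absurd hu (hvar u)]
    change _ = ofText T.render
    simp [Store.get, Store.set, ofText, hw]
  · rintro ρ₁ ρ₂ h - ih T hT rfl
    obtain ⟨l, p, rfl⟩ := rel_substitute T hT h
    obtain ⟨r, hr⟩ := ih _ (fun h => (mem_inl_substOne h).elim hT (psums_ne_var p)) rfl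
    -- The earlier replacement takes precedence: the later ones no longer see the variables it has
    -- removed.
    refine ⟨fun u => if u.bits = l then p else r u, hr.trans ?_⟩
    rw [subst_substOne]
    congr 2
    funext u
    by_cases hu : u.bits = l <;> simp [hu]

/-- In an intermediate text every variable is represented either by its name or by its value. The
hypothesis `h2` bounds all such mixtures together, and hence every stage of the substitution. -/
lemma runs_star_substitute (r : ℕ → Profile) {M : ℕ} (vs : List ℕ) (T : Template)
    (hT : .inl .var ∉ T) (hvs : ∀ v, .inr v ∈ T → v ∈ vs) 
    (h1 : ∀ v ∈ vs, v.size ≤ M ∧ (encNums (r v).psums).length ≤ M ∧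
      (encNums (r v).entries).length ≤ M)
    (h2 : ∀ g : ℕ → List Cell, (∀ v, g v = .var :: enc v ++ [.endNum] ∨
      g v = encNums (r v).psums) → (T.subst g).length ≤ M) :
    Runs substitute.star (ofText T.render) (ofText (T.subst fun v => encNums (r v).psums))
      (vs.length * (50 * (M + 1) ^ 2)) := by
  induction vs generalizing T with
  | nil =>
    rw [subst_congr (g := fun v => .var :: enc v ++ [.endNum])
      fun u hu => by simpa using hvs u hu]
    exact Runs.star_nil.mono (by simp)
  | cons v vs ih =>
    have h3 : ∀ g : ℕ → List Cell, (∀ v, g v = .var :: enc v ++ [.endNum] ∨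
        g v = encNums (r v).psums) →
        ((T.substOne v.bits (encNums (r v).psums)).subst g).length ≤ M := by
      intro g hg
      rw [subst_substOne]
      refine h2 _ fun u => ?_
      split_ifs with hu
      · right
        rw [← bval_bits u, hu, bval_bits]
      · exact hg u
    obtain ⟨hv1, hv2, hv3⟩ := h1 v (by simp)
    have h4 := runs_substitute T hT v (r v) (M := M) (fun u hu => (h1 u (hvs u hu)).1) hv2 hv3 hv1
      ((length_le_length_render T).trans (h2 _ fun v => .inl rfl)) (h3 _ fun v => .inl rfl)
    have h5 := ih (T.substOne v.bits (encNums (r v).psums))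
      (fun h => (mem_inl_substOne h).elim hT (psums_ne_var _))
      (fun u hu => by
        obtain ⟨hu1, hu2⟩ := mem_inr_substOne hu
        exact (List.mem_cons.1 (hvs u hu1)).resolve_left fun h => hu2 (by rw [h]))
      (fun u hu => h1 u (by simp [hu])) h3
    have e : (T.substOne v.bits (encNums (r v).psums)).subst (fun v => encNums (r v).psums) =
        T.subst fun v => encNums (r v).psums := by
      rw [subst_substOne]
      congr 1
      funext u
      split_ifs with hu
      · rw [← bval_bits u, hu, bval_bits]
      · rfl
    rw [e] at h5
    exact (h4.star_cons h5).mono (by rw [List.length_cons]; ring_nf; omega)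

lemma runs_substituteAll (r : ℕ → Profile) {M : ℕ} (T : Template) (hT : .inl .var ∉ T)
    (h1 : ∀ v, .inr v ∈ T → v.size ≤ M ∧ (encNums (r v).psums).length ≤ M ∧
      (encNums (r v).entries).length ≤ M)
    (h2 : ∀ g : ℕ → List Cell, (∀ v, g v = .var :: enc v ++ [.endNum] ∨
      g v = encNums (r v).psums) → (T.subst g).length ≤ M) :
    Runs substituteAll (ofText T.render) (ofText (T.subst fun v => encNums (r v).psums))
      (55 * (M + 1) ^ 3) := by
  have hvs : (T.filterMap Sum.getRight?).length ≤ M :=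
    (List.length_filterMap_le _ _).trans
      ((length_le_length_render T).trans (h2 _ fun v => .inl rfl))
  have h3 := runs_star_substitute r (M := M) (T.filterMap Sum.getRight?) T hT
    (fun v hv => List.mem_filterMap.2 ⟨_, hv, rfl⟩)
    (fun v hv => by
      obtain ⟨s | u, hs, hu⟩ := List.mem_filterMap.1 hv
      · simp at hu
      · obtain rfl : u = v := by simpa using hu
        exact h1 u hs) h2
  have hM := h2 (fun v => encNums (r v).psums) fun v => .inr rfl
  set w := T.subst fun v => encNums (r v).psums with hw
  have hvar : Cell.var ∉ w := by
    simp only [hw, subst, List.mem_flatMap]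
    rintro ⟨s | u, hs, h⟩
    · obtain rfl : Cell.var = s := by simpa using h
      exact hT hs
    · exact psums_ne_var _ h
  have h4 := (runs_moveOne_loop (l := otherCells) (i := .w) (j := .x) (σ := ofText w) (t := w)
    (rest := []) (by decide) (fun s hs => (mem_otherCells s).2 fun h => hvar (h ▸ hs))
    (by simp [ofText, Store.get]) (det_isEmpty (k := .w) rfl).1).mul (det_move (i := .x) (j := .w)
      (by decide) _).1
  have h5 := h3.mul h4
  have h6 := h5.mono (n := 55 * (M + 1) ^ 3) (by
    have : (T.filterMap Sum.getRight?).length * (50 * (M + 1) ^ 2) ≤ M * (50 * (M + 1) ^ 2) :=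
      Nat.mul_le_mul_right _ hvs
    simp [Store.get, Store.set, ofText]
    nlinarith [Nat.zero_le (M ^ 2), Nat.zero_le (M ^ 3)])
  simpa [Store.get, Store.set, ofText, substituteAll] using h6

end Prog

/-! ### Verification of the equations between partial sums -/

/-- Drop the first number of a list, unless it is the only one. -/
def shift : List ℕ → List ℕ
  | _ :: m :: l => m :: l
  | l => l

/-- The first number of a list. -/
def firstNum (l : List ℕ) : ℕ := l.headD 0

@[simp] lemma firstNum_cons (n : ℕ) (l : List ℕ) : firstNum (n :: l) = n := rfl

section Texts

variable (V : Profile → List ℕ) (r : ℕ → Profile)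

/-- The text of a factor, where every profile `p` is given by the list `V p` of numbers. -/
def factorCells (f : ℕ × ℕ) : List Cell :=
  .fac :: (encNums (V (r f.1)) ++ .endProfile :: (enc f.2 ++ [.endExp]))

/-- The text of a term. -/
def termCells (t : ProfileTerm) : List Cell :=
  .coef :: (encNums (V t.coeff) ++ .endProfile :: (t.factors.flatMap (factorCells V r) ++
    [.endTerm]))

/-- The text of an equation. -/
def equationCells (E : ProfileEquation) : List Cell :=
  E.lhs.flatMap (termCells V r) ++ .rhs :: (encNums (V E.rhs) ++ [.endProfile])

/-- The value of a factor, where every profile is represented by the first number of its list. -/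
def factorValue (f : ℕ × ℕ) : ℕ := firstNum (V (r f.1)) ^ f.2

/-- The value of a term. -/
def termValue (t : ProfileTerm) : ℕ :=
  firstNum (V t.coeff) * (t.factors.map (factorValue V r)).prod

/-- The value of the left-hand side of an equation. -/
def lhsValue (E : ProfileEquation) : ℕ := (E.lhs.map (termValue V r)).sum

end Texts

namespace Prog

open Store

variable {σ τ ρ : Store} {n : ℕ} {P Q : Prog}

/-- If `P` reads an item of a list from `w`, then a loop of `P` reads some items of the list. -/
lemma rel_loop_list {α β : Type} {St : β → List Cell → List Cell → Store}
    {text out : α → List Cell} {ok : α → Prop} {act : β → α → β} {rest₀ : List Cell}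
    (hP : ∀ i acc rest x τ, Rel P (St acc (text i ++ rest) x) τ →
      ok i ∧ τ = St (act acc i) rest ((out i).reverse ++ x))
    (hP₀ : ∀ acc x τ, ¬ Rel P (St acc rest₀ x) τ) (l : List α) (acc : β) (x : List Cell)
    (h : Rel (loop P Q) (St acc (l.flatMap text ++ rest₀) x) τ) :
    ∃ l₁ l₂, l = l₁ ++ l₂ ∧ (∀ i ∈ l₁, ok i) ∧
      Rel Q (St (l₁.foldl act acc) (l₂.flatMap text ++ rest₀)
        ((l₁.flatMap out).reverse ++ x)) τ := by
  induction l generalizing acc x with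
  | nil =>
    rcases rel_loop.1 h with h | ⟨ρ, h, -⟩
    · exact ⟨[], [], rfl, by simp, h⟩
    · exact absurd h (hP₀ _ _ _)
  | cons i l ih =>
    rcases rel_loop.1 h with h | ⟨ρ, h1, h2⟩
    · exact ⟨[], i :: l, rfl, by simp, h⟩
    · rw [List.flatMap_cons, List.append_assoc] at h1
      obtain ⟨hi, rfl⟩ := hP _ _ _ _ _ h1
      obtain ⟨l₁, l₂, rfl, hl, h⟩ := ih _ _ h2
      exact ⟨i :: l₁, l₂, rfl, by simpa using ⟨hi, hl⟩, by simpa using h⟩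

/-- The predicate `good` relates the accumulator to the items still to be read. It is the invariant
that carries the size bounds into each iteration. -/
lemma runs_loop_list {α β : Type} {St : β → List Cell → List Cell → Store}
    {text out : α → List Cell} {act : β → α → β} {rest₀ : List Cell} {c : ℕ}
    {good : β → List α → Prop}
    (hP : ∀ i l acc rest x, good acc (i :: l) → good (act acc i) l ∧
      Runs P (St acc (text i ++ rest) x) (St (act acc i) rest ((out i).reverse ++ x)) c)
    (l : List α) (acc : β) (x : List Cell) (hl : good acc l)
    (h : good (l.foldl act acc) [] →
      Runs Q (St (l.foldl act acc) rest₀ ((l.flatMap out).reverse ++ x)) τ n) :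
    Runs (loop P Q) (St acc (l.flatMap text ++ rest₀) x) τ (l.length * c + n) := by
  induction l generalizing acc x with
  | nil => exact (h hl).loop_done.mono (by simp)
  | cons i l ih =>
    obtain ⟨h1, h2⟩ := hP i l acc (l.flatMap text ++ rest₀) x hl
    have h3 := h2.loop_step (ih _ ((out i).reverse ++ x) h1 fun h4 => by
      simpa using h (by simpa using h4))
    rw [List.flatMap_cons, List.append_assoc]
    exact h3.mono (by rw [List.length_cons]; ring_nf; omega)

/-! #### Reading the first number of a list -/

/-- The symbols of a list of numbers. -/
def numCells : List Cell := [.bit false, .bit true, .endNum]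

lemma mem_numCells_of_mem_encNums {l : List ℕ} {s : Cell} (h : s ∈ encNums l) : s ∈ numCells := by
  simp only [encNums, List.mem_flatMap, List.mem_append, List.mem_singleton] at h
  obtain ⟨n, -, h | rfl⟩ := h
  · obtain ⟨b, -, rfl⟩ := List.mem_map.1 h
    cases b <;> decide
  · decide

/-- The number which has been read is the only one: copy it. -/
def keepHead : Prog :=
  pop .w .endProfile * (loop (moveTwo allCells .u .b .v) (isEmpty .u) *
    (move .v .x * (push .x .endNum * push .x .endProfile)))

/-- The number which has been read is not the only one: copy the others. -/
def dropHead : Prog :=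
  moveOne numCells .w .x * (loop (moveOne numCells .w .x)
    (pop .w .endProfile * push .x .endProfile) * move .u .b)

/-- Read the first number of a list into `b`, and copy the list without it, unless the number is the
only one. If `last` is true, then the number is required to be the only one. -/
def head (last : Bool) : Prog :=
  loop (moveOne bitCells .w .u) (pop .w .endNum) * (keepHead + if last then 0 else dropHead)

lemma det_head_prefix (σ : Store) (n : ℕ) (rest : List Cell) :
    Det (loop (moveOne bitCells .w .u) (pop .w .endNum))
      {σ with w := enc n ++ .endNum :: rest, b := [], u := [], v := []}
      {σ with w := rest, b := [], u := (enc n).reverse, v := []} (2 * n.size + 1) := by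
  refine (det_moveOne_loop (t := enc n) (rest := .endNum :: rest) (by decide)
    (fun s hs => mem_bitCells_of_mem_cells hs) (by simp [bitCells])
    (fun σ ρ h => ?_) rfl (det_pop (l := rest) rfl)).congr ?_ ?_
  · obtain ⟨r, hr, -⟩ := (rel_pop _ _).1 h
    simp [hr, bitCells]
  · simp [Store.get, Store.set]
  · simp

lemma det_keepHead (σ : Store) (n : ℕ) (rest x : List Cell) :
    Det keepHead {σ with w := .endProfile :: rest, x := x, b := [], u := (enc n).reverse, v := []}
      {σ with w := rest, x := (encNums [n] ++ [Cell.endProfile]).reverse ++ x, b := enc n, u := [],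
              v := []} (5 * n.size + 5) := by
  refine ((det_pop (l := rest) rfl).mul ((det_moveTwo_loop (t := (enc n).reverse) (rest := [])
    (by decide) (by decide) (by decide) (by simp) (by simp)
    (fun σ ρ h => by simp [((rel_isEmpty _).1 h).1]) (by simp [Store.get, Store.set])
    (det_isEmpty (by rfl))).mul ((det_move (by decide) _).mul ((det_push _ _).mul
    (det_push _ _))))).congr ?_ ?_
  · simp [Store.get, Store.set]
  · simp [Store.get, Store.set]
    omega

lemma det_dropHead (σ : Store) (n m : ℕ) (l : List ℕ) (rest x : List Cell) :
    Det dropHead {σ with w := encNums (m :: l) ++ .endProfile :: rest, x := x, b := [],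
                         u := (enc n).reverse}
      {σ with w := rest, x := (encNums (m :: l) ++ [Cell.endProfile]).reverse ++ x, b := enc n,
              u := []} (2 * (encNums (m :: l)).length + 2 * n.size + 3) := by
  obtain ⟨s, t, ht⟩ : ∃ s t, encNums (m :: l) = s :: t :=
    List.exists_cons_of_ne_nil (by simp)
  have hmem : ∀ c ∈ s :: t, c ∈ numCells := fun c hc => mem_numCells_of_mem_encNums (ht ▸ hc)
  rw [ht]
  refine (Det.mul (m := 2) (Det.alt (hmem s (by simp)) ((det_pop rfl).mul (det_push _ _))
    fun j hj ρ => not_rel_pop_mul (by simp [Store.get, hj.symm])) (Det.mul (det_moveOne_loop (t := t)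
      (rest := .endProfile :: rest) (by decide) (fun c hc => hmem c (by simp [hc]))
      (by simp [numCells]) (fun σ ρ h => ?_) (by simp [Store.get, Store.set])
      ((det_pop (l := rest) (by simp [Store.get, Store.set])).mul (det_push _ _)))
      (det_move (by decide) _))).congr ?_ ?_
  · simp only [rel_mul, rel_pop] at h
    obtain ⟨_, ⟨r, hr, -⟩, -⟩ := h
    simp [hr, numCells]
  · simp [Store.get, Store.set]
  · simp [Store.get, Store.set]
    omega

/-- After the first number, `keepHead` needs the end marker and `dropHead` a further symbol of the
list, so the choice is forced. With `last` set, only `keepHead` remains, which checks that the list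
is a singleton. -/
lemma rel_head (last : Bool) (σ : Store) (l : List ℕ) (hl : l ≠ []) (rest x : List Cell)
    (h : Rel (head last) {σ with w := encNums l ++ .endProfile :: rest, x := x, b := [], u := [],
                                 v := []} τ) :
    (last → l.length = 1) ∧ τ = {σ with
      w := rest, x := (encNums (shift l) ++ [Cell.endProfile]).reverse ++ x,
      b := enc (firstNum l), u := [], v := []} := by
  obtain ⟨ρ, h1, h2⟩ := rel_mul.1 h
  cases l with
  | nil => exact absurd rfl hl
  | cons n l =>
    rw [encNums_cons, List.append_assoc, List.cons_append] at h1
    obtain rfl := (det_head_prefix {σ with x := x} n (encNums l ++ .endProfile :: rest)).2 _ h1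
    cases l with
    | nil =>
      refine ⟨fun _ => rfl, ?_⟩
      rcases rel_add.1 h2 with h2 | h2
      · exact (det_keepHead σ n rest x).2 _ h2
      · cases last with
        | true => simp at h2
        | false =>
          simp [dropHead, moveOne, numCells, Store.get] at h2
    | cons m l =>
      rcases rel_add.1 h2 with h2 | h2
      · refine absurd h2 (not_rel_pop_mul ?_)
        have : ∀ s ∈ encNums (m :: l), s ≠ .endProfile := fun s hs h => by
          have := mem_numCells_of_mem_encNums hs
          simp [h, numCells] at this
        cases he : encNums (m :: l) with
        | nil => simp at he
        | cons s t => simpa [Store.get] using this s (by simp [he])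
      · cases last with
        | true => simp at h2
        | false => exact ⟨by simp, (det_dropHead {σ with v := []} n m l rest x).2 _ h2⟩

lemma runs_head (last : Bool) (σ : Store) (l : List ℕ) (hl : l ≠ []) (rest x : List Cell)
    (h : last → l.length = 1) :
    Runs (head last) {σ with w := encNums l ++ .endProfile :: rest, x := x, b := [], u := [],
                             v := []}
      {σ with w := rest, x := (encNums (shift l) ++ [Cell.endProfile]).reverse ++ x,
              b := enc (firstNum l), u := [], v := []} (7 * (encNums l).length + 6) := by
  cases l with
  | nil => exact absurd rfl hl
  | cons n l =>
    rw [encNums_cons, List.append_assoc, List.cons_append]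
    have h1 := (det_head_prefix {σ with x := x} n (encNums l ++ .endProfile :: rest)).1
    cases l with
    | nil =>
      exact (h1.mul (det_keepHead σ n rest x).1.left).mono (by simp; omega)
    | cons m l =>
      cases last with
      | true => simp at h
      | false =>
        exact (h1.mul (det_dropHead {σ with v := []} n m l rest x).1.right).mono
          (by simp; omega)

end Prog

namespace Prog

open Store

variable {σ τ ρ : Store} {n : ℕ} {P Q : Prog}

/-! #### Factors -/

/-- The store during the verification: the value of a term in `a`, and the value of a sum in `s`. -/
def work (a s : ℕ) (w x : List Cell) : Store := {ofText w with x := x, a := enc a, s := enc s}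

lemma work_zero (w : List Cell) : work 0 0 w [] = ofText w := by simp [work, ofText, enc]

lemma not_rel_pop_mul_work {c c' : Cell} {a s : ℕ} {w x : List Cell} (h : c ≠ c') :
    ¬ Rel (pop .w c * P) (work a s (c' :: w) x) τ :=
  not_rel_pop_mul (by simpa [Store.get, work, ofText, eq_comm] using h)

/-- Multiply by a factor. -/
def powFactor (last : Bool) : Prog := pop .w .fac * (push .x .fac * (head last * pow))

/-- Copy an exponent. If `z` is true, then the exponent is required to be positive. -/
def copyExp (z : Bool) : Prog :=
  (if z then moveOne bitCells .w .x else 1) *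
    loop (moveOne bitCells .w .x) (pop .w .endExp * push .x .endExp)

/-- Copy a factor. If `z` is true, then the factor is required to be null. -/
def skipFactor (z last : Bool) : Prog :=
  pop .w .fac * (push .x .fac * (head last * ((if z then isEmpty .b else clear .b) * copyExp z)))

section

variable {V : Profile → List ℕ} {r : ℕ → Profile} {last : Bool}

lemma rel_powFactor (hV : ∀ p, V p ≠ []) (f : ℕ × ℕ) (a s : ℕ) (rest x : List Cell)
    (h : Rel (powFactor last) (work a s (factorCells V r f ++ rest) x) τ) :
    (last → (V (r f.1)).length = 1) ∧ τ = work (a * factorValue V r f) s rest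
      ((factorCells (fun p => shift (V p)) r f).reverse ++ x) := by
  obtain ⟨_, h1, h⟩ := rel_mul.1 h
  obtain rfl := (det_pop (l := encNums (V (r f.1)) ++ .endProfile :: (enc f.2 ++ .endExp :: rest))
    (by simp [work, ofText, Store.get, factorCells])).2 _ h1
  obtain ⟨_, h1, h⟩ := rel_mul.1 h
  obtain rfl := (det_push _ _).2 _ h1
  obtain ⟨_, h1, h⟩ := rel_mul.1 h
  obtain ⟨hl, rfl⟩ := rel_head last (work a s [] []) _ (hV _) _ _ h1
  refine ⟨hl, ?_⟩
  -- No bound is available for soundness, where only uniqueness matters; `L` is chosen as a sum that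
  -- meets the three requirements.
  rw [(det_pow (L := a.size + (a * firstNum (V (r f.1)) ^ f.2).size +
    (firstNum (V (r f.1)) ^ 2 ^ f.2.bits.length).size) (work a s [] [])
    (a := a) (b := firstNum (V (r f.1))) (l := f.2.bits) (by omega) (by rw [bval_bits]; omega) (by omega)).2 _ h]
  simp [work, ofText, factorCells, factorValue, Store.get, enc, Store.set]

/-- For `e > 0` one has `2 ^ e.size ≤ 2 * e`, so the last square computed is at most `(b ^ e) ^ 2 ≤
q * q`. For `e = 0` no squaring takes place and the bound for `b` itself applies; a base below 2
does not grow. -/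
lemma size_pow_le {b e q L : ℕ} (hb : b.size ≤ L) (hq : 2 * q.size + 1 ≤ L) (h : b ^ e ≤ q)  :
    (b ^ 2 ^ e.size).size ≤ L := by
  rcases Nat.lt_or_ge b 2 with h2 | h2
  · have : b ^ 2 ^ e.size ≤ 1 := pow_le_one₀ (by omega) (by omega)
    exact (Nat.size_le_size this).trans (by simp; omega)
  · rcases Nat.eq_zero_or_pos e with rfl | he
    · simpa using hb
    · have h3 : 2 ^ e.size ≤ e + e := by
        have : 2 ^ (e.size - 1) ≤ e := Nat.lt_size.1 (by have := Nat.size_pos.2 he; omega)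
        have h4 : e.size = e.size - 1 + 1 := by have := Nat.size_pos.2 he; omega
        rw [h4, pow_succ]
        omega
      have h4 : b ^ 2 ^ e.size ≤ q * q :=
        (Nat.pow_le_pow_right (by omega) h3).trans (by rw [pow_add]; exact Nat.mul_le_mul h h)
      refine (Nat.size_le.2 ?_).trans hq
      have h5 := Nat.lt_size_self q
      calc b ^ 2 ^ e.size ≤ q * q := h4
        _ < 2 ^ q.size * 2 ^ q.size := Nat.mul_lt_mul'' h5 h5
        _ = 2 ^ (2 * q.size) := by ring
        _ ≤ 2 ^ (2 * q.size + 1) := Nat.pow_le_pow_right (by omega) (by omega)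

lemma size_firstNum_le (l : List ℕ) : (firstNum l).size ≤ (encNums l).length := by
  cases l <;> simp [firstNum]

/-- The lengths of the encodings of a factor are bounded. -/
def FactorOk (V : Profile → List ℕ) (r : ℕ → Profile) (last : Bool) (L : ℕ) (f : ℕ × ℕ) : Prop :=
  (encNums (V (r f.1))).length ≤ L ∧ f.2.size ≤ L ∧ (last → (V (r f.1)).length = 1)

lemma runs_powFactor (hV : ∀ p, V p ≠ []) {L q : ℕ} (hL : 2 * q.size + 1 ≤ L) (f : ℕ × ℕ)
    (hf : FactorOk V r last L f) (a s : ℕ) (rest x : List Cell) (ha : 0 < a)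
    (h : a * factorValue V r f ≤ q) (h' : 0 < factorValue V r f) :
    Runs (powFactor last) (work a s (factorCells V r f ++ rest) x)
      (work (a * factorValue V r f) s rest
        ((factorCells (fun p => shift (V p)) r f).reverse ++ x)) (100 * (L + 1) ^ 3) := by
  obtain ⟨h1, h2, h3⟩ := hf
  have hqL : q.size ≤ L := by omega
  have e1 := (runs_head last (work a s [] []) (V (r f.1)) (hV _) (enc f.2 ++ .endExp :: rest)
    (.fac :: x) h3)
  have hb : (firstNum (V (r f.1))).size ≤ L := (size_firstNum_le _).trans h1
  have e2 := (det_pow (work a s [] []) (a := a) (b := firstNum (V (r f.1))) (l := f.2.bits)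
    (w := rest) (x := (encNums (shift (V (r f.1))) ++ [Cell.endProfile]).reverse ++ .fac :: x)
    (L := L) ((Nat.size_le_size ((Nat.le_mul_of_pos_right a h').trans h)).trans hqL)
    ((Nat.size_le_size (by rw [bval_bits]; exact h)).trans hqL)
    (by
      rw [Nat.size_eq_bits_len]
      exact size_pow_le hb hL ((Nat.le_mul_of_pos_left _ ha).trans h))).1
  have e3 := (det_pop (k := .w) (s := .fac) (σ := work a s (factorCells V r f ++ rest) x)
    (l := encNums (V (r f.1)) ++ .endProfile :: (enc f.2 ++ .endExp :: rest))
    (by simp [work, ofText, Store.get, factorCells])).1.mul ((det_push .x .fac).1.mul (e1.mul e2))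
  have e4 := e3.mono (n := 100 * (L + 1) ^ 3) (by
    rw [Nat.size_eq_bits_len]
    have : f.2.size * (L * (36 * L + 38) + 12) ≤ L * (L * (36 * L + 38) + 12) :=
      Nat.mul_le_mul_right _ h2
    nlinarith [Nat.zero_le (L ^ 2), Nat.zero_le (L ^ 3)])
  simpa [work, ofText, factorCells, factorValue, enc, powFactor] using e4

/-- A null base makes a factor null only if the exponent is positive, as `0 ^ 0 = 1`. In binary,
positivity just means that there is at least one digit to copy. -/
lemma det_copyExp (z : Bool) (σ : Store) (e : ℕ) (rest x : List Cell) (h : z → e ≠ 0) :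
    Det (copyExp z) {σ with w := enc e ++ .endExp :: rest, x := x}
      {σ with w := rest, x := (enc e ++ [Cell.endExp]).reverse ++ x} (2 * e.size + 4) := by
  have h0 : ∀ (l : List Bool) (x : List Cell),
      Det (loop (moveOne bitCells .w .x) (pop .w .endExp * push .x .endExp))
      {σ with w := cells l ++ .endExp :: rest, x := x}
      {σ with w := rest, x := (cells l ++ [Cell.endExp]).reverse ++ x} (2 * l.length + 2) := by
    intro l x
    refine (det_moveOne_loop (t := cells l) (rest := .endExp :: rest) (by decide)
      (fun s hs => mem_bitCells_of_mem_cells hs) (by simp [bitCells])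
      (fun σ ρ h => ?_) rfl ((det_pop (l := rest) rfl).mul (det_push _ _))).congr ?_ ?_
    · simp only [rel_mul, rel_pop] at h
      obtain ⟨_, ⟨r, hr, -⟩, -⟩ := h
      simp [hr, bitCells]
    · simp [Store.get, Store.set]
    · simp
  cases z with
  | false =>
    refine (Det.mul (m := 0) ⟨Runs.one, fun ρ h => rel_one.1 h⟩ (h0 e.bits x)).congr rfl ?_
    rw [Nat.size_eq_bits_len]
    omega
  | true =>
    cases he : e.bits with
    | nil => exact absurd (by simpa [he] using (bval_bits e).symm) (h rfl)
    | cons b l =>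
      refine (Det.mul (P := moveOne bitCells .w .x) (m := 2) (Det.alt (mem_bitCells b)
        ((det_pop (σ := {σ with w := enc e ++ .endExp :: rest, x := x}) (k := .w) (s := .bit b)
          (l := cells l ++ .endExp :: rest) (by simp [Store.get, enc, he])).mul
          (det_push _ _)) fun j hj ρ => not_rel_pop_mul ?_) (h0 l (.bit b :: x))).congr ?_ ?_
      · simp [Store.get, enc, he, hj.symm]
      · simp [enc, he]
      · rw [← Nat.size_eq_bits_len, he]
        simp
        omega

lemma ne_zero_of_rel_copyExp (σ : Store) (e : ℕ) (rest : List Cell) (hσ : σ.w = enc e ++ .endExp :: rest)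
    (h : Rel (copyExp true) σ τ) : e ≠ 0 := by
  rintro rfl
  simp [copyExp, moveOne, bitCells, Store.get, hσ, enc] at h

lemma rel_skipFactor (z : Bool) (hV : ∀ p, V p ≠ []) (f : ℕ × ℕ) (a s : ℕ) (rest x : List Cell)
    (h : Rel (skipFactor z last) (work a s (factorCells V r f ++ rest) x) τ) :
    ((last → (V (r f.1)).length = 1) ∧ (z → factorValue V r f = 0)) ∧ τ = work a s rest
      ((factorCells (fun p => shift (V p)) r f).reverse ++ x) := by
  obtain ⟨_, h1, h⟩ := rel_mul.1 h
  obtain rfl := (det_pop (l := encNums (V (r f.1)) ++ .endProfile :: (enc f.2 ++ .endExp :: rest))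
    (by simp [work, ofText, Store.get, factorCells])).2 _ h1
  obtain ⟨_, h1, h⟩ := rel_mul.1 h
  obtain rfl := (det_push _ _).2 _ h1
  obtain ⟨_, h1, h⟩ := rel_mul.1 h
  obtain ⟨hl, rfl⟩ := rel_head last (work a s [] []) _ (hV _) _ _ h1
  obtain ⟨_, h1, h⟩ := rel_mul.1 h
  cases z with
  | false =>
    obtain rfl := (det_clear _ _).2 _ h1
    refine ⟨⟨hl, by simp⟩, ?_⟩
    rw [(det_copyExp false (work a s [] []) f.2 rest _ (by simp)).2 _ h]
    simp [work, ofText, factorCells, Store.get, Store.set]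
  | true =>
    obtain ⟨hb, rfl⟩ := (rel_isEmpty _).1 h1
    have he := ne_zero_of_rel_copyExp _ f.2 rest rfl h
    have hb0 : firstNum (V (r f.1)) = 0 := by
      have : (Nat.bits (firstNum (V (r f.1)))) = [] := by simpa [Store.get, enc] using hb
      simpa [this] using (bval_bits (firstNum (V (r f.1)))).symm
    refine ⟨⟨hl, fun _ => by simp [factorValue, hb0, he]⟩, ?_⟩
    rw [hb0] at h
    rw [(det_copyExp true {work a s [] [] with b := enc 0} f.2 rest _ (fun _ => he)).2 _ h]
    simp [work, ofText, factorCells, Store.get, Store.set, enc]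

lemma runs_skipFactor (z : Bool) (hV : ∀ p, V p ≠ []) {L : ℕ} (f : ℕ × ℕ)
    (hf : FactorOk V r last L f) (a s : ℕ) (rest x : List Cell)
    (h : z → factorValue V r f = 0) :
    Runs (skipFactor z last) (work a s (factorCells V r f ++ rest) x)
      (work a s rest ((factorCells (fun p => shift (V p)) r f).reverse ++ x))
      (100 * (L + 1)) := by
  obtain ⟨h1, h2, h3⟩ := hf
  have e1 := (runs_head last (work a s [] []) (V (r f.1)) (hV _) (enc f.2 ++ .endExp :: rest)
    (.fac :: x) h3)
  have hb : (firstNum (V (r f.1))).size ≤ L := (size_firstNum_le _).trans h1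
  have hz : z → firstNum (V (r f.1)) = 0 ∧ f.2 ≠ 0 := fun hz => by
    simpa [factorValue] using h hz
  have e2 : Runs (if z then isEmpty .b else clear .b)
      {work a s [] [] with w := enc f.2 ++ .endExp :: rest,
                           x := (encNums (shift (V (r f.1))) ++ [Cell.endProfile]).reverse ++
                             .fac :: x, b := enc (firstNum (V (r f.1)))}
      {work a s [] [] with w := enc f.2 ++ .endExp :: rest,
                           x := (encNums (shift (V (r f.1))) ++ [Cell.endProfile]).reverse ++
                             .fac :: x} (L + 1) := by
    cases z with
    | false => exact (det_clear _ _).1.mono (by simpa [Store.get] using hb)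
    | true =>
      rw [(hz rfl).1, show enc 0 = [] by simp [enc]]
      exact (det_isEmpty rfl).1.mono (by omega)
  have e3 := (det_pop (k := .w) (s := .fac) (σ := work a s (factorCells V r f ++ rest) x)
    (l := encNums (V (r f.1)) ++ .endProfile :: (enc f.2 ++ .endExp :: rest))
    (by simp [work, ofText, Store.get, factorCells])).1.mul ((det_push .x .fac).1.mul (e1.mul
      (e2.mul (det_copyExp z (work a s [] []) f.2 rest _ (fun h => (hz h).2)).1)))
  have e4 := e3.mono (n := 100 * (L + 1)) (by omega)
  simpa [work, ofText, factorCells, skipFactor] using e4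

end

end Prog

namespace Prog

open Store

variable {σ τ ρ : Store} {n : ℕ} {P Q : Prog}

/-! #### Terms -/

/-- Read a coefficient, and move its first number to `a`. -/
def readCoef (last : Bool) : Prog :=
  pop .w .coef * (push .x .coef * (head last * (move .b .u * move .u .a)))

/-- Copy a coefficient. If `z` is true, then the coefficient is required to be null. -/
def skipCoef (z last : Bool) : Prog :=
  pop .w .coef * (push .x .coef * (head last * if z then isEmpty .b else clear .b))

/-- At the end of a term, add its value to the number in `s`. -/
def addTerm : Prog :=
  pop .w .endTerm * (push .x .endTerm * (move .a .u * (move .u .b * (move .s .u * (move .u .a *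
    (add * (move .a .u * (move .u .s * clear .b))))))))

/-- Copy the end of a term. -/
def skipEnd : Prog := pop .w .endTerm * push .x .endTerm

/-- Copy factors up to the end of a term. -/
def skipFactors (last : Bool) : Prog := loop (skipFactor false last) skipEnd

/-- Compute a term, or check that one of its factors is null. -/
def evaluateTerm (last : Bool) : Prog :=
  readCoef last * loop (powFactor last) addTerm + (skipCoef true last * skipFactors last +
    skipCoef false last *
      loop (skipFactor false last) (skipFactor true last * skipFactors last))

lemma det_addTerm (a s : ℕ) (rest x : List Cell) {L : ℕ} (h : (s + a).size ≤ L) :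
    Det addTerm (work a s (.endTerm :: rest) x) (work 0 (s + a) rest (.endTerm :: x))
      (35 * L + 20) := by
  have ha : a.size ≤ L := (Nat.size_le_size (by omega)).trans h
  have hs : s.size ≤ L := (Nat.size_le_size (by omega)).trans h
  refine ((det_pop (l := rest) rfl).mul ((det_push _ _).mul ((det_move (by decide) _).mul
    ((det_move (by decide) _).mul ((det_move (by decide) _).mul ((det_move (by decide) _).mul
    (((det_add (work 0 0 rest (.endTerm :: x)) h).of_eq ?_ rfl).mul ((det_move (by decide) _).mul
    ((det_move (by decide) _).mul (det_clear _ _)))))))))).congr ?_ ?_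
  · simp [work, ofText, Store.get, Store.set, enc]
  · simp [work, ofText, Store.get, Store.set, enc]
  · simp [work, ofText, Store.get, Store.set]
    omega

section

variable {V : Profile → List ℕ} {r : ℕ → Profile} {last : Bool}

lemma rel_readCoef {l : List ℕ} (hl : l ≠ []) (s : ℕ) (rest x : List Cell)
    (h : Rel (readCoef last) (work 0 s (.coef :: (encNums l ++ .endProfile :: rest)) x) τ) :
    (last → l.length = 1) ∧ τ = work (firstNum l) s rest
      ((.coef :: (encNums (shift l) ++ [Cell.endProfile])).reverse ++ x) := by
  obtain ⟨_, h1, h⟩ := rel_mul.1 h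
  obtain rfl := (det_pop rfl).2 _ h1
  obtain ⟨_, h1, h⟩ := rel_mul.1 h
  obtain rfl := (det_push _ _).2 _ h1
  obtain ⟨_, h1, h⟩ := rel_mul.1 h
  obtain ⟨hl, rfl⟩ := rel_head last (work 0 s [] []) _ hl rest (.coef :: x) (by
    simpa [work, ofText, Store.set, Store.get] using h1)
  refine ⟨hl, (((det_move (by decide) _).mul (det_move (by decide) _)).2 _ h).trans ?_⟩
  simp [work, ofText, Store.get, Store.set, enc]

lemma runs_readCoef {l : List ℕ} (hl : l ≠ []) (s : ℕ) (rest x : List Cell) {L : ℕ}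
    (hL : (encNums l).length ≤ L) (h : last → l.length = 1) :
    Runs (readCoef last) (work 0 s (.coef :: (encNums l ++ .endProfile :: rest)) x)
      (work (firstNum l) s rest ((.coef :: (encNums (shift l) ++ [Cell.endProfile])).reverse ++ x))
      (11 * L + 10) := by
  have e1 := ((runs_head last (work 0 s [] []) l hl rest (.coef :: x) h).mul
    ((det_move (i := .b) (j := .u) (by decide) _).mul
      (det_move (i := .u) (j := .a) (by decide) _)).1)
  have e2 := (det_pop (k := .w) (s := .coef)
    (σ := work 0 s (.coef :: (encNums l ++ .endProfile :: rest)) x)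
    (l := encNums l ++ .endProfile :: rest) rfl).1.mul ((det_push .x .coef).1.mul
      ((by simpa [work, ofText, Store.set, Store.get] using e1)))
  have hb := (size_firstNum_le l).trans hL
  have e3 := e2.mono (n := 11 * L + 10) (by omega)
  simpa [work, ofText, readCoef, enc] using e3

lemma rel_skipCoef (z : Bool) {l : List ℕ} (hl : l ≠ []) (s : ℕ) (rest x : List Cell)
    (h : Rel (skipCoef z last) (work 0 s (.coef :: (encNums l ++ .endProfile :: rest)) x) τ) :
    (last → l.length = 1) ∧ (z → firstNum l = 0) ∧ τ = work 0 s rest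
      ((.coef :: (encNums (shift l) ++ [Cell.endProfile])).reverse ++ x) := by
  obtain ⟨_, h1, h⟩ := rel_mul.1 h
  obtain rfl := (det_pop rfl).2 _ h1
  obtain ⟨_, h1, h⟩ := rel_mul.1 h
  obtain rfl := (det_push _ _).2 _ h1
  obtain ⟨_, h1, h⟩ := rel_mul.1 h
  obtain ⟨hl, rfl⟩ := rel_head last (work 0 s [] []) _ hl rest (.coef :: x) (by
    simpa [work, ofText, Store.set, Store.get] using h1)
  cases z with
  | false =>
    refine ⟨hl, by simp, ((det_clear _ _).2 _ h).trans ?_⟩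
    simp [work, ofText, Store.set]
  | true =>
    obtain ⟨hb, rfl⟩ := (rel_isEmpty _).1 h
    have hb0 : firstNum l = 0 := by
      have : (firstNum l).bits = [] := by simpa [Store.get, enc] using hb
      simpa [this] using (bval_bits (firstNum l)).symm
    refine ⟨hl, fun _ => hb0, ?_⟩
    simp [work, ofText, enc, hb0]

lemma runs_skipCoef (z : Bool) {l : List ℕ} (hl : l ≠ []) (s : ℕ) (rest x : List Cell) {L : ℕ}
    (hL : (encNums l).length ≤ L) (h : last → l.length = 1) (hz : z → firstNum l = 0) :
    Runs (skipCoef z last) (work 0 s (.coef :: (encNums l ++ .endProfile :: rest)) x)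
      (work 0 s rest ((.coef :: (encNums (shift l) ++ [Cell.endProfile])).reverse ++ x))
      (11 * L + 10) := by
  have e1 := runs_head last (work 0 s [] []) l hl rest (.coef :: x) h
  have hb := (size_firstNum_le l).trans hL
  have e2 : Runs (if z then isEmpty .b else clear .b)
      {work 0 s [] [] with
        w := rest, x := (encNums (shift l) ++ [Cell.endProfile]).reverse ++ .coef :: x,
        b := enc (firstNum l)}
      {work 0 s [] [] with
        w := rest, x := (encNums (shift l) ++ [Cell.endProfile]).reverse ++ .coef :: x}
      (L + 1) := by
    cases z with
    | false => exact (det_clear _ _).1.mono (by simpa [Store.get] using hb)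
    | true =>
      rw [hz rfl, show enc 0 = [] by simp [enc]]
      exact (det_isEmpty rfl).1.mono (by omega)
  have e3 := (det_pop (k := .w) (s := .coef)
    (σ := work 0 s (.coef :: (encNums l ++ .endProfile :: rest)) x)
    (l := encNums l ++ .endProfile :: rest) rfl).1.mul ((det_push .x .coef).1.mul
      ((e1.mul e2)))
  have e4 := e3.mono (n := 11 * L + 10) (by omega)
  simpa [work, ofText, skipCoef] using e4

lemma rel_skipFactors (hV : ∀ p, V p ≠ []) (l : List (ℕ × ℕ)) (s : ℕ) (rest x : List Cell)
    (h : Rel (skipFactors last)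
      (work 0 s (l.flatMap (factorCells V r) ++ .endTerm :: rest) x) τ) :
    (∀ f ∈ l, last → (V (r f.1)).length = 1) ∧ τ = work 0 s rest
      (.endTerm :: ((l.flatMap (factorCells (fun p => shift (V p)) r)).reverse ++ x)) := by
  obtain ⟨l₁, l₂, rfl, hl, h⟩ := rel_loop_list (St := fun _ : Unit => work 0 s)
    (text := factorCells V r) (act := fun _ _ => ())
    (fun f _ rest x τ h => rel_skipFactor false hV f 0 s rest x h)
    (fun _ _ _ => not_rel_pop_mul_work (by decide)) l () x h
  cases l₂ with
  | nil =>
    refine ⟨by simpa using fun f hf hlast => (hl f hf).1 hlast, ?_⟩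
    refine (((det_pop (l := rest) (by rfl)).mul (det_push _ _)).2 _ h).trans ?_
    simp [work, ofText, Store.get, Store.set]
  | cons f l₂ =>
    simp only [List.flatMap_cons, factorCells, List.cons_append] at h
    exact absurd h (not_rel_pop_mul_work (by decide))

lemma runs_skipFactors (hV : ∀ p, V p ≠ []) (l : List (ℕ × ℕ)) (s : ℕ) (rest x : List Cell)
    {L : ℕ} (hL : ∀ f ∈ l, FactorOk V r last L f) :
    Runs (skipFactors last) (work 0 s (l.flatMap (factorCells V r) ++ .endTerm :: rest) x)
      (work 0 s rest (.endTerm ::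
        ((l.flatMap (factorCells (fun p => shift (V p)) r)).reverse ++ x)))
      (l.length * (100 * (L + 1)) + 2) :=
  runs_loop_list (St := fun _ : Unit => work 0 s) (text := factorCells V r)
    (out := factorCells (fun p => shift (V p)) r) (act := fun _ _ => ())
    (good := fun _ l => ∀ f ∈ l, FactorOk V r last L f)
    (fun f l _ rest x h => ⟨fun f hf => h f (by simp [hf]),
      runs_skipFactor false hV f (h f (by simp)) 0 s rest x (by simp)⟩) l () x hL
    fun _ => ((det_pop (l := rest) (by rfl)).mul (det_push _ _)).1

/-- The lists of the profiles in a term have only one number. -/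
def TermLast (V : Profile → List ℕ) (r : ℕ → Profile) (t : ProfileTerm) : Prop :=
  (V t.coeff).length = 1 ∧ ∀ f ∈ t.factors, (V (r f.1)).length = 1

lemma foldl_mul_eq (l : List (ℕ × ℕ)) (a : ℕ) (g : ℕ × ℕ → ℕ) :
    l.foldl (fun a f => a * g f) a = a * (l.map g).prod := by
  induction l generalizing a with
  | nil => simp
  | cons f l ih => simp [ih, mul_assoc]

/-- Whichever of the three branches is taken, computing the product, a null coefficient, or a null
factor at a guessed place, the amount added to `s` is the value of the term. All branches copy the
text with its lists shifted. -/
lemma rel_evaluateTerm (hV : ∀ p, V p ≠ []) (t : ProfileTerm) (s : ℕ) (rest x : List Cell)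
    (h : Rel (evaluateTerm last) (work 0 s (termCells V r t ++ rest) x) τ) :
    (last → TermLast V r t) ∧ τ = work 0 (s + termValue V r t) rest
      ((termCells (fun p => shift (V p)) r t).reverse ++ x) := by
  simp only [termCells, List.cons_append, List.append_assoc, List.nil_append] at h
  rcases rel_add.1 h with h | h
  · obtain ⟨_, h1, h⟩ := rel_mul.1 h
    obtain ⟨hc, rfl⟩ := rel_readCoef (hV _) s _ _ h1
    obtain ⟨l₁, l₂, hl, hl₁, h⟩ := rel_loop_list (St := fun a : ℕ => work a s)
      (text := factorCells V r) (act := fun a f => a * factorValue V r f)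
      (fun f a rest x τ h => rel_powFactor hV f a s rest x h)
      (fun _ _ _ => not_rel_pop_mul_work (by decide)) t.factors _ _ h
    cases l₂ with
    | nil =>
      rw [List.append_nil] at hl
      rw [← hl] at h hl₁
      refine ⟨fun h => ⟨hc h, fun f hf => hl₁ f hf h⟩, ?_⟩
      rw [(det_addTerm _ s rest _ le_rfl).2 _ h, foldl_mul_eq]
      simp [termCells, termValue]
    | cons f l₂ =>
      simp only [List.flatMap_cons, factorCells, List.cons_append] at h
      exact absurd h (not_rel_pop_mul_work (by decide))
  rcases rel_add.1 h with h | h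
  · obtain ⟨_, h1, h⟩ := rel_mul.1 h
    obtain ⟨hc, hz, rfl⟩ := rel_skipCoef true (hV _) s _ _ h1
    obtain ⟨hl, rfl⟩ := rel_skipFactors hV _ s _ _ h
    refine ⟨fun h => ⟨hc h, fun f hf => hl f hf h⟩, ?_⟩
    simp [termCells, termValue, hz]
  · obtain ⟨_, h1, h⟩ := rel_mul.1 h
    obtain ⟨hc, -, rfl⟩ := rel_skipCoef false (hV _) s _ _ h1
    obtain ⟨l₁, l₂, hl, hl₁, h⟩ := rel_loop_list (St := fun _ : Unit => work 0 s)
      (text := factorCells V r) (act := fun _ _ => ())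
      (fun f _ rest x τ h => rel_skipFactor false hV f 0 s rest x h)
      (fun _ _ _ => not_rel_pop_mul_work (by decide)) t.factors () _ h
    obtain ⟨_, h1, h⟩ := rel_mul.1 h
    cases l₂ with
    | nil => exact absurd h1 (not_rel_pop_mul_work (by decide))
    | cons f l₂ =>
      rw [List.flatMap_cons, List.append_assoc] at h1
      obtain ⟨⟨hf, hz⟩, rfl⟩ := rel_skipFactor true hV f 0 s _ _ h1
      obtain ⟨hl₂, rfl⟩ := rel_skipFactors hV _ s _ _ h
      refine ⟨fun hlast => ⟨hc hlast, fun f' hf' => ?_⟩, ?_⟩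
      · rw [hl] at hf'
        rcases List.mem_append.1 hf' with hf' | hf'
        · exact (hl₁ _ hf').1 hlast
        · rcases List.mem_cons.1 hf' with rfl | hf'
          exacts [hf hlast, hl₂ _ hf' hlast]
      · simp [termCells, termValue, hl, hz]

/-- The lengths of the encodings of a term are bounded. -/
def TermOk (V : Profile → List ℕ) (r : ℕ → Profile) (last : Bool) (L : ℕ) (t : ProfileTerm) :
    Prop :=
  (encNums (V t.coeff)).length ≤ L ∧ (last → (V t.coeff).length = 1) ∧ t.factors.length ≤ L ∧
    ∀ f ∈ t.factors, FactorOk V r last L f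

/-- If the value is non-zero, every factor is at least 1, so the partial products stay below the
value of the term and hence below `q`. If it is zero, the other factors may have enormous values,
and a branch that computes nothing is taken. -/
lemma runs_evaluateTerm (hV : ∀ p, V p ≠ []) {L q : ℕ} (hL : 2 * q.size + 1 ≤ L) (t : ProfileTerm)
    (ht : TermOk V r last L t) (s : ℕ) (rest x : List Cell) (h : s + termValue V r t ≤ q) :
    Runs (evaluateTerm last) (work 0 s (termCells V r t ++ rest) x)
      (work 0 (s + termValue V r t) rest ((termCells (fun p => shift (V p)) r t).reverse ++ x))
      (300 * (L + 1) ^ 4) := by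
  obtain ⟨hc, hc', hlen, hf⟩ := ht
  have hcost : ∀ k, k ≤ L * (100 * (L + 1) ^ 3) + 300 * (L + 1) ^ 3 → k ≤ 300 * (L + 1) ^ 4 := by
    intro k hk
    refine hk.trans ?_
    rw [pow_succ (L + 1) 3]
    nlinarith [Nat.zero_le ((L + 1) ^ 3 * L)]
  have h1 : L + 1 ≤ (L + 1) ^ 3 := Nat.le_self_pow (by norm_num) _
  have hfac : t.factors.length * (100 * (L + 1)) ≤ L * (100 * (L + 1) ^ 3) :=
    Nat.mul_le_mul hlen (Nat.mul_le_mul_left _ h1)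
  have e0 : termCells V r t ++ rest = .coef :: (encNums (V t.coeff) ++ .endProfile ::
      (t.factors.flatMap (factorCells V r) ++ .endTerm :: rest)) := by simp [termCells]
  rw [e0]
  by_cases h0 : termValue V r t = 0
  · rw [h0, add_zero]
    by_cases hcz : firstNum (V t.coeff) = 0
    · have e1 := (runs_skipCoef true (hV t.coeff) s
        (t.factors.flatMap (factorCells V r) ++ .endTerm :: rest) x hc hc' fun _ => hcz).mul
        (runs_skipFactors hV t.factors s rest _ hf)
      refine Runs.right (Runs.left ?_)
      simpa [termCells] using e1.mono (hcost _ (by nlinarith))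
    · obtain ⟨f, hft, hfz⟩ : ∃ f ∈ t.factors, factorValue V r f = 0 := by
        have := (mul_eq_zero.1 h0).resolve_left hcz
        rw [List.prod_eq_zero_iff] at this
        simpa using this
      -- The position of the null factor is the guess: the factors before it and after it are copied
      -- without being evaluated.
      obtain ⟨l₁, l₂, hl⟩ := List.append_of_mem hft
      rw [hl] at hf hlen
      have e1 := (runs_skipCoef false (hV t.coeff) s
        (t.factors.flatMap (factorCells V r) ++ .endTerm :: rest) x hc hc' (by simp)).mul
        (Q := loop (skipFactor false last) (skipFactor true last * skipFactors last))
        ((runs_loop_list (St := fun _ : Unit => work 0 s) (text := factorCells V r)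
          (out := factorCells (fun p => shift (V p)) r) (act := fun _ _ => ())
          (good := fun _ l => ∀ f ∈ l, FactorOk V r last L f)
          (Q := skipFactor true last * skipFactors last)
          (rest₀ := factorCells V r f ++ (l₂.flatMap (factorCells V r) ++ .endTerm :: rest))
          (fun f l _ rest x h => ⟨fun f hf => h f (by simp [hf]),
            runs_skipFactor false hV f (h f (by simp)) 0 s rest x (by simp)⟩) l₁ () _
          (fun f hf' => hf f (by simp [hf']))
          fun _ => (runs_skipFactor true hV f (hf f (by simp)) 0 s _ _ fun _ => hfz).mul
            (runs_skipFactors hV l₂ s rest _ fun f hf' => hf f (by simp [hf']))) |> fun h => by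
              simpa [hl] using h)
      refine Runs.right (Runs.right ?_)
      have e2 := e1.mono (hcost _ (by
        have : (l₁.length + (l₂.length + 1)) * (100 * (L + 1)) ≤ L * (100 * (L + 1) ^ 3) :=
          Nat.mul_le_mul (by simpa using hlen) (Nat.mul_le_mul_left _ h1)
        nlinarith))
      simpa [termCells, hl] using e2
  · have hv : 0 < firstNum (V t.coeff) ∧ 0 < (t.factors.map (factorValue V r)).prod := by
      rw [Nat.pos_iff_ne_zero, Nat.pos_iff_ne_zero]
      exact mul_ne_zero_iff.1 h0
    have e1 := (runs_readCoef (hV t.coeff) s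
        (t.factors.flatMap (factorCells V r) ++ .endTerm :: rest) x hc hc').mul
        (runs_loop_list (St := fun a : ℕ => work a s) (text := factorCells V r)
          (out := factorCells (fun p => shift (V p)) r) (act := fun a f => a * factorValue V r f)
          -- The product of the accumulator with all remaining factors is at most `q`; since these
          -- are positive, so is each partial product.
          (good := fun a l => (∀ f ∈ l, FactorOk V r last L f) ∧ 0 < a ∧
            0 < (l.map (factorValue V r)).prod ∧ a * (l.map (factorValue V r)).prod ≤ q)
          (rest₀ := .endTerm :: rest)
          (fun f l a rest x ⟨h1, h2, h3, h4⟩ => by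
            rw [List.map_cons, List.prod_cons] at h3 h4
            have h5 : 0 < factorValue V r f := Nat.pos_of_mul_pos_right h3
            have h6 : 0 < (l.map (factorValue V r)).prod := Nat.pos_of_mul_pos_left h3
            rw [← mul_assoc] at h4
            exact ⟨⟨fun f hf => h1 f (by simp [hf]), Nat.mul_pos h2 h5, h6, h4⟩,
              runs_powFactor hV hL f (h1 f (by simp)) a s rest x h2
                ((Nat.le_mul_of_pos_right _ h6).trans h4) h5⟩) t.factors _ _
          ⟨hf, hv.1, hv.2, (Nat.le_add_left _ _).trans h⟩
          fun _ => (det_addTerm _ s rest _ (L := L) (by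
            rw [foldl_mul_eq]
            exact (Nat.size_le_size h).trans (by omega))).1)
    refine Runs.left ?_
    have e2 := e1.mono (hcost _ (by
      have : t.factors.length * (100 * (L + 1) ^ 3) ≤ L * (100 * (L + 1) ^ 3) :=
        Nat.mul_le_mul_right _ hlen
      omega))
    rw [foldl_mul_eq] at e2
    simpa [termCells, termValue] using e2

end

end Prog

namespace Prog

open Store

variable {σ τ ρ : Store} {n : ℕ} {P Q : Prog}

/-! #### Equations -/

/-- Check that the numbers in `b` and `s` are equal. -/
def compare : Prog :=
  loop (alt bools fun b => pop .b (.bit b) * pop .s (.bit b)) (isEmpty .b * isEmpty .s)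

lemma rel_compare (σ : Store) (p q : List Bool)
    (h : Rel compare {σ with b := cells p, s := cells q} τ) :
    p = q ∧ τ = {σ with b := [], s := []} := by
  induction p generalizing q with
  | nil =>
    rcases rel_loop.1 h with h | ⟨_, h, -⟩
    · obtain ⟨_, h1, h⟩ := rel_mul.1 h
      obtain ⟨-, rfl⟩ := (rel_isEmpty _).1 h1
      obtain ⟨hq, rfl⟩ := (rel_isEmpty _).1 h
      obtain rfl : q = [] := cells_eq_nil.1 hq
      exact ⟨rfl, rfl⟩
    · simp [Store.get] at h
  | cons b p ih =>
    rcases rel_loop.1 h with h | ⟨_, h, h'⟩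
    · simp [Store.get] at h
    · simp only [rel_alt, rel_mul, rel_pop] at h
      obtain ⟨b', -, _, ⟨l, hl, rfl⟩, l', hl', rfl⟩ := h
      cases q with
      | nil => simp [Store.get, Store.set] at hl'
      | cons b'' q =>
        simp only [Store.get, Store.set, cells_cons, List.cons.injEq, Cell.bit.injEq] at hl hl'
        obtain ⟨rfl, rfl⟩ := hl
        obtain ⟨rfl, rfl⟩ := hl'
        obtain ⟨rfl, h2⟩ := ih q h'
        exact ⟨rfl, h2⟩

lemma runs_compare (σ : Store) (p : List Bool) :
    Runs compare {σ with b := cells p, s := cells p} {σ with b := [], s := []}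
      (2 * p.length + 2) := by
  induction p with
  | nil => exact ((det_isEmpty rfl).mul (det_isEmpty rfl)).1.loop_done
  | cons b p ih =>
    exact ((((det_pop (σ := {σ with b := cells (b :: p), s := cells (b :: p)}) (k := .b) (s := .bit b)
      (l := cells p) rfl).mul (det_pop (k := .s) (s := .bit b) (l := cells p) rfl)).1.alt (l := bools)
      (f := fun b => pop .b (.bit b) * pop .s (.bit b)) (mem_bools b)).loop_step ih).mono
      (by simp; omega)

/-- Check an equation. -/
def checkEquation (last : Bool) : Prog :=
  loop (evaluateTerm last) (pop .w .rhs * (push .x .rhs * (head last * compare)))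

/-- Check the equations between the first numbers of the lists, and shift the lists. -/
def round (last : Bool) : Prog := loop (checkEquation last) (isEmpty .w) * move .x .w

/-- Check the equations between all the numbers of the lists. -/
def checkAll : Prog := (round false).star * round true

/-- The equation holds between the first numbers of the lists. -/
def HeadSolution (V : Profile → List ℕ) (r : ℕ → Profile) (E : ProfileEquation) : Prop :=
  lhsValue V r E = firstNum (V E.rhs)

/-- The lists of the profiles in an equation have only one number. -/
def EquationLast (V : Profile → List ℕ) (r : ℕ → Profile) (E : ProfileEquation) : Prop :=
  (∀ t ∈ E.lhs, TermLast V r t) ∧ (V E.rhs).length = 1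

/-- The text of a system. -/
def systemCells (V : Profile → List ℕ) (r : ℕ → Profile) (S : List ProfileEquation) :
    List Cell :=
  S.flatMap (equationCells V r)

/-- The lengths of the encodings of an equation are bounded. -/
def EquationOk (V : Profile → List ℕ) (r : ℕ → Profile) (last : Bool) (L : ℕ)
    (E : ProfileEquation) : Prop :=
  (∀ t ∈ E.lhs, TermOk V r last L t) ∧ E.lhs.length ≤ L ∧ (encNums (V E.rhs)).length ≤ L ∧
    (last → (V E.rhs).length = 1) ∧ 2 * (firstNum (V E.rhs)).size + 1 ≤ L

section

variable {V : Profile → List ℕ} {r : ℕ → Profile} {last : Bool}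

lemma foldl_add_eq {α : Type} (l : List α) (a : ℕ) (g : α → ℕ) :
    l.foldl (fun a i => a + g i) a = a + (l.map g).sum := by
  induction l generalizing a with
  | nil => simp
  | cons f l ih => simp [ih, add_assoc]

lemma rel_checkEquation (hV : ∀ p, V p ≠ []) (E : ProfileEquation) (rest x : List Cell)
    (h : Rel (checkEquation last) (work 0 0 (equationCells V r E ++ rest) x) τ) :
    (HeadSolution V r E ∧ (last → EquationLast V r E)) ∧ τ = work 0 0 rest
      ((equationCells (fun p => shift (V p)) r E).reverse ++ x) := by
  simp only [equationCells, List.cons_append, List.append_assoc, List.nil_append] at h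
  obtain ⟨l₁, l₂, hl, hl₁, h⟩ := rel_loop_list (St := fun s : ℕ => work 0 s)
    (text := termCells V r) (act := fun s t => s + termValue V r t)
    (fun t s rest x τ h => rel_evaluateTerm hV t s rest x h)
    (fun _ _ _ h => by
      rcases rel_add.1 h with h | h
      · obtain ⟨_, h, -⟩ := rel_mul.1 h
        exact not_rel_pop_mul_work (by decide) h
      · rcases rel_add.1 h with h | h <;>
        · obtain ⟨_, h, -⟩ := rel_mul.1 h
          exact not_rel_pop_mul_work (by decide) h) E.lhs 0 x h
  cases l₂ with
  | cons t l₂ =>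
    simp only [List.flatMap_cons, termCells, List.cons_append] at h
    exact absurd h (not_rel_pop_mul_work (by decide))
  | nil =>
    rw [List.append_nil] at hl
    rw [← hl, foldl_add_eq, zero_add] at h
    rw [← hl] at hl₁
    obtain ⟨_, h1, h⟩ := rel_mul.1 h
    obtain rfl := (det_pop rfl).2 _ h1
    obtain ⟨_, h1, h⟩ := rel_mul.1 h
    obtain rfl := (det_push _ _).2 _ h1
    obtain ⟨_, h1, h⟩ := rel_mul.1 h
    obtain ⟨hr, rfl⟩ := rel_head last (work 0 (lhsValue V r E) [] []) _ (hV _) rest _ h1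
    obtain ⟨hb, rfl⟩ := rel_compare {work 0 0 [] [] with
      w := rest
      x := (encNums (shift (V E.rhs)) ++ [Cell.endProfile]).reverse ++ .rhs ::
        ((E.lhs.flatMap (termCells (fun p => shift (V p)) r)).reverse ++ x)} _
        (lhsValue V r E).bits h
    refine ⟨⟨?_, fun hlast => ⟨fun t ht => hl₁ t ht hlast, hr hlast⟩⟩, ?_⟩
    · rw [HeadSolution, ← bval_bits (lhsValue V r E), ← hb, bval_bits]
    · simp [work, ofText, equationCells, enc]

/-- As the equation holds, the partial sums of the left-hand side never exceed the right-hand side,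
which plays the role of `q` for every term. -/
lemma runs_checkEquation (hV : ∀ p, V p ≠ []) {L : ℕ} (E : ProfileEquation)
    (hE : EquationOk V r last L E) (h : HeadSolution V r E) (rest x : List Cell) :
    Runs (checkEquation last) (work 0 0 (equationCells V r E ++ rest) x)
      (work 0 0 rest ((equationCells (fun p => shift (V p)) r E).reverse ++ x))
      (300 * (L + 1) ^ 5) := by
  obtain ⟨ht, hlen, hr, hr', hq⟩ := hE
  have e1 := runs_head last (work 0 (lhsValue V r E) [] []) (V E.rhs) (hV _) rest
    (.rhs :: ((E.lhs.flatMap (termCells (fun p => shift (V p)) r)).reverse ++ x)) hr'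
  have e2 := runs_compare {work 0 0 [] [] with
      w := rest
      x := (encNums (shift (V E.rhs)) ++ [Cell.endProfile]).reverse ++ .rhs ::
        ((E.lhs.flatMap (termCells (fun p => shift (V p)) r)).reverse ++ x)}
        (firstNum (V E.rhs)).bits
  have e3 : Runs (pop .w .rhs * (push .x .rhs * (head last * compare)))
      (work 0 (lhsValue V r E) (.rhs :: (encNums (V E.rhs) ++ .endProfile :: rest))
        ((E.lhs.flatMap (termCells (fun p => shift (V p)) r)).reverse ++ x))
      (work 0 0 rest ((equationCells (fun p => shift (V p)) r E).reverse ++ x))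
      (20 * L + 20) := by
    rw [h] at e1 ⊢
    have e4 := ((det_pop (k := .w) (s := .rhs) (σ := work 0 (firstNum (V E.rhs))
      (.rhs :: (encNums (V E.rhs) ++ .endProfile :: rest))
        ((E.lhs.flatMap (termCells (fun p => shift (V p)) r)).reverse ++ x))
      (l := encNums (V E.rhs) ++ .endProfile :: rest) rfl).1.mul ((det_push .x .rhs).1.mul
      (e1.mul e2))).mono (n := 20 * L + 20) (by
        rw [Nat.size_eq_bits_len]
        omega)
    simpa [work, ofText, equationCells, enc] using e4
  have e5 := runs_loop_list (St := fun s : ℕ => work 0 s) (text := termCells V r)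
    (out := termCells (fun p => shift (V p)) r) (act := fun s t => s + termValue V r t)
    (good := fun s l => (∀ t ∈ l, TermOk V r last L t) ∧
      s + (l.map (termValue V r)).sum ≤ firstNum (V E.rhs))
    (rest₀ := .rhs :: (encNums (V E.rhs) ++ .endProfile :: rest))
    (Q := pop .w .rhs * (push .x .rhs * (head last * compare)))
    (fun t l s rest x ⟨h1, h2⟩ => by
      rw [List.map_cons, List.sum_cons, ← add_assoc] at h2
      exact ⟨⟨fun t ht => h1 t (by simp [ht]), h2⟩,
        runs_evaluateTerm hV hq t (h1 t (by simp)) s rest x ((Nat.le_add_right _ _).trans h2)⟩)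
    E.lhs 0 x ⟨ht, by rw [zero_add]; exact h.le⟩
    fun _ => (by rw [foldl_add_eq, zero_add]; exact e3)
  have e6 := e5.mono (n := 300 * (L + 1) ^ 5) (by
    have h1 : E.lhs.length * (300 * (L + 1) ^ 4) ≤ L * (300 * (L + 1) ^ 4) :=
      Nat.mul_le_mul_right _ hlen
    have h2 : L + 1 ≤ (L + 1) ^ 4 := Nat.le_self_pow (by norm_num) _
    rw [pow_succ (L + 1) 4]
    nlinarith)
  simpa [checkEquation, equationCells] using e6

lemma rel_round (hV : ∀ p, V p ≠ []) (S : List ProfileEquation)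
    (h : Rel (round last) (ofText (systemCells V r S)) τ) :
    (∀ E ∈ S, HeadSolution V r E ∧ (last → EquationLast V r E)) ∧
      τ = ofText (systemCells (fun p => shift (V p)) r S) := by
  obtain ⟨_, h, h'⟩ := rel_mul.1 h
  rw [← work_zero, ← List.append_nil (systemCells V r S)] at h
  obtain ⟨l₁, l₂, rfl, hl₁, h⟩ := rel_loop_list (St := fun _ : Unit => work 0 0)
    (text := equationCells V r) (act := fun _ _ => ())
    (fun E _ rest x τ h => rel_checkEquation hV E rest x h)
    (fun _ _ _ h => by
      rcases rel_loop.1 h with h | ⟨_, h, -⟩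
      · exact not_rel_pop_mul (by simp [Store.get, work, ofText]) h
      rcases rel_add.1 h with h | h
      · obtain ⟨_, h, -⟩ := rel_mul.1 h
        exact not_rel_pop_mul (by simp [Store.get, work, ofText]) h
      · rcases rel_add.1 h with h | h <;>
        · obtain ⟨_, h, -⟩ := rel_mul.1 h
          exact not_rel_pop_mul (by simp [Store.get, work, ofText]) h) S () [] h
  obtain ⟨hw, rfl⟩ := (rel_isEmpty _).1 h
  cases l₂ with
  | cons E l₂ => simp [Store.get, work, ofText, equationCells] at hw
  | nil =>
    refine ⟨by simpa using hl₁, ((det_move (by decide) _).2 _ h').trans ?_⟩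
    simp [work, ofText, systemCells, Store.get, Store.set, enc]

lemma runs_round (hV : ∀ p, V p ≠ []) {L : ℕ} (S : List ProfileEquation)
    (hS : ∀ E ∈ S, EquationOk V r last L E) (h : ∀ E ∈ S, HeadSolution V r E)
    (hL : (systemCells (fun p => shift (V p)) r S).length ≤ L) (hlen : S.length ≤ L) :
    Runs (round last) (ofText (systemCells V r S))
      (ofText (systemCells (fun p => shift (V p)) r S)) (300 * (L + 1) ^ 6) := by
  have e1 := (runs_loop_list (St := fun _ : Unit => work 0 0) (text := equationCells V r)
    (out := equationCells (fun p => shift (V p)) r) (act := fun _ _ => ()) (rest₀ := [])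
    (good := fun _ l => ∀ E ∈ l, EquationOk V r last L E ∧ HeadSolution V r E)
    (Q := isEmpty .w)
    (fun E l _ rest x h => ⟨fun E hE => h E (by simp [hE]),
      runs_checkEquation hV E (h E (by simp)).1 (h E (by simp)).2 rest x⟩)
    S () [] (fun E hE => ⟨hS E hE, h E hE⟩)
    fun _ => (det_isEmpty (by rfl)).1).mul (det_move (i := .x) (j := .w) (by decide) _).1
  have e2 := e1.mono (n := 300 * (L + 1) ^ 6) (by
    have h1 : S.length * (300 * (L + 1) ^ 5) ≤ L * (300 * (L + 1) ^ 5) :=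
      Nat.mul_le_mul_right _ hlen
    have h2 : L + 1 ≤ (L + 1) ^ 5 := Nat.le_self_pow (by norm_num) _
    have h3 : (work 0 0 [] ((systemCells (fun p => shift (V p)) r S).reverse ++ [])).x.length ≤ L := by
      simpa [work] using hL
    simp only [systemCells] at h3
    rw [pow_succ (L + 1) 5]
    simp only [Store.get]
    nlinarith)
  simpa [round, work, systemCells, Store.get, Store.set, ofText, enc] using e2

end

lemma shift_ne_nil {l : List ℕ} (h : l ≠ []) : shift l ≠ [] := by
  rcases l with _ | ⟨n, _ | ⟨m, l⟩⟩ <;> simp_all [shift]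

/-- The number of rounds is guessed. The last round insists that all the lists occurring in the
system are singletons, so stopping too early is impossible. -/
lemma rel_checkAll (V : Profile → List ℕ) (r : ℕ → Profile) (hV : ∀ p, V p ≠ [])
    (S : List ProfileEquation) (h : Rel checkAll (ofText (systemCells V r S)) τ) :
    ∃ N, (∀ k ≤ N, ∀ E ∈ S, HeadSolution (fun p => shift^[k] (V p)) r E) ∧
      ∀ E ∈ S, EquationLast (fun p => shift^[N] (V p)) r E := by
  obtain ⟨ρ, h1, h2⟩ := rel_mul.1 h
  refine h1.star_induction (fun σ' => ∀ V : Profile → List ℕ, (∀ p, V p ≠ []) →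
    σ' = ofText (systemCells V r S) →
    ∃ N, (∀ k ≤ N, ∀ E ∈ S, HeadSolution (fun p => shift^[k] (V p)) r E) ∧
      ∀ E ∈ S, EquationLast (fun p => shift^[N] (V p)) r E) ?_ ?_ V hV rfl
  · rintro V hV rfl
    obtain ⟨h3, -⟩ := rel_round hV S h2
    exact ⟨0, fun k hk E hE => by
      obtain rfl := Nat.le_zero.1 hk
      exact (h3 E hE).1, fun E hE => (h3 E hE).2 rfl⟩
  · rintro ρ₁ ρ₂ h3 - ih V hV rfl
    obtain ⟨h4, rfl⟩ := rel_round hV S h3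
    obtain ⟨N, h5, h6⟩ := ih _ (fun p => shift_ne_nil (hV p)) rfl
    refine ⟨N + 1, fun k hk E hE => ?_, h6⟩
    cases k with
    | zero => exact (h4 E hE).1
    | succ k => exact h5 k (by omega) E hE

/-- All rounds share the single size bound `L`; the bounds on the shifted lists are assumed for
every round, since the texts change from one to the next. -/
lemma runs_checkAll (V : Profile → List ℕ) (r : ℕ → Profile) (hV : ∀ p, V p ≠ [])
    (S : List ProfileEquation) (N L : ℕ) (hlen : S.length ≤ L)
    (hok : ∀ k ≤ N, ∀ E ∈ S,
      EquationOk (fun p => shift^[k] (V p)) r (decide (k = N)) L E)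
    (hL : ∀ k ≤ N + 1, (systemCells (fun p => shift^[k] (V p)) r S).length ≤ L)
    (h : ∀ k ≤ N, ∀ E ∈ S, HeadSolution (fun p => shift^[k] (V p)) r E) :
    ∃ τ, Runs checkAll (ofText (systemCells V r S)) τ ((N + 1) * (300 * (L + 1) ^ 6)) := by
  have key : ∃ ρ τ, Runs (round false).star (ofText (systemCells V r S)) ρ
      (N * (300 * (L + 1) ^ 6)) ∧ Runs (round true) ρ τ (300 * (L + 1) ^ 6) := by
    induction N generalizing V with
    | zero =>
      exact ⟨_, _, Runs.star_nil.mono (by simp), runs_round hV S (hok 0 le_rfl) (h 0 le_rfl)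
        (hL 1 le_rfl) hlen⟩
    | succ N ih =>
      have h1 := runs_round (last := false) hV S (hok 0 (by omega)) (h 0 (by omega))
        (hL 1 (by omega)) hlen
      obtain ⟨ρ, τ, h2, h3⟩ := ih (fun p => shift (V p)) (fun p => shift_ne_nil (hV p))
        (fun k hk E hE => by simpa using hok (k + 1) (by omega) E hE)
        (fun k hk => hL (k + 1) (by omega))
        (fun k hk E hE => h (k + 1) (by omega) E hE)
      exact ⟨ρ, τ, (h1.star_cons h2).mono (by rw [add_mul]; omega), h3⟩
  obtain ⟨ρ, τ, h1, h2⟩ := key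
  exact ⟨τ, (h1.mul h2).mono (by rw [add_mul]; omega)⟩

end Prog

/-! ### Sizes of solutions -/

namespace Profile

lemma psum_succ_of_height_le (p : Profile) {k : ℕ} (h : p.height ≤ k) :
    p.psum (k + 1) = p.psum (p.height + 1) := by
  induction k, h using Nat.le_induction with
  | base => rfl
  | succ k hk ih =>
    rw [← ih, psum, Finset.sum_range_succ, p.seq_eq_zero_of_height_lt (by omega)]
    rfl

lemma sum_entries (p : Profile) : p.entries.sum = p.psum (p.height + 1) := by
  rw [entries, psum, Finset.sum_range]
  rw [← List.sum_ofFn, List.ofFn_eq_map, ← List.map_coe_finRange_eq_range, List.map_map]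
  rfl

lemma psum_mono (p : Profile) {i j : ℕ} (h : i ≤ j) : p.psum i ≤ p.psum j :=
  Finset.sum_le_sum_of_subset (Finset.range_mono h)

lemma psum_le_sum_entries (p : Profile) (k : ℕ) : p.psum k ≤ p.entries.sum := by
  rw [sum_entries]
  rcases Nat.le_total p.height k with h | h
  · rw [← p.psum_succ_of_height_le h]
    exact p.psum_mono (by omega)
  · exact p.psum_mono (by omega)

/-- The partial sums of a fixed positive number of terms, as a homomorphism. -/
def psumHom (k : ℕ) : Profile →+* ℕ where
  toFun p := p.psum (k + 1)
  map_one' := by simp [psum_one]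
  map_mul' p q := psum_mul p q _
  map_zero' := psum_zero _
  map_add' p q := psum_add p q _

lemma seq_zero_ne_zero {p : Profile} (h : p ≠ 0) : p.seq 0 ≠ 0 :=
  fun h0 => h (p.eq_zero_of_seq_zero h0)

lemma psum_pos {p : Profile} (h : p ≠ 0) (k : ℕ) : 0 < p.psum (k + 1) :=
  (Nat.pos_of_ne_zero (seq_zero_ne_zero h)).trans_le
    (Finset.single_le_sum (fun _ _ => Nat.zero_le _) (Finset.mem_range.2 (Nat.succ_pos k)))

/-- The number of periodic states is multiplicative, and positive for a non-null profile. -/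
instance : NoZeroDivisors Profile where
  eq_zero_or_eq_zero_of_mul_eq_zero {p q} h := by
    by_contra! h'
    have h1 := psum_mul p q 1
    rw [h, psum_zero] at h1
    exact (Nat.mul_pos (psum_pos h'.1 0) (psum_pos h'.2 0)).ne h1

instance : Nontrivial Profile :=
  ⟨1, 0, fun h => by simpa [psum_one, psum_zero] using congrArg (fun p => p.psum 1) h⟩

/-- The height and the number of states of each profile are bounded by those of another one. -/
def Dominated (p q : Profile) : Prop :=
  (∀ i, p.seq i ≠ 0 → q.seq i ≠ 0) ∧ ∀ k, p.psum k ≤ q.psum k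

lemma Dominated.trans {p q s : Profile} (h : p.Dominated q) (h' : q.Dominated s) :
    p.Dominated s :=
  ⟨fun i hi => h'.1 i (h.1 i hi), fun k => (h.2 k).trans (h'.2 k)⟩

lemma dominated_add (p q : Profile) : p.Dominated (p + q) :=
  ⟨fun i hi => show p.seq i + q.seq i ≠ 0 by omega, fun k => by
    rw [psum_add]
    exact Nat.le_add_right _ _⟩

/-- The term of index `i` of the product contains `p_i` times the sum of `q_0, …, q_i`, which is
positive because `q` is not null. For the partial sums it suffices that they multiply. -/
lemma dominated_mul (p : Profile) {q : Profile} (hq : q ≠ 0) : p.Dominated (p * q) := by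
  refine ⟨fun i hi => ?_, fun k => ?_⟩
  · show mulSeq p.seq q.seq i ≠ 0
    rw [mulSeq_eq]
    cases i with
    | zero =>
      have := Nat.mul_pos (Nat.pos_of_ne_zero hi) (Nat.pos_of_ne_zero (seq_zero_ne_zero hq))
      omega
    | succ i =>
      have := Nat.mul_pos (Nat.pos_of_ne_zero hi) (psum_pos hq i)
      rw [psum] at this
      omega
  · rw [psum_mul]
    cases k with
    | zero => simp [psum]
    | succ k => exact Nat.le_mul_of_pos_right _ (psum_pos hq k)

lemma Dominated.height_le {p q : Profile} (h : p.Dominated q) : p.height ≤ q.height := by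
  rcases eq_or_ne p 0 with rfl | hp
  · rw [height_zero]
    exact Nat.zero_le _
  · by_contra! hlt
    exact h.1 _ (p.seq_ne_zero_of_le_height (seq_zero_ne_zero hp) le_rfl)
      (q.seq_eq_zero_of_height_lt hlt)

lemma dominated_pow {p : Profile} (hp : p ≠ 0) {e : ℕ} (he : e ≠ 0) : p.Dominated (p ^ e) := by
  obtain ⟨e, rfl⟩ := Nat.exists_eq_succ_of_ne_zero he
  rw [pow_succ']
  exact dominated_mul p (pow_ne_zero e hp)

lemma dominated_prod {l : List Profile} (hl : l.prod ≠ 0) {p : Profile} (hp : p ∈ l) :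
    p.Dominated l.prod := by
  obtain ⟨l₁, l₂, rfl⟩ := List.append_of_mem hp
  rw [List.prod_append, List.prod_cons, mul_left_comm] at *
  exact dominated_mul p (right_ne_zero_of_mul hl)

lemma dominated_sum {l : List Profile} {p : Profile} (hp : p ∈ l) : p.Dominated l.sum := by
  obtain ⟨l₁, l₂, rfl⟩ := List.append_of_mem hp
  rw [List.sum_append, List.sum_cons, add_left_comm]
  exact dominated_add p _

end Profile

/-! ### Solutions of polynomial size -/

open Profile

/-- The value of a term in the semiring of profiles. -/
def ProfileTerm.eval (r : ℕ → Profile) (t : ProfileTerm) : Profile :=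
  t.coeff * (t.factors.map fun f => r f.1 ^ f.2).prod

lemma eval_termsToPoly (r : ℕ → Profile) (l : List ProfileTerm) :
    MvPolynomial.eval r (termsToPoly l) = (l.map (ProfileTerm.eval r)).sum := by
  rw [termsToPoly, map_list_sum, List.map_map]
  congr 2
  funext t
  simp [ProfileTerm.toPoly, ProfileTerm.eval, map_list_prod, Function.comp_def]

/-- The variable `v` has an influence on the value of a term. -/
def Relevant (S : List ProfileEquation) (r : ℕ → Profile) (v : ℕ) : Prop :=
  ∃ E ∈ S, ∃ t ∈ E.lhs, t.eval r ≠ 0 ∧ ∃ e ≠ 0, (v, e) ∈ t.factors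

open Classical in
/-- The solution in which the variables without influence are replaced by zero. -/
noncomputable def restrict (S : List ProfileEquation) (r : ℕ → Profile) (v : ℕ) : Profile :=
  if Relevant S r v then r v else 0

/-- In a term of non-null value, all variables with a positive exponent are relevant and keep their
values, while those with exponent zero do not matter. A term of null value has a null coefficient,
or a variable with positive exponent and null value; that variable remains null whether or not it is
relevant. -/
lemma eval_restrict (S : List ProfileEquation) (r : ℕ → Profile) {E : ProfileEquation}
    (hE : E ∈ S) {t : ProfileTerm} (ht : t ∈ E.lhs) : t.eval (restrict S r) = t.eval r := by
  by_cases h0 : t.eval r = 0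
  · rw [h0]
    rcases mul_eq_zero.1 h0 with h | h
    · rw [ProfileTerm.eval, h, zero_mul]
    · obtain ⟨⟨v, e⟩, hf, hz⟩ := List.mem_map.1 (List.prod_eq_zero_iff.1 h)
      have he : e ≠ 0 := by
        rintro rfl
        simp at hz
      have hz : r v = 0 := by simpa [he] using hz
      rw [ProfileTerm.eval, List.prod_eq_zero (List.mem_map.2 ⟨(v, e), hf, ?_⟩), mul_zero]
      rw [restrict]
      split_ifs <;> simp [hz, he]
  · rw [ProfileTerm.eval, ProfileTerm.eval]
    congr 2
    refine List.map_congr_left fun ⟨v, e⟩ hf => ?_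
    rcases eq_or_ne e 0 with rfl | he
    · simp
    · rw [restrict, if_pos ⟨E, hE, t, ht, h0, e, he, hf⟩]

lemma isSolution_restrict {S : List ProfileEquation} {r : ℕ → Profile}
    (h : ∀ E ∈ S, E.IsSolution r) : ∀ E ∈ S, E.IsSolution (restrict S r) := by
  intro E hE
  rw [ProfileEquation.IsSolution, ← h E hE, eval_termsToPoly, eval_termsToPoly]
  congr 1
  exact List.map_congr_left fun t ht => eval_restrict S r hE ht

/-- A relevant variable is dominated by its positive power, this by the product of the factors, this
by the non-null term, and this by the sum of the terms, which is the right-hand side. -/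
lemma restrict_dominated {S : List ProfileEquation} {r : ℕ → Profile}
    (h : ∀ E ∈ S, E.IsSolution r) (v : ℕ) :
    restrict S r v = 0 ∨ ∃ E ∈ S, (restrict S r v).Dominated E.rhs := by
  rw [restrict]
  split_ifs with hv
  · obtain ⟨E, hE, t, ht, h0, e, he, hf⟩ := hv
    refine .inr ⟨E, hE, ?_⟩
    rw [← h E hE, eval_termsToPoly]
    have h1 := right_ne_zero_of_mul h0
    have h2 : r v ^ e ∈ t.factors.map fun f => r f.1 ^ f.2 := List.mem_map.2 ⟨_, hf, rfl⟩
    have h3 : r v ≠ 0 := by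
      intro h4
      refine h1 (List.prod_eq_zero ?_)
      rw [h4, zero_pow he] at h2
      exact h2
    refine (dominated_pow h3 he).trans ((dominated_prod h1 h2).trans (Dominated.trans ?_
      (dominated_sum (List.mem_map.2 ⟨t, ht, rfl⟩))))
    rw [ProfileTerm.eval, mul_comm]
    exact dominated_mul _ (left_ne_zero_of_mul h0)
  · exact .inl rfl

/-! ### The first numbers of the shifted lists -/

lemma length_iterate_shift {l : List ℕ} (h : l ≠ []) (k : ℕ) :
    (shift^[k] l).length = max 1 (l.length - k) := by
  induction k generalizing l with
  | zero =>
    have := List.length_pos_iff.2 h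
    simp
    omega
  | succ k ih =>
    rw [Function.iterate_succ_apply, ih (Prog.shift_ne_nil h)]
    rcases l with _ | ⟨n, _ | ⟨m, l⟩⟩
    · exact absurd rfl h
    · simp [shift]
    · simp [shift]

lemma firstNum_iterate_shift {l : List ℕ} (h : l ≠ []) (k : ℕ) :
    firstNum (shift^[k] l) = l.getD (min k (l.length - 1)) 0 := by
  induction k generalizing l with
  | zero => cases l <;> simp [firstNum]
  | succ k ih =>
    rw [Function.iterate_succ_apply, ih (Prog.shift_ne_nil h)]
    rcases l with _ | ⟨n, _ | ⟨m, l⟩⟩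
    · exact absurd rfl h
    · simp [shift]
    · simp only [shift, List.length_cons, Nat.add_sub_cancel]
      rw [Nat.add_min_add_right, List.getD_cons_succ]

lemma Profile.psums_ne_nil (p : Profile) : p.psums ≠ [] := by simp [psums]

/-- Shifting a list stops at its last number, just as the partial sums become constant from the
height on. The finite list therefore represents the whole sequence. -/
lemma firstNum_iterate_shift_psums (p : Profile) (k : ℕ) :
    firstNum (shift^[k] p.psums) = psumHom k p := by
  rw [firstNum_iterate_shift p.psums_ne_nil]
  have hlen : p.psums.length = p.height + 1 := by simp [psums]
  rw [hlen, Nat.add_sub_cancel, List.getD_eq_getElem _ _ (by omega)]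
  simp only [psums, List.getElem_map, List.getElem_range]
  show _ = p.psum (k + 1)
  rcases Nat.le_total k p.height with h | h
  · rw [Nat.min_eq_left h]
  · rw [Nat.min_eq_right h, p.psum_succ_of_height_le h]

lemma lhsValue_psums (r : ℕ → Profile) (E : ProfileEquation) (k : ℕ) :
    lhsValue (fun p => shift^[k] p.psums) r E =
      psumHom k (MvPolynomial.eval r (termsToPoly E.lhs)) := by
  rw [eval_termsToPoly, map_list_sum, List.map_map, lhsValue]
  congr 2
  funext t
  have h : factorValue (fun p => shift^[k] p.psums) r = fun f => psumHom k (r f.1) ^ f.2 :=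
    funext fun f => by rw [factorValue, firstNum_iterate_shift_psums]
  simp [termValue, ProfileTerm.eval, h, firstNum_iterate_shift_psums, map_list_prod,
    Function.comp_def]

lemma headSolution_iff (r : ℕ → Profile) (E : ProfileEquation) (k : ℕ) :
    Prog.HeadSolution (fun p => shift^[k] p.psums) r E ↔
      psumHom k (MvPolynomial.eval r (termsToPoly E.lhs)) = psumHom k E.rhs := by
  rw [Prog.HeadSolution, lhsValue_psums, firstNum_iterate_shift_psums]

lemma iterate_shift_eq {l : List ℕ} {N k : ℕ} (h : (shift^[N] l).length = 1) (hk : N ≤ k) :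
    shift^[k] l = shift^[N] l := by
  induction k, hk using Nat.le_induction with
  | base => rfl
  | succ k hk ih =>
    rw [Function.iterate_succ_apply', ih]
    obtain ⟨n, hn⟩ := List.length_eq_one_iff.1 h
    rw [hn]
    rfl

/-- Once the lists are singletons, further shifts do not change them, so the equation of index `N`
is also the one of every larger index. All partial sums of the two sides then agree, and these
determine a profile. -/
lemma isSolution_of_headSolution {r : ℕ → Profile} {E : ProfileEquation} {N : ℕ}
    (h : ∀ k ≤ N, Prog.HeadSolution (fun p => shift^[k] p.psums) r E)
    (hN : Prog.EquationLast (fun p => shift^[N] p.psums) r E) : E.IsSolution r := by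
  have h1 : ∀ k, Prog.HeadSolution (fun p => shift^[k] p.psums) r E := by
    intro k
    rcases Nat.le_total k N with hk | hk
    · exact h k hk
    · have h2 := h N le_rfl
      rw [Prog.HeadSolution] at h2 ⊢
      rw [iterate_shift_eq hN.2 hk, ← h2, lhsValue, lhsValue]
      congr 1
      refine List.map_congr_left fun t ht => ?_
      obtain ⟨h3, h4⟩ := hN.1 t ht
      rw [termValue, termValue, iterate_shift_eq h3 hk]
      congr 2
      refine List.map_congr_left fun f hf => ?_
      rw [factorValue, factorValue, iterate_shift_eq (h4 f hf) hk]
  refine ext_psum fun k => ?_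
  cases k with
  | zero => simp [psum]
  | succ k => exact (headSolution_iff r E k).1 (h1 k)

/-! ### Lengths of texts -/

open Profile Template

lemma length_le_flatMap {α β : Type} {l : List α} {f : α → List β} {a : α} (h : a ∈ l) :
    (f a).length ≤ (l.flatMap f).length := by
  rw [List.length_flatMap]
  exact List.single_le_sum (by simp) _ (List.mem_map_of_mem h)

lemma card_le_flatMap {α β : Type} {l : List α} {f : α → List β} (h : ∀ a ∈ l, f a ≠ []) :
    l.length ≤ (l.flatMap f).length := by
  induction l with
  | nil => simp
  | cons a l ih =>
    have h1 := List.length_pos_iff.2 (h a (by simp))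
    have h2 := ih fun b hb => h b (by simp [hb])
    simp only [List.length_cons, List.flatMap_cons, List.length_append]
    omega

lemma length_flatMap_le {α β γ : Type} {l : List α} {f : α → List β} {g : α → List γ} {D : ℕ}
    (h : ∀ a ∈ l, (f a).length ≤ D * (g a).length) :
    (l.flatMap f).length ≤ D * (l.flatMap g).length := by
  induction l with
  | nil => simp
  | cons a l ih =>
    have h1 := h a (by simp)
    have h2 := ih fun b hb => h b (by simp [hb])
    simp only [List.flatMap_cons, List.length_append, mul_add]
    omega

lemma length_codeNat (n : ℕ) : (codeNat n).length = n.size + 1 := by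
  simp [codeNat, encodeNat_eq_bits, Nat.size_eq_bits_len]

lemma length_codeProfile (p : Profile) :
    (codeProfile p).length = (encNums p.entries).length + 1 := by
  rw [← List.length_map (f := EqSymbol.toCell), map_codeProfile]
  simp

/-- The lengths of the texts of the profiles in a system are bounded. -/
def TextsLe (A : Profile → List Cell) (B : ℕ → List Cell) (D : ℕ) (S : List ProfileEquation) :
    Prop :=
  ∀ E ∈ S, (A E.rhs).length ≤ D ∧ ∀ t ∈ E.lhs, (A t.coeff).length ≤ D ∧
    ∀ f ∈ t.factors, (B f.1).length ≤ D

/-- The text of a system whose constants and variables are represented by given texts. -/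
def textWith (A : Profile → List Cell) (B : ℕ → List Cell) (S : List ProfileEquation) :
    List Cell :=
  S.flatMap fun E => (E.lhs.flatMap fun t => .coef :: (A t.coeff ++ .endProfile ::
    ((t.factors.flatMap fun f => .fac :: (B f.1 ++ .endProfile :: (enc f.2 ++ [.endExp]))) ++
      [.endTerm]))) ++ .rhs :: (A E.rhs ++ [.endProfile])

lemma systemCells_eq (V : Profile → List ℕ) (r : ℕ → Profile) (S : List ProfileEquation) :
    Prog.systemCells V r S = textWith (fun p => encNums (V p)) (fun v => encNums (V (r v))) S :=
  rfl

lemma subst_systemText (g : ℕ → List Cell) (S : List ProfileEquation) :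
    (systemText S).subst g = textWith (fun p => encNums p.psums) g S := by
  simp [systemText, equationText, termText, factorText, textWith, subst_flatMap]

/-- Each coefficient, factor or right-hand side contributes at most `D + 3` symbols besides the
digits of an exponent, and each has a non-empty code in the input. -/
lemma length_textWith_le {A : Profile → List Cell} {B : ℕ → List Cell} {D : ℕ}
    {S : List ProfileEquation} (h : TextsLe A B D S) :
    (textWith A B S).length ≤ (D + 3) * (codeSystem S).length := by
  refine length_flatMap_le fun E hE => ?_
  obtain ⟨h1, h2⟩ := h E hE
  have h3 : (E.lhs.flatMap fun t => Cell.coef :: (A t.coeff ++ .endProfile ::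
      ((t.factors.flatMap fun f => .fac :: (B f.1 ++ .endProfile :: (enc f.2 ++ [.endExp]))) ++
      [.endTerm]))).length ≤ (D + 3) * (E.lhs.flatMap codeTerm).length := by
    refine length_flatMap_le fun t ht => ?_
    obtain ⟨h4, h5⟩ := h2 t ht
    have h6 : (t.factors.flatMap fun f => Cell.fac :: (B f.1 ++ .endProfile ::
        (enc f.2 ++ [.endExp]))).length ≤
        (D + 3) * (t.factors.flatMap fun f => codeNat f.1 ++ codeNat f.2).length := by
      refine length_flatMap_le fun f hf => ?_
      have h7 := h5 f hf
      simp only [List.length_cons, List.length_append, Prog.length_enc, length_codeNat,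
        List.length_nil]
      nlinarith [Nat.zero_le ((D + 3) * f.1.size), Nat.zero_le (D * f.2.size)]
    simp only [codeTerm, List.length_cons, List.length_append, List.length_nil]
    nlinarith [Nat.zero_le ((D + 3) * (codeProfile t.coeff).length)]
  have h8 : 1 ≤ (codeProfile E.rhs).length := by rw [length_codeProfile]; omega
  simp only [codeEquation, List.length_cons, List.length_append, List.length_nil]
  nlinarith

lemma length_encNums_le (l : List ℕ) {m : ℕ} (hl : l.length ≤ m) (h : ∀ n ∈ l, n.size ≤ m) :
    (encNums l).length ≤ m * (m + 1) := by
  rw [length_encNums]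
  refine (List.sum_le_card_nsmul _ (m + 1) fun k hk => ?_).trans ?_
  · obtain ⟨n, hn, rfl⟩ := List.mem_map.1 hk
    exact Nat.succ_le_succ (h n hn)
  · rw [List.length_map, smul_eq_mul]
    exact Nat.mul_le_mul_right _ hl

/-- The number of heights and the size of the number of states are bounded. -/
def Profile.Small (m : ℕ) (p : Profile) : Prop := p.height + 1 ≤ m ∧ p.entries.sum.size ≤ m

namespace Profile.Small

variable {m : ℕ} {p : Profile}

lemma length_psums (h : p.Small m) : (encNums p.psums).length ≤ m * (m + 1) := by
  refine length_encNums_le _ (by simpa [psums] using h.1) fun n hn => ?_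
  obtain ⟨i, -, rfl⟩ := List.mem_map.1 hn
  exact (Nat.size_le_size (p.psum_le_sum_entries _)).trans h.2

lemma length_entries (h : p.Small m) : (encNums p.entries).length ≤ m * (m + 1) := by
  refine length_encNums_le _ (by simpa [entries] using h.1) fun n hn => ?_
  exact (Nat.size_le_size (List.single_le_sum (by simp) n hn)).trans h.2

lemma of_dominated {q : Profile} (h : q.Small m) (hpq : p.Dominated q) : p.Small m := by
  refine ⟨(Nat.succ_le_succ hpq.height_le).trans h.1, le_trans (Nat.size_le_size ?_) h.2⟩
  rw [sum_entries]
  exact (hpq.2 _).trans (q.psum_le_sum_entries _)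

lemma of_code (h : (codeProfile p).length ≤ m) : p.Small m := by
  rw [length_codeProfile] at h
  have h1 := length_le_encNums p.entries
  refine ⟨by simp [entries] at h1; simp [entries] at h; omega, (size_sum_le _).trans (by omega)⟩

lemma zero (h : 1 ≤ m) : (0 : Profile).Small m := by
  rw [Small, height_zero, entries_zero]
  simpa using h

end Profile.Small

lemma length_encNums_shift_le (l : List ℕ) (k : ℕ) :
    (encNums (shift^[k] l)).length ≤ (encNums l).length := by
  induction k generalizing l with
  | zero => exact le_rfl
  | succ k ih =>
    refine (ih (shift l)).trans ?_
    rcases l with _ | ⟨n, _ | ⟨m, l⟩⟩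
    · simp [shift]
    · simp [shift]
    · simp [shift]
      omega

section Lengths

variable {S : List ProfileEquation} {E : ProfileEquation} {t : ProfileTerm}

lemma length_codeEquation_le (hE : E ∈ S) :
    (E.lhs.flatMap codeTerm).length + (codeProfile E.rhs).length ≤ (codeSystem S).length := by
  refine le_trans ?_ (length_le_flatMap (f := codeEquation) hE)
  simp [codeEquation]

lemma length_codeTerm_le (hE : E ∈ S) (ht : t ∈ E.lhs) :
    (codeProfile t.coeff).length +
      (t.factors.flatMap fun f => codeNat f.1 ++ codeNat f.2).length ≤ (codeSystem S).length := by
  refine le_trans ?_ ((length_le_flatMap (f := codeTerm) ht).trans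
    ((Nat.le_add_right _ _).trans (length_codeEquation_le hE)))
  simp [codeTerm]

lemma length_codeFactor_le (hE : E ∈ S) (ht : t ∈ E.lhs) {f : ℕ × ℕ} (hf : f ∈ t.factors) :
    f.1.size + f.2.size ≤ (codeSystem S).length := by
  have h1 : (codeNat f.1 ++ codeNat f.2).length ≤
      (t.factors.flatMap fun f => codeNat f.1 ++ codeNat f.2).length :=
    length_le_flatMap (f := fun f : ℕ × ℕ => codeNat f.1 ++ codeNat f.2) hf
  have h2 := length_codeTerm_le hE ht
  rw [List.length_append, length_codeNat, length_codeNat] at h1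
  omega

end Lengths

lemma exists_factor_of_mem_systemText {S : List ProfileEquation} {v : ℕ}
    (h : .inr v ∈ systemText S) :
    ∃ E ∈ S, ∃ t ∈ E.lhs, ∃ f ∈ t.factors, f.1 = v := by
  simp only [systemText, equationText, termText, factorText, ofCells, List.mem_flatMap,
    List.mem_append, List.mem_cons, List.mem_map, List.not_mem_nil, reduceCtorEq, and_false,
    exists_false, or_false, false_or, Sum.inr.injEq] at h
  obtain ⟨E, hE, t, ht, f, hf, rfl⟩ := h
  exact ⟨E, hE, t, ht, f, hf, rfl⟩

lemma var_notMem_systemText (S : List ProfileEquation) : .inl .var ∉ systemText S := by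
  simp [systemText, equationText, termText, factorText, ofCells, encNums, enc, cells]

/-! ### The verification of a solution -/

namespace Prog

open Store

/-- Replace the variables by guessed profiles, and check the equations. -/
def solve : Prog := substituteAll * checkAll

lemma rel_solve {S : List ProfileEquation} {τ : Store}
    (h : Rel solve (ofText (systemText S).render) τ) :
    ∃ r : ℕ → Profile, ∀ E ∈ S, E.IsSolution r := by
  obtain ⟨_, h1, h2⟩ := rel_mul.1 h
  obtain ⟨r, rfl⟩ := rel_substituteAll _ (var_notMem_systemText S) h1
  rw [subst_systemText, ← systemCells_eq Profile.psums] at h2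
  obtain ⟨N, h3, h4⟩ := rel_checkAll _ r Profile.psums_ne_nil S h2
  exact ⟨r, fun E hE => isSolution_of_headSolution (fun k hk => h3 k hk E hE) (h4 E hE)⟩

lemma runs_solve {S : List ProfileEquation} {r : ℕ → Profile} (h : ∀ E ∈ S, E.IsSolution r)
    {m M : ℕ} (hm : (codeSystem S).length + 1 = m) (hM : (m + 5) ^ 3 = M) :
    (systemText S).render.length ≤ M ∧
    ∃ τ, Runs solve (ofText (systemText S).render) τ
      (55 * (M + 1) ^ 3 + m * (300 * (2 * M + 2) ^ 6)) := by
  -- The given solution may be arbitrarily large on variables without influence, so the restricted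
  -- one is verified instead.
  have hsol := isSolution_restrict h
  have hrhs : ∀ E ∈ S, E.rhs.Small m := fun E hE =>
    .of_code (by have := length_codeEquation_le hE; omega)
  have hcoef : ∀ E ∈ S, ∀ t ∈ E.lhs, t.coeff.Small m := fun E hE t ht =>
    .of_code (by have := length_codeTerm_le hE ht; omega)
  have hr : ∀ v, (restrict S r v).Small m := fun v => by
    rcases restrict_dominated h v with h0 | ⟨E, hE, hdom⟩
    · rw [h0]
      exact .zero (by omega)
    · exact (hrhs E hE).of_dominated hdom
  set r := restrict S r
  -- The lists of partial sums have at most `m * (m + 1)` symbols. The additional 2 leaves room for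
  -- the marker and the end of a variable's name, and the 3 comes from `length_textWith_le`.
  have hDM : (m * (m + 1) + 2 + 3) * (codeSystem S).length ≤ M := by
    rw [← hM]
    have : (codeSystem S).length ≤ m := by omega
    refine (Nat.mul_le_mul_left _ this).trans ?_
    nlinarith [Nat.zero_le (m ^ 2), Nat.zero_le (m ^ 3)]
  have hD : m * (m + 1) + 2 ≤ M := by
    rw [← hM]
    nlinarith [Nat.zero_le (m ^ 2), Nat.zero_le (m ^ 3)]
  have hm1 : m + 1 ≤ m * (m + 1) := Nat.le_mul_of_pos_left _ (by omega)
  have hmM : m ≤ M := by omega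
  have hsubst : ∀ g : ℕ → List Cell, (∀ v, g v = .var :: enc v ++ [.endNum] ∨
      g v = encNums (r v).psums) → ((systemText S).subst g).length ≤ M := by
    intro g hg
    rw [subst_systemText]
    refine (length_textWith_le fun E hE => ⟨((hrhs E hE).length_psums).trans (by omega),
      fun t ht => ⟨((hcoef E hE t ht).length_psums).trans (by omega), fun f hf => ?_⟩⟩).trans hDM
    rcases hg f.1 with hg | hg
    · have := length_codeFactor_le hE ht hf
      rw [hg]
      simp
      omega
    · rw [hg]
      exact (hr _).length_psums.trans (by omega)
  refine ⟨hsubst _ fun v => .inl rfl, ?_⟩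
  have e1 := runs_substituteAll r (M := M) (systemText S) (var_notMem_systemText S)
    (fun v hv => by
      obtain ⟨E, hE, t, ht, f, hf, rfl⟩ := exists_factor_of_mem_systemText hv
      have h1 := length_codeFactor_le hE ht hf
      have h2 := (hr f.1).length_psums
      have h3 := (hr f.1).length_entries
      exact ⟨by omega, by omega, by omega⟩) hsubst
  have hshift : ∀ (p : Profile) (k : ℕ), p.Small m → (encNums (shift^[k] p.psums)).length ≤ m * (m + 1) :=
    fun p k hp => (length_encNums_shift_le _ k).trans hp.length_psums
  have hlast : ∀ p : Profile, p.Small m → ∀ k,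
      decide (k = m - 1) → (shift^[k] p.psums).length = 1 := by
    intro p hp k hk
    rw [length_iterate_shift p.psums_ne_nil, of_decide_eq_true hk]
    have := hp.1
    simp [psums]
    omega
  -- Lists of at most `m` numbers are singletons after `m - 1` shifts. The bound `2 * M + 1`
  -- provides for the squares, whose size may be twice that of the right-hand side.
  obtain ⟨τ, e2⟩ := runs_checkAll Profile.psums r Profile.psums_ne_nil S (m - 1) (2 * M + 1)
    (by
      have := card_le_flatMap (l := S) (f := codeEquation) fun E _ => by simp [codeEquation]
      rw [codeSystem] at hm
      omega)
    (fun k hk E hE => by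
      refine ⟨fun t ht => ⟨(hshift _ k (hcoef E hE t ht)).trans (by omega),
        hlast _ (hcoef E hE t ht) k, ?_, fun f hf => ⟨(hshift _ k (hr _)).trans (by omega), ?_,
          hlast _ (hr _) k⟩⟩, ?_, (hshift _ k (hrhs E hE)).trans (by omega),
          hlast _ (hrhs E hE) k, ?_⟩
      · have h1 := card_le_flatMap (l := t.factors) (f := fun f => codeNat f.1 ++ codeNat f.2)
          fun f _ => by simp [codeNat]
        have h2 := length_codeTerm_le hE ht
        omega
      · have := length_codeFactor_le hE ht hf
        omega
      · have h1 := card_le_flatMap (l := E.lhs) (f := codeTerm) fun t _ => by simp [codeTerm]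
        have h2 := length_codeEquation_le hE
        omega
      · have h2 := hshift _ k (hrhs E hE)
        have h1 := (size_firstNum_le (shift^[k] E.rhs.psums)).trans h2
        simp only
        omega)
    (fun k hk => by
      rw [systemCells_eq]
      refine (length_textWith_le (D := m * (m + 1) + 2) fun E hE =>
        ⟨(hshift _ k (hrhs E hE)).trans (by omega), fun t ht =>
        ⟨(hshift _ k (hcoef E hE t ht)).trans (by omega), fun f hf =>
          (hshift _ k (hr _)).trans (by omega)⟩⟩).trans (by omega))
    (fun k hk E hE => (headSolution_iff r E k).2 (congrArg (psumHom k) (hsol E hE)))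
  refine ⟨τ, (e1.mul (Q := checkAll) (n := m * (300 * (2 * M + 2) ^ 6)) ?_)⟩
  rw [subst_systemText, ← systemCells_eq Profile.psums]
  exact e2.mono (le_of_eq (by congr 1; omega))

/-- Parse the input, and verify a solution. -/
def verify (P : Prog) : Prog :=
  move .x .y * (P * (isEmpty .y * (move .x .w * solve)))

end Prog

/-! ### Membership in NP -/

open Prog Store in
/-- If systems of equations can be parsed, then their solvability is in NP. -/
theorem inNP_of_parses {α : Type} (P : Prog) (sys : α → List ProfileEquation)
    (hP : Parses P (fun a => (codeSystem (sys a)).map EqSymbol.toCell)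
      fun a => (systemText (sys a)).render) :
    InNP ({w | ∃ a, codeSystem (sys a) = w ∧ ∃ r : ℕ → Profile, ∀ E ∈ sys a, E.IsSolution r} :
      Language EqSymbol) := by
  obtain ⟨K, hK⟩ := hP.runs
  have hget : (ofText []).get = fun _ => [] := by
    funext k
    cases k <;> rfl
  -- The verifier delivers the input reversed in `x`; moving it to `y` puts the first letter on top.
  have hstart : ∀ w : List EqSymbol, Det (move .x .y)
      ((ofText []).set .x (w.reverse.map EqSymbol.toCell))
      (clean {ofText [] with y := w.map EqSymbol.toCell ++ []}) (2 * w.length + 1) := fun w =>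
    (det_move (by decide) _).congr (by simp [Store.get, Store.set, ofText, clean, List.map_reverse])
      (by simp [Store.get, Store.set])
  -- This is `(m + 5) ^ 3` for `m = |w| + 1`, as in `runs_solve`.
  let M : Polynomial ℕ := (Polynomial.X + 6) ^ 3
  refine inNP_of_regular EqSymbol.toCell Reg.x (verify P).matches'
    (RegularExpression.isRegular_matches' _)
    (2 * Polynomial.X + 1 + (Polynomial.C K * (Polynomial.X + 1) ^ 2 + (1 + (2 * M + 1 +
      (55 * (M + 1) ^ 3 + (Polynomial.X + 1) * (300 * (2 * M + 2) ^ 6)))))) _ fun w => ?_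
  rw [← hget, ← get_set]
  simp only [execAll_get, Option.isSome_map]
  constructor
  · rintro ⟨a, rfl, r, hr⟩
    obtain ⟨hlen, τ, hsolve⟩ := runs_solve hr rfl rfl
    have e1 := (hstart (codeSystem (sys a))).1.mul ((hK (ofText []) a []).mul
      ((det_isEmpty (k := .y) rfl).1.mul ((det_move (i := .x) (j := .w) (by decide) _).1.mul
        (show Runs solve _ τ _ by simpa [Store.get, Store.set, ofText, clean] using hsolve))))
    obtain ⟨y, hy, hy', hl⟩ := e1
    refine ⟨y, hy, hl.trans ?_, by rw [hy']; rfl⟩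
    have hlen' : (clean {ofText [] with
        y := [], x := (systemText (sys a)).render.reverse ++ (ofText []).x}).x.length ≤
          ((codeSystem (sys a)).length + 1 + 5) ^ 3 := by
      simpa [clean, ofText] using hlen
    simp only [M, Polynomial.eval_add, Polynomial.eval_mul, Polynomial.eval_pow, Polynomial.eval_X,
      Polynomial.eval_C, Polynomial.eval_ofNat, Polynomial.eval_one, List.length_map, Store.get,
      add_assoc, Nat.reduceAdd] at hlen' ⊢
    omega
  · rintro ⟨y, hy, -, h⟩
    obtain ⟨τ, h⟩ := Option.isSome_iff_exists.1 h
    have h : Rel (verify P) _ τ := ⟨y, hy, h⟩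
    obtain ⟨_, h1, h⟩ := rel_mul.1 h
    obtain rfl := (hstart w).2 _ h1
    obtain ⟨_, h1, h⟩ := rel_mul.1 h
    obtain ⟨a, rest, hw, rfl⟩ := hP.sound _ _ h1
    obtain ⟨_, h1, h⟩ := rel_mul.1 h
    obtain ⟨hrest, rfl⟩ := (rel_isEmpty _).1 h1
    obtain rfl : rest = [] := hrest
    obtain ⟨_, h1, h⟩ := rel_mul.1 h
    obtain rfl := (det_move (by decide) _).2 _ h1
    refine ⟨a, ?_, rel_solve (τ := τ) (by simpa [Store.get, Store.set, ofText, clean] using h)⟩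
    simp only [List.append_nil] at hw
    exact (List.map_injective_iff.2 EqSymbol.toCell_injective hw).symm

theorem mainTheorem10 : InNP SolvableEquations ∧ InNP SolvableSystems := by
  refine ⟨?_, inNP_of_parses _ id Prog.parses_system⟩
  -- A single equation is treated as a system with one member; only the parser differs.
  have h := inNP_of_parses Prog.parseEquation (fun E : ProfileEquation => [E])
    (by simpa [codeSystem, systemText] using Prog.parses_equation)
  have e : ({w | ∃ E, codeSystem [E] = w ∧ ∃ r : ℕ → Profile, ∀ F ∈ [E], F.IsSolution r} :
      Language EqSymbol) = SolvableEquations := by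
    ext w
    simp [SolvableEquations, codeSystem]
  exact e ▸ h
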